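/- **Setting.** Let $F:\mathbb R^d\times\mathbb R^s\to\mathbb R$ be locally Lipschitz, let $G:\mathbb R^{d}\times\mathbb R^s\to\mathbb R^p$, $H:\mathbb R^{d}\times\mathbb R^s\to\mathbb R^q$, $f:\mathbb R^{d}\times\mathbb R^s\to\mathbb R$, $g:\mathbb R^{d}\times\mathbb R^s\to\mathbb R^m$, $h:\mathbb R^{d}\times\mathbb R^s\to\mathbb R^n$ be continuously differentiable, and let $\nabla_y f,\nabla_y g_i,\nabla_y h_i$ be continuously differentiable in $(x,y)$. Put $$Y(x)=\{y: g(x,y)\le 0,\ h(x,y)=0\},\quad V(x)=\inf_{y\in Y(x)}f(x,y),\quad S(x)=\operatorname{argmin}_{y\in Y(x)}f(x,y),$$ and consider the combined program $$\text{(CP)}\quad \min_{x,y,u,v} F(x,y)\ \text{ s.t. }\ f(x,y)-V(x)\le 0,\ G(x,y)\le 0,\ H(x,y)=0,\ h(x,y)=0,$$ $$\nabla_yf(x,y)+u\nabla_yg(x,y)+v\nabla_yh(x,y)=0,\quad 0\le -g(x,y)\perp u\ge 0,$$ where $u\nabla_y g:=\sum_i u_i\nabla_y g_i$ and $v\nabla_y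 h:=\sum_i v_i\nabla_y h_i$. For a feasible point $z^*=(x^*,y^*,u^*,v^*)$ put $I_G^*=\{i:G_i(x^*,y^*)=0\}$, $\mathcal I^*=\{i:g_i(x^*,y^*)=0<u^*_i\}$, $\mathcal J^*=\{i:g_i(x^*,y^*)=0=u_i^*\}$, $\mathcal K^*=\{i:g_i(x^*,y^*)<0=u_i^*\}$. Let $\partial$ denote the limiting (Mordukhovich) subdifferential. Index the inequality constraints of (CP) so that $\varphi_0(x,y,u,v)=f(x,y)-V(x)$ and $\varphi_i=G_i$ for $i=1,\dots,p$, let $A^*$ be the set of those active at $z^*$, and let $\psi_j$ be all the equality constraint functions ($H_i$, $h_i$ and the components of $\nabla_yf+u\nabla_yg+v\nabla_yh$), all regarded as functions of $z=(x,y,u,v)$. *RCRCQ for (CP) at $z^*$* means: for all $A\subseteq A^*$, $\mathcal I_5,\mathcal I_6\subseteq\mathcal J^*$, all $\zeta_i^*\in\partial\varphi_i(z^*)$ $(i\in A)$, and all sequences $z^k\to z^*$ with $z^k\ne z^*$ and $\zeta^k_i\in\partial\varphi_i(z^k)$ with $\zeta^k_i\to\zeta_i^*$ $(i\in A)$, for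 all sufficiently large $k$ the set of vectors $$\{\zeta_i^k\}_{i\in A}\cup\{\nabla\psi_j(z^k)\}_{j}\cup\{\nabla(-g_i)(z^k)\}_{i\in\mathcal I^*\cup\mathcal I_5}\cup\{\nabla (u_i)\}_{i\in\mathcal K^*\cup\mathcal I_6}$$ has the same rank as the corresponding set at $z^*$ (with $\zeta^*_i$ in place of $\zeta^k_i$). *M-stationarity of $z^*$ for (CP)* means: $z^*$ is feasible and there are $\xi\in\partial F(z^*)$ (with $F$ regarded as a function of $z$), $\zeta_i\in\partial\varphi_i(z^*)$ and $\lambda_i\ge0$ $(i\in A^*)$, reals $\mu_j$, and $a,b\in\mathbb R^m$ with $b_i=0$ for $i\in\mathcal I^*$, $a_i=0$ for $i\in\mathcal K^*$, and either $a_i>0,\ b_i>0$ or $a_ib_i=0$ for $i\in\mathcal J^*$, such that $$\xi+\sum_{i\in A^*}\lambda_i\zeta_i+\sum_j\mu_j\nabla\psi_j(z^*)-\sum_i a_i\nabla(-g_i)(z^*)-\sum_i b_i\nabla(u_i)=0.$$ **Theorem.** Let $(x^*,y^*,u^*,v^*)$ be a local solution of (CP). Suppose that one of the following holds. (a) $Y(x)=Y$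 is independent of $x$ and $Y$ is compact; in this case put $W(x)=\{\nabla_xf(x,y):y\in S(x)\}$. (b) $\bigcup_{x\in U}Y(x)$ is bounded for some neighbourhood $U$ of $x^*$, and for every $y\in S(x^*)$ MFCQ holds at $y$ (the vectors $\nabla_yh_i(x^*,y)$ are linearly independent, and some $t$ satisfies $\langle\nabla_yh_i(x^*,y),t\rangle=0$ for all $i$ and $\langle\nabla_yg_i(x^*,y),t\rangle<0$ for all $i$ with $g_i(x^*,y)=0$); in this case put $$W(x)=\bigcup_{y\in S(x)}\{\nabla_xf(x,y)+u\nabla_xg(x,y)+v\nabla_xh(x,y):(u,v)\in M(x,y)\},$$ $$M(x,y)=\{(u,v):\nabla_yf(x,y)+u\nabla_yg(x,y)+v\nabla_yh(x,y)=0,\ u\ge0,\ \langle g(x,y),u\rangle=0\}.$$ For $\mathcal I_2\subseteq I_G^*$, $\mathcal I_3,\mathcal I_4\subseteq\mathcal J^*$ and $\alpha\in\{0,1\}$ let $$J'(x,y,u,v,\alpha,w)=\begin{bmatrix}\nabla(\nabla_yf+u\nabla_yg+v\nabla_yh)(x,y)&\nabla_yh(x,y)^T&\nabla_yg(x,y)^T\\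 \nabla h(x,y)&0&0\\ \nabla H(x,y)&0&0\\ \nabla G_{\mathcal I_2}(x,y)&0&0\\ \nabla g_{\mathcal I^*\cup\mathcal I_3}(x,y)&0&0\\ 0&0&E_{\mathcal K^*\cup\mathcal I_4}\\ \alpha(\nabla f(x,y)-(w,0))&0&0\end{bmatrix},$$ where $\nabla$ is the derivative in $(x,y)$ and $E_{\mathcal K^*\cup\mathcal I_4}$ has the rows $e_i^T\in\mathbb R^m$, $i\in\mathcal K^*\cup\mathcal I_4$. Assume that for all such $\mathcal I_2,\mathcal I_3,\mathcal I_4,\alpha$, every $w^*\in\operatorname{co}W(x^*)$, and all sequences $x^k\to x^*$, $y^k\to y^*$, $u^k\to u^*$, $v^k\to v^*$, $w^k\to w^*$ with $w^k\in\operatorname{co}W(x^k)$, the matrices $J'(x^k,y^k,u^k,v^k,\alpha,w^k)$ and $J'(x^*,y^*,u^*,v^*,\alpha,w^*)$ have the same rank for all sufficiently large $k$. Then RCRCQ for (CP) holds at $(x^*,y^*,u^*,v^*)$, and $(x^*,y^*,u^*,v^*)$ is an M-stationary point of (CP). -/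

import Mathlib

open Filter Topology

/-- `ℝ^ι` with its Euclidean norm and inner product. -/
abbrev Vec (ι : Type) [Fintype ι] : Type := EuclideanSpace ℝ ι

/-! ### Limiting subdifferential -/

section Subdifferential

variable {E : Type*} [NormedAddCommGroup E] [InnerProductSpace ℝ E]

/-- Fréchet (regular) subdifferential of `φ` at `x`: all `ζ` with
`φ x' - φ x - ⟪ζ, x' - x⟫ ≥ o(‖x' - x‖)`. -/
def regularSubdiff (φ : E → ℝ) (x : E) : Set E :=
  {ζ | ∀ ε > 0, ∀ᶠ x' in 𝓝 x, φ x' - φ x - inner ℝ ζ (x' - x) ≥ -(ε * ‖x' - x‖)}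

/-- Limiting (Mordukhovich) subdifferential of `φ` at `x`. -/
def limitingSubdiff (φ : E → ℝ) (x : E) : Set E :=
  {ζ | ∃ (xs : ℕ → E) (ζs : ℕ → E),
    Tendsto xs atTop (𝓝 x) ∧ Tendsto (fun k => φ (xs k)) atTop (𝓝 (φ x)) ∧
    (∀ k, ζs k ∈ regularSubdiff φ (xs k)) ∧ Tendsto ζs atTop (𝓝 ζ)}

end Subdifferential

/-! ### Systems of inequalities, equalities and complementarity constraints -/

/-- The data of the feasibility system
`g i z ≤ 0`, `h i z = 0`, `0 ≤ G i z ⟂ H i z ≥ 0`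
(without abstract set constraint: the constraint set `C` is the whole space, whose normal cones
are `{0}`). -/
structure FeasSystem (E ι κ τ : Type*) where
  g : ι → E → ℝ
  h : κ → E → ℝ
  G : τ → E → ℝ
  H : τ → E → ℝ

namespace FeasSystem

variable {E ι κ τ : Type*}

/-- The feasible region. -/
def feasible (S : FeasSystem E ι κ τ) : Set E :=
  {z | (∀ i, S.g i z ≤ 0) ∧ (∀ i, S.h i z = 0) ∧
    ∀ i, 0 ≤ S.G i z ∧ 0 ≤ S.H i z ∧ S.G i z * S.H i z = 0}

/-- Active inequality constraints at `z`. -/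
def activeSet (S : FeasSystem E ι κ τ) (z : E) : Set ι := {i | S.g i z = 0}

/-- The index set `I* = {i : 0 = G i z < H i z}`. -/
def setI (S : FeasSystem E ι κ τ) (z : E) : Set τ := {i | S.G i z = 0 ∧ 0 < S.H i z}

/-- The index set `J* = {i : 0 = G i z = H i z}`. -/
def setJ (S : FeasSystem E ι κ τ) (z : E) : Set τ := {i | S.G i z = 0 ∧ S.H i z = 0}

/-- The index set `K* = {i : G i z > H i z = 0}`. -/
def setK (S : FeasSystem E ι κ τ) (z : E) : Set τ := {i | 0 < S.G i z ∧ S.H i z = 0}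

/-- `z₀` is a local minimizer of `φ` over the feasible region. -/
def IsLocalSolution [TopologicalSpace E] (S : FeasSystem E ι κ τ) (φ : E → ℝ) (z₀ : E) : Prop :=
  z₀ ∈ S.feasible ∧ IsLocalMinOn φ S.feasible z₀

variable [NormedAddCommGroup E] [InnerProductSpace ℝ E] [CompleteSpace E]

/-- The set of vectors
`{v i}_{i ∈ A} ∪ {∇ h i (z)}_i ∪ {∇ G i (z)}_{i ∈ P} ∪ {∇ H i (z)}_{i ∈ Q}`. -/
def gradientSet (S : FeasSystem E ι κ τ) (A : Set ι) (P Q : Set τ) (z : E) (v : ι → E) : Set E :=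
  (v '' A) ∪ Set.range (fun i => gradient (S.h i) z) ∪
    ((fun i => gradient (S.G i) z) '' P) ∪ ((fun i => gradient (S.H i) z) '' Q)

/-- The relaxed constant rank constraint qualification at `z₀`. -/
def RCRCQ (S : FeasSystem E ι κ τ) (z₀ : E) : Prop :=
  ∀ (I₄ : Set ι) (I₅ I₆ : Set τ),
    I₄ ⊆ S.activeSet z₀ → I₅ ⊆ S.setJ z₀ → I₆ ⊆ S.setJ z₀ →
    ∀ v₀ : ι → E, (∀ i ∈ I₄, v₀ i ∈ limitingSubdiff (S.g i) z₀) →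
    ∀ (zs : ℕ → E) (vs : ℕ → ι → E),
      (∀ k, zs k ≠ z₀) → Tendsto zs atTop (𝓝 z₀) →
      (∀ k, ∀ i ∈ I₄, vs k i ∈ limitingSubdiff (S.g i) (zs k)) →
      (∀ i ∈ I₄, Tendsto (fun k => vs k i) atTop (𝓝 (v₀ i))) →
      ∀ᶠ k in atTop,
        Set.finrank ℝ (S.gradientSet I₄ (S.setI z₀ ∪ I₅) (S.setK z₀ ∪ I₆) (zs k) (vs k)) =
          Set.finrank ℝ (S.gradientSet I₄ (S.setI z₀ ∪ I₅) (S.setK z₀ ∪ I₆) z₀ v₀)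

/-- `z₀` is an M-stationary point of the problem of minimizing `φ` over the feasible region. -/
def MStationary [Fintype ι] [Fintype κ] [Fintype τ]
    (S : FeasSystem E ι κ τ) (φ : E → ℝ) (z₀ : E) : Prop :=
  z₀ ∈ S.feasible ∧
  ∃ (ξ : E) (v : ι → E) (lg : ι → ℝ) (lh : κ → ℝ) (lG lH : τ → ℝ),
    ξ ∈ limitingSubdiff φ z₀ ∧
    (∀ i ∈ S.activeSet z₀, v i ∈ limitingSubdiff (S.g i) z₀ ∧ 0 ≤ lg i) ∧
    (∀ i, i ∉ S.activeSet z₀ → lg i = 0) ∧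
    (∀ i ∈ S.setI z₀, lH i = 0) ∧
    (∀ i ∈ S.setK z₀, lG i = 0) ∧
    (∀ i ∈ S.setJ z₀, (0 < lG i ∧ 0 < lH i) ∨ lG i * lH i = 0) ∧
    ξ + ∑ i, lg i • v i + ∑ i, lh i • gradient (S.h i) z₀
      - ∑ i, lG i • gradient (S.G i) z₀ - ∑ i, lH i • gradient (S.H i) z₀ = 0

end FeasSystem

/-! ### Bilevel programs and the combined program -/

/-- The vector `(a, b)`. -/
noncomputable def pair {ι κ : Type} [Fintype ι] [Fintype κ] (a : Vec ι) (b : Vec κ) :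
    Vec (ι ⊕ κ) :=
  WithLp.toLp 2 (Sum.elim a.ofLp b.ofLp)

/-- The first block `a` of the vector `(a, b)`. -/
noncomputable def fstBlock {ι κ : Type} [Fintype ι] [Fintype κ] (z : Vec (ι ⊕ κ)) : Vec ι :=
  WithLp.toLp 2 (fun i => z (Sum.inl i))

/-- The second block `b` of the vector `(a, b)`. -/
noncomputable def sndBlock {ι κ : Type} [Fintype ι] [Fintype κ] (z : Vec (ι ⊕ κ)) : Vec κ :=
  WithLp.toLp 2 (fun i => z (Sum.inr i))

/-- The functions defining the bilevel program
`min F(x,y)` s.t. `y ∈ S(x)`, `G(x,y) ≤ 0`, `H(x,y) = 0`, where `S(x)` is the solution set of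
`min_y f(x,y)` s.t. `g(x,y) ≤ 0`, `h(x,y) = 0`; here `x ∈ ℝ^d`, `y ∈ ℝ^s`. -/
structure BilevelProgram (d s p q m n : ℕ) where
  F : Vec (Fin d ⊕ Fin s) → ℝ
  G : Fin p → Vec (Fin d ⊕ Fin s) → ℝ
  H : Fin q → Vec (Fin d ⊕ Fin s) → ℝ
  f : Vec (Fin d ⊕ Fin s) → ℝ
  g : Fin m → Vec (Fin d ⊕ Fin s) → ℝ
  h : Fin n → Vec (Fin d ⊕ Fin s) → ℝ

namespace BilevelProgram

variable {d s p q m n : ℕ}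

/-- `∇_x φ (x,y)`. -/
noncomputable def gradX (φ : Vec (Fin d ⊕ Fin s) → ℝ) (w : Vec (Fin d ⊕ Fin s)) : Vec (Fin d) :=
  fstBlock (gradient φ w)

/-- `∇_y φ (x,y)`. -/
noncomputable def gradY (φ : Vec (Fin d ⊕ Fin s) → ℝ) (w : Vec (Fin d ⊕ Fin s)) : Vec (Fin s) :=
  sndBlock (gradient φ w)

/-- Standing smoothness assumptions: `F` is locally Lipschitz, all other functions are
continuously differentiable, and the `y`-gradients of the lower level functions are
continuously differentiable. -/
structure Regular (B : BilevelProgram d s p q m n) : Prop where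
  F_lip : LocallyLipschitz B.F
  G_smooth : ∀ i, ContDiff ℝ 1 (B.G i)
  H_smooth : ∀ i, ContDiff ℝ 1 (B.H i)
  f_smooth : ContDiff ℝ 1 B.f
  g_smooth : ∀ i, ContDiff ℝ 1 (B.g i)
  h_smooth : ∀ i, ContDiff ℝ 1 (B.h i)
  f_gradY_smooth : ContDiff ℝ 1 (gradY B.f)
  g_gradY_smooth : ∀ i, ContDiff ℝ 1 (gradY (B.g i))
  h_gradY_smooth : ∀ i, ContDiff ℝ 1 (gradY (B.h i))

/-- The lower level feasible set `Y(x)`. -/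
def Y (B : BilevelProgram d s p q m n) (x : Vec (Fin d)) : Set (Vec (Fin s)) :=
  {y | (∀ i, B.g i (pair x y) ≤ 0) ∧ ∀ i, B.h i (pair x y) = 0}

/-- The lower level solution set `S(x)`. -/
def S (B : BilevelProgram d s p q m n) (x : Vec (Fin d)) : Set (Vec (Fin s)) :=
  {y | y ∈ B.Y x ∧ ∀ y' ∈ B.Y x, B.f (pair x y) ≤ B.f (pair x y')}

/-- The lower level value function `V(x) = inf {f(x,y) : y ∈ Y(x)}`. (It is used only locally,
where `Y(x)` is compact and non-empty, so that the infimum is a genuine one.) -/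
noncomputable def V (B : BilevelProgram d s p q m n) (x : Vec (Fin d)) : ℝ :=
  sInf ((fun y => B.f (pair x y)) '' B.Y x)

/-- The `y`-gradient of the lower level Lagrangian,
`∇_y f + u ∇_y g + v ∇_y h`, at `w = (x,y)`. -/
noncomputable def gradYLagrangian (B : BilevelProgram d s p q m n) (u : Vec (Fin m))
    (v : Vec (Fin n)) (w : Vec (Fin d ⊕ Fin s)) : Vec (Fin s) :=
  gradY B.f w + ∑ i, u i • gradY (B.g i) w + ∑ i, v i • gradY (B.h i) w

/-- The set `M(x,y)` of lower level multipliers. -/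
def multipliers (B : BilevelProgram d s p q m n) (x : Vec (Fin d)) (y : Vec (Fin s)) :
    Set (Vec (Fin m) × Vec (Fin n)) :=
  {uv | B.gradYLagrangian uv.1 uv.2 (pair x y) = 0 ∧ (∀ i, 0 ≤ uv.1 i) ∧
    ∑ i, B.g i (pair x y) * uv.1 i = 0}

/-- The Mangasarian-Fromovitz constraint qualification for the system
`g(x,·) ≤ 0`, `h(x,·) = 0` at `y`. -/
def MFCQ (B : BilevelProgram d s p q m n) (x : Vec (Fin d)) (y : Vec (Fin s)) : Prop :=
  LinearIndependent ℝ (fun i => gradY (B.h i) (pair x y)) ∧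
  ∃ t : Vec (Fin s), (∀ i, inner ℝ (gradY (B.h i) (pair x y)) t = 0) ∧
    ∀ i, B.g i (pair x y) = 0 → inner ℝ (gradY (B.g i) (pair x y)) t < 0

/-- The set `{∇_x f(x,y) : y ∈ S(x)}` (used when `Y(x)` does not depend on `x`). -/
def WFixed (B : BilevelProgram d s p q m n) (x : Vec (Fin d)) : Set (Vec (Fin d)) :=
  (fun y => gradX B.f (pair x y)) '' B.S x

/-- The set of all `∇_x f(x,y) + u ∇_x g(x,y) + v ∇_x h(x,y)` with `y ∈ S(x)` and
`(u,v) ∈ M(x,y)`. -/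
def W (B : BilevelProgram d s p q m n) (x : Vec (Fin d)) : Set (Vec (Fin d)) :=
  {w | ∃ y ∈ B.S x, ∃ uv ∈ B.multipliers x y,
    w = gradX B.f (pair x y) + ∑ i, uv.1 i • gradX (B.g i) (pair x y)
      + ∑ i, uv.2 i • gradX (B.h i) (pair x y)}

/-- The space of the variables `((x,y),(u,v))` of the combined program. -/
abbrev Var (d s m n : ℕ) : Type := Vec ((Fin d ⊕ Fin s) ⊕ (Fin m ⊕ Fin n))

/-- The point `(x,y,u,v)`. -/
noncomputable def point (x : Vec (Fin d)) (y : Vec (Fin s)) (u : Vec (Fin m)) (v : Vec (Fin n)) :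
    Var d s m n :=
  pair (pair x y) (pair u v)

/-- The objective `F(x,y)` of the combined program. -/
noncomputable def cpObjective (B : BilevelProgram d s p q m n) (z : Var d s m n) : ℝ :=
  B.F (fstBlock z)

/-- The constraints of the combined program (CP):
`f(x,y) - V(x) ≤ 0`, `G(x,y) ≤ 0`, `H(x,y) = 0`, `h(x,y) = 0`,
`∇_y f(x,y) + u ∇_y g(x,y) + v ∇_y h(x,y) = 0`, `0 ≤ -g(x,y) ⟂ u ≥ 0`. -/
noncomputable def cp (B : BilevelProgram d s p q m n) :
    FeasSystem (Var d s m n) (Unit ⊕ Fin p) (Fin q ⊕ Fin n ⊕ Fin s) (Fin m) where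
  g := Sum.elim (fun _ z => B.f (fstBlock z) - B.V (fstBlock (fstBlock z)))
    (fun i z => B.G i (fstBlock z))
  h := Sum.elim (fun i z => B.H i (fstBlock z))
    (Sum.elim (fun i z => B.h i (fstBlock z))
      (fun j z => B.gradYLagrangian (fstBlock (sndBlock z)) (sndBlock (sndBlock z))
        (fstBlock z) j))
  G := fun i z => -B.g i (fstBlock z)
  H := fun i z => fstBlock (sndBlock z) i

/-- The matrix `J'(x,y,u,v,α,w)`, for the index sets `I₂`, `P = I* ∪ I₃`, `Q = K* ∪ I₄`.
Its three block columns are indexed by the components of `(x,y)`, of `v` and of `u`. -/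
noncomputable def Jmat (B : BilevelProgram d s p q m n) (I₂ : Set (Fin p)) (P Q : Set (Fin m))
    (x : Vec (Fin d)) (y : Vec (Fin s)) (u : Vec (Fin m)) (v : Vec (Fin n))
    (α : ℝ) (w : Vec (Fin d)) :
    Matrix (Fin s ⊕ Fin n ⊕ Fin q ⊕ I₂ ⊕ P ⊕ Q ⊕ Unit) ((Fin d ⊕ Fin s) ⊕ Fin n ⊕ Fin m) ℝ :=
  Matrix.of
    (Sum.elim
      (fun j => Sum.elim (gradient (fun w' => B.gradYLagrangian u v w' j) (pair x y)).ofLp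
        (Sum.elim (fun i => gradY (B.h i) (pair x y) j) (fun i => gradY (B.g i) (pair x y) j)))
    (Sum.elim (fun i => Sum.elim (gradient (B.h i) (pair x y)).ofLp 0)
    (Sum.elim (fun i => Sum.elim (gradient (B.H i) (pair x y)).ofLp 0)
    (Sum.elim (fun i => Sum.elim (gradient (B.G i) (pair x y)).ofLp 0)
    (Sum.elim (fun i => Sum.elim (gradient (B.g i) (pair x y)).ofLp 0)
    (Sum.elim (fun i => Sum.elim 0 (Sum.elim 0 (Pi.single (i : Fin m) 1)))
      (fun _ => Sum.elim (α • (gradient B.f (pair x y) - pair w 0)).ofLp 0)))))))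

/-- The constant rank hypothesis on `J'` at `(x,y,u,v)` with respect to the set-valued map
`x ↦ co W(x)`. -/
def ConstantRank (B : BilevelProgram d s p q m n) (W : Vec (Fin d) → Set (Vec (Fin d)))
    (x : Vec (Fin d)) (y : Vec (Fin s)) (u : Vec (Fin m)) (v : Vec (Fin n)) : Prop :=
  ∀ (I₂ : Set (Fin p)) (I₃ I₄ : Set (Fin m)),
    I₂ ⊆ {i | B.G i (pair x y) = 0} →
    I₃ ⊆ B.cp.setJ (point x y u v) → I₄ ⊆ B.cp.setJ (point x y u v) →
    ∀ α : ℝ, (α = 0 ∨ α = 1) → ∀ w ∈ convexHull ℝ (W x),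
    ∀ (xs : ℕ → Vec (Fin d)) (ys : ℕ → Vec (Fin s)) (us : ℕ → Vec (Fin m))
      (vs : ℕ → Vec (Fin n)) (ws : ℕ → Vec (Fin d)),
      Tendsto xs atTop (𝓝 x) → Tendsto ys atTop (𝓝 y) → Tendsto us atTop (𝓝 u) →
      Tendsto vs atTop (𝓝 v) → Tendsto ws atTop (𝓝 w) →
      (∀ k, ws k ∈ convexHull ℝ (W (xs k))) →
      ∀ᶠ k in atTop,
        (B.Jmat I₂ (B.cp.setI (point x y u v) ∪ I₃) (B.cp.setK (point x y u v) ∪ I₄)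
          (xs k) (ys k) (us k) (vs k) α (ws k)).rank =
        (B.Jmat I₂ (B.cp.setI (point x y u v) ∪ I₃) (B.cp.setK (point x y u v) ∪ I₄)
          x y u v α w).rank

end BilevelProgram

/-! Everything rests on one fact about the value function: for x near x*, every Fréchet subgradient
of -V at x is the negative of an element of co W(x). It follows by separation from a one-sided
estimate, the field `descent` of `GradientMapAt`: if c < ⟨w,e⟩ for all w ∈ W(x), then V grows at
rate at least c for infinitely many of the steps x + t_k e_k, whenever t_k ↓ 0 and e_k → e. In case
(a) the minimizers at the shifted point are feasible at x as well, and comparing values of f is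
enough (`gradientMapAt_WFixed`). In case (b) they must first be moved back to Y(x). Linear
programming duality (`exists_multiplier_or_direction`) yields either an element of W(x) with ⟨w,e⟩ ≤
c or a direction along which the move works, and metric regularity of h repairs the equalities at
cost o(t) (`exists_feasible_perturbation`, `gradientMapAt_W`). Since co W is locally bounded and
outer semicontinuous, limiting subgradients of f - V have the form ∇f - (w,0) with w ∈ co W
(`mem_limitingSubdiff_value`). Lipschitz continuity of V is not needed: continuity and one-sided
calmness near x* suffice.

Consequently the vectors in RCRCQ are, up to sign and a permutation of coordinates, rows of J', with
α = 1 or 0 according to whether the value constraint is selected (`finrank_gradientSet`). The rank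
hypothesis therefore gives RCRCQ, even for sequences that may take the value z*
(`strongRCRCQ_of_constantRank`).

For M-stationarity the problem is penalized quadratically in three variables: the objective is
evaluated at z, the constraints at w, and c is a point of the complementarity set, coupled by
squared distances. Each nonsmooth function then meets only smooth terms, so no nonsmooth sum rule is
needed, and minimality in c gives the signs on the biactive indices (`exists_penaltyStationary`).
The resulting multipliers may blow up with the penalty parameter. A Carathéodory reduction modulo
the span of the gradients with free multipliers makes the remaining ones independent, constant rank
carries this independence to the limit, and independence in the limit bounds the reduced multipliers
(`exists_convergent_multipliers`). The limit is the M-stationarity system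
(`mStationary_of_strongRCRCQ`). -/

/-! ### Fréchet and limiting subgradients -/

section SubdifferentialCalculus

variable {E : Type*} [NormedAddCommGroup E] [InnerProductSpace ℝ E]

/-- Test the subgradient inequality along x + tζ with t ↓ 0. Only growth from above enters, which is
all that is available for f - V. -/
theorem norm_le_of_mem_regularSubdiff {φ : E → ℝ} {x ζ : E} {L : ℝ} (hL : 0 ≤ L)
    (h : ∀ᶠ x' in 𝓝 x, φ x' - φ x ≤ L * ‖x' - x‖) (hζ : ζ ∈ regularSubdiff φ x) : ‖ζ‖ ≤ L := by
  refine le_of_forall_pos_le_add fun ε hε => ?_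
  by_cases h0 : ζ = 0
  · subst h0; simp; positivity
  have hn : 0 < ‖ζ‖ := norm_pos_iff.mpr h0
  have ht : Tendsto (fun t : ℝ => x + t • ζ) (𝓝[>] 0) (𝓝 x) := by
    have : Tendsto (fun t : ℝ => x + t • ζ) (𝓝 0) (𝓝 (x + (0 : ℝ) • ζ)) :=
      Continuous.tendsto (by fun_prop) 0
    simpa using this.mono_left nhdsWithin_le_nhds
  obtain ⟨t, ⟨h1, h2⟩, ht0⟩ :=
    ((ht.eventually (h.and (hζ ε hε))).and self_mem_nhdsWithin).exists
  have ht0 : 0 < t := ht0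
  simp only [add_sub_cancel_left, inner_smul_right, real_inner_self_eq_norm_sq, norm_smul,
    Real.norm_eq_abs, abs_of_pos ht0] at h1 h2
  have h3 : t * ‖ζ‖ * ‖ζ‖ ≤ t * ‖ζ‖ * (L + ε) := by nlinarith
  exact le_of_mul_le_mul_left h3 (by positivity)

theorem zero_mem_regularSubdiff_of_isLocalMin {φ : E → ℝ} {x : E} (h : IsLocalMin φ x) :
    (0 : E) ∈ regularSubdiff φ x := by
  intro ε hε
  filter_upwards [h] with x' hx'
  have : 0 ≤ ε * ‖x' - x‖ := by positivity
  simp only [inner_zero_left]; linarith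

theorem regularSubdiff_congr {φ ψ : E → ℝ} {x ζ : E} (h : φ =ᶠ[𝓝 x] ψ)
    (hζ : ζ ∈ regularSubdiff φ x) : ζ ∈ regularSubdiff ψ x := by
  intro ε hε
  filter_upwards [h, hζ ε hε] with x' h1 h2
  rw [← h1, ← h.self_of_nhds]; exact h2

variable [CompleteSpace E]

theorem add_mem_regularSubdiff {φ ψ : E → ℝ} {x ζ q : E} (hζ : ζ ∈ regularSubdiff φ x)
    (hψ : HasGradientAt ψ q x) : ζ + q ∈ regularSubdiff (fun z => φ z + ψ z) x := by
  intro ε hε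
  have h1 := (hasGradientAt_iff_isLittleO.mp hψ).def (half_pos hε)
  filter_upwards [hζ (ε / 2) (half_pos hε), h1] with x' h2 h3
  rw [Real.norm_eq_abs] at h3
  have := neg_le_of_abs_le h3
  rw [inner_add_left]
  linarith

theorem neg_mem_regularSubdiff_of_isLocalMin {φ ψ : E → ℝ} {x q : E}
    (h : IsLocalMin (fun z => φ z + ψ z) x) (hψ : HasGradientAt ψ q x) :
    -q ∈ regularSubdiff φ x := by
  have hneg : HasGradientAt (fun z => -ψ z) (-q) x := by
    rw [hasGradientAt_iff_hasFDerivAt] at hψ ⊢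
    simpa using hψ.fun_neg
  have := add_mem_regularSubdiff (zero_mem_regularSubdiff_of_isLocalMin h) hneg
  simpa using this

theorem mem_regularSubdiff_of_hasGradientAt {ψ : E → ℝ} {x q : E} (hψ : HasGradientAt ψ q x) :
    q ∈ regularSubdiff ψ x := by
  have h0 : (0 : E) ∈ regularSubdiff (fun _ : E => (0 : ℝ)) x :=
    zero_mem_regularSubdiff_of_isLocalMin (Filter.Eventually.of_forall fun _ => le_rfl)
  simpa using add_mem_regularSubdiff h0 hψ

/-- Subtracting ψ leaves a subgradient ζ - q of the zero function, whose norm is at most 0. -/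
theorem eq_of_mem_regularSubdiff_of_hasGradientAt {ψ : E → ℝ} {x q ζ : E}
    (hψ : HasGradientAt ψ q x) (hζ : ζ ∈ regularSubdiff ψ x) : ζ = q := by
  have hneg : HasGradientAt (fun z => -ψ z) (-q) x := by
    rw [hasGradientAt_iff_hasFDerivAt] at hψ ⊢
    simpa using hψ.fun_neg
  have := norm_le_of_mem_regularSubdiff le_rfl
    (by simp) (add_mem_regularSubdiff hζ hneg)
  simpa [← sub_eq_add_neg, sub_eq_zero] using this

theorem ContDiff.hasGradientAt_gradient {ψ : E → ℝ} (hψ : ContDiff ℝ 1 ψ) (x : E) :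
    HasGradientAt ψ (gradient ψ x) x :=
  (hψ.differentiable one_ne_zero x).hasGradientAt

theorem ContDiff.continuous_gradient {ψ : E → ℝ} (hψ : ContDiff ℝ 1 ψ) :
    Continuous (gradient ψ) :=
  (InnerProductSpace.toDual ℝ E).symm.continuous.comp (hψ.continuous_fderiv one_ne_zero)

theorem limitingSubdiff_of_contDiff {ψ : E → ℝ} (hψ : ContDiff ℝ 1 ψ) (x : E) :
    limitingSubdiff ψ x = {gradient ψ x} := by
  ext ζ
  constructor
  · rintro ⟨xs, ζs, hx, -, hζ, hlim⟩
    have : ζs = fun k => gradient ψ (xs k) := by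
      funext k
      exact eq_of_mem_regularSubdiff_of_hasGradientAt (hψ.hasGradientAt_gradient _) (hζ k)
    rw [this] at hlim
    exact tendsto_nhds_unique hlim ((hψ.continuous_gradient.tendsto x).comp hx)
  · rintro rfl
    exact ⟨fun _ => x, fun _ => gradient ψ x, tendsto_const_nhds, tendsto_const_nhds,
      fun _ => mem_regularSubdiff_of_hasGradientAt (hψ.hasGradientAt_gradient x),
      tendsto_const_nhds⟩

/-- After division by s₀ this is 1 + b - b² ≤ √(1 + 2b) for |b| ≤ 1/4: a linearization of the square
root with quadratic error, used to pass from the squared positive part back to the function. -/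
theorem sqrt_lower_bound {s₀ s a : ℝ} (hs₀ : 0 < s₀) (hs : 0 ≤ s) (ha : |a| ≤ s₀ / 4)
    (h : s₀ ^ 2 + 2 * a * s₀ ≤ s ^ 2) : s₀ + a - a ^ 2 / s₀ ≤ s := by
  obtain ⟨b, rfl⟩ : ∃ b, a = b * s₀ := ⟨a / s₀, by field_simp⟩
  have hb : |b| ≤ 1 / 4 := by
    rw [abs_mul, abs_of_pos hs₀] at ha
    by_contra hcon
    push Not at hcon
    nlinarith
  obtain ⟨hb1, hb2⟩ := abs_le.mp hb
  have e : s₀ + b * s₀ - (b * s₀) ^ 2 / s₀ = s₀ * (1 + b - b ^ 2) := by field_simp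
  rw [e]
  refine le_of_abs_le (abs_le_of_sq_le_sq ?_ hs)
  have : (1 + b - b ^ 2) ^ 2 ≤ 1 + 2 * b := by nlinarith [sq_nonneg b, sq_nonneg (b ^ 2)]
  calc (s₀ * (1 + b - b ^ 2)) ^ 2 = s₀ ^ 2 * (1 + b - b ^ 2) ^ 2 := by ring
    _ ≤ s₀ ^ 2 * (1 + 2 * b) := by gcongr
    _ ≤ s ^ 2 := by linarith

omit [CompleteSpace E] in
/-- Chain rule for the square of the positive part, at a point where the function is positive. -/
theorem smul_mem_regularSubdiff_of_sq_posPart {φ : E → ℝ} {x ζ : E} {k : ℝ} (hk : 0 < k)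
    (hx : 0 < φ x) (hζ : ζ ∈ regularSubdiff (fun z => k / 2 * (max (φ z) 0) ^ 2) x) :
    (k * φ x)⁻¹ • ζ ∈ regularSubdiff φ x := by
  intro ε hε
  set s₀ := φ x with hs₀
  set ε' := k * s₀ * (ε / 2) with hε'
  have hks : 0 < k * s₀ := by positivity
  have hε'0 : 0 < ε' := by positivity
  -- C bounds the slope: |a| ≤ C‖z - x‖ below. The radius is chosen so that |a| ≤ s₀/4 and the
  -- quadratic error a²/s₀ costs only half of ε.
  set C := (‖ζ‖ + ε') / (k * s₀) with hC
  have hC0 : 0 < C := by positivity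
  have hball : ∀ᶠ z in 𝓝 x, ‖z - x‖ < min (s₀ / (4 * C)) (ε * s₀ / (2 * C ^ 2)) := by
    have : Tendsto (fun z => ‖z - x‖) (𝓝 x) (𝓝 0) := by
      simpa using (Continuous.tendsto (f := fun z => ‖z - x‖) (by fun_prop) x)
    exact this.eventually_lt_const (by positivity)
  filter_upwards [hζ ε' hε'0, hball] with z h1 h2
  have h3 := (lt_min_iff.mp h2).1
  have h4 := (lt_min_iff.mp h2).2
  rw [lt_div_iff₀ (by positivity)] at h3 h4
  set n := ‖z - x‖ with hn
  have hn0 : 0 ≤ n := norm_nonneg _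
  set a := (inner ℝ ζ (z - x) - ε' * n) / (k * s₀) with ha
  have hin : |inner ℝ ζ (z - x)| ≤ ‖ζ‖ * n := abs_real_inner_le_norm _ _
  obtain ⟨hin1, hin2⟩ := abs_le.mp hin
  have haC : |a| ≤ C * n := by
    rw [ha, abs_div, abs_of_pos hks, hC, div_mul_eq_mul_div]
    gcongr
    rw [abs_le]
    constructor <;> nlinarith [norm_nonneg ζ]
  have hak : a * (k * s₀) = inner ℝ ζ (z - x) - ε' * n := by
    rw [ha]; field_simp
  have hmain : s₀ ^ 2 + 2 * a * s₀ ≤ (max (φ z) 0) ^ 2 := by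
    have hm : max s₀ 0 = s₀ := max_eq_left hx.le
    simp only [← hs₀, hm] at h1
    have : k * (s₀ ^ 2 + 2 * a * s₀) ≤ k * (max (φ z) 0) ^ 2 := by nlinarith
    exact le_of_mul_le_mul_left this hk
  have hsqrt := sqrt_lower_bound hx (le_max_right _ _) (by linarith : |a| ≤ s₀ / 4) hmain
  have ha2 : a ^ 2 ≤ (C * n) ^ 2 := by
    rw [← sq_abs]; gcongr
  have ha3 : a ^ 2 / s₀ ≤ ε / 2 * n := by
    rw [div_le_iff₀ hx]
    nlinarith
  have hpos : 0 < s₀ + a - a ^ 2 / s₀ := by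
    have h5 : |a| ≤ s₀ / 4 := by linarith
    have h7 := neg_le_of_abs_le h5
    have h6 : a ^ 2 / s₀ ≤ s₀ / 4 := by
      rw [div_le_iff₀ hx, ← sq_abs]
      nlinarith [abs_nonneg a]
    linarith
  have hφ : max (φ z) 0 = φ z := by
    rcases le_total (φ z) 0 with h | h
    · rw [max_eq_right h] at hsqrt; linarith
    · exact max_eq_left h
  rw [hφ] at hsqrt
  have hae : a = (k * s₀)⁻¹ * inner ℝ ζ (z - x) - ε / 2 * n := by
    rw [ha, hε']; field_simp
  rw [real_inner_smul_left]
  linarith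

omit [CompleteSpace E] in
-- Where φ ≤ 0, calmness makes the squared positive part grow at most like ‖z - x‖², so every ε > 0
-- bounds the norm of its subgradients. No subgradient of φ itself need exist at such a point.
theorem eq_zero_of_mem_regularSubdiff_sq_posPart {φ : E → ℝ} {x ζ : E} {k L : ℝ} (hk : 0 < k)
    (hx : φ x ≤ 0) (hcalm : ∀ᶠ z in 𝓝 x, φ z - φ x ≤ L * ‖z - x‖)
    (hζ : ζ ∈ regularSubdiff (fun z => k / 2 * (max (φ z) 0) ^ 2) x) : ζ = 0 := by
  rw [← norm_le_zero_iff]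
  refine le_of_forall_pos_le_add fun ε hε => ?_
  refine norm_le_of_mem_regularSubdiff (by linarith) ?_ hζ
  have hball : ∀ᶠ z in 𝓝 x, ‖z - x‖ < ε / (k / 2 * L ^ 2 + 1) := by
    have : Tendsto (fun z => ‖z - x‖) (𝓝 x) (𝓝 0) := by
      simpa using (Continuous.tendsto (f := fun z => ‖z - x‖) (by fun_prop) x)
    exact this.eventually_lt_const (by positivity)
  filter_upwards [hcalm, hball] with z h1 h2
  rw [lt_div_iff₀ (by positivity)] at h2
  rw [max_eq_right hx]
  have hn := norm_nonneg (z - x)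
  have h3 : (max (φ z) 0) ^ 2 ≤ (L * ‖z - x‖) ^ 2 := by
    rcases le_total (φ z) 0 with h | h
    · rw [max_eq_right h]; nlinarith [sq_nonneg (L * ‖z - x‖)]
    · rw [max_eq_left h]; gcongr; linarith
  have h4 : k / 2 * (max (φ z) 0) ^ 2 ≤ k / 2 * (L * ‖z - x‖) ^ 2 := by gcongr
  have h5 : (‖z - x‖ * (k / 2 * L ^ 2)) * ‖z - x‖ ≤ ε * ‖z - x‖ := by
    gcongr; linarith
  nlinarith

/-- Minimizers of φ + k‖· - x‖² tend to x and carry regular subgradients, which are bounded.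
M-stationarity asks for a subgradient of the value constraint even if its multiplier vanishes. -/
theorem limitingSubdiff_nonempty [FiniteDimensional ℝ E] {φ : E → ℝ} {x : E} {R : ℝ}
    (hcont : ∀ᶠ z in 𝓝 x, ContinuousAt φ z)
    (hbdd : ∀ᶠ z in 𝓝 x, ∀ ζ ∈ regularSubdiff φ z, ‖ζ‖ ≤ R) :
    (limitingSubdiff φ x).Nonempty := by
  obtain ⟨δ, hδ, hδball⟩ := Metric.nhds_basis_closedBall.eventually_iff.mp (hcont.and hbdd)
  set K := Metric.closedBall x δ with hK
  have hKc : IsCompact K := isCompact_closedBall x δ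
  have hxK : x ∈ K := Metric.mem_closedBall_self hδ.le
  have hφK : ContinuousOn φ K := fun z hz => (hδball hz).1.continuousWithinAt
  have hmin : ∀ k : ℕ, ∃ z ∈ K, IsMinOn (fun z => φ z + k * ‖z - x‖ ^ 2) K z := fun k =>
    hKc.exists_isMinOn ⟨x, hxK⟩ (hφK.add (by fun_prop))
  choose zs hzK hzmin using hmin
  obtain ⟨m, hm⟩ := hKc.exists_isMinOn ⟨x, hxK⟩ hφK
  have hval : ∀ k : ℕ, φ (zs k) + k * ‖zs k - x‖ ^ 2 ≤ φ x := fun k => by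
    simpa using hzmin k hxK
  have hlow : ∀ k, φ m ≤ φ (zs k) := fun k => hm.2 (hzK k)
  have hzlim : Tendsto zs atTop (𝓝 x) := by
    rw [tendsto_iff_norm_sub_tendsto_zero]
    have hsq : Tendsto (fun k => ‖zs k - x‖ ^ 2) atTop (𝓝 0) := by
      have h0 : Tendsto (fun k : ℕ => (φ x - φ m) / (k : ℝ)) atTop (𝓝 0) :=
        tendsto_const_div_atTop_nhds_zero_nat _
      refine tendsto_of_tendsto_of_tendsto_of_le_of_le' tendsto_const_nhds h0
        (Eventually.of_forall fun k => by positivity) ?_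
      filter_upwards [eventually_gt_atTop 0] with k hk
      rw [le_div_iff₀ (by exact_mod_cast hk)]
      nlinarith [hval k, hlow k]
    have := (Real.continuous_sqrt.tendsto 0).comp hsq
    simpa [Function.comp_def] using this
  have hev : ∀ᶠ k in atTop, ∃ ζ, ζ ∈ regularSubdiff φ (zs k) ∧ ‖ζ‖ ≤ R := by
    have : ∀ᶠ k in atTop, zs k ∈ Metric.ball x δ := hzlim.eventually (Metric.ball_mem_nhds x hδ)
    filter_upwards [this] with k hk
    have hloc : IsLocalMin (fun z => φ z + k * ‖z - x‖ ^ 2) (zs k) :=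
      (hzmin k).isLocalMin (mem_of_superset (Metric.isOpen_ball.mem_nhds hk)
        Metric.ball_subset_closedBall)
    have hg : DifferentiableAt ℝ (fun z => (k : ℝ) * ‖z - x‖ ^ 2) (zs k) := by
      have : DifferentiableAt ℝ (fun z : E => ‖z - x‖ ^ 2) (zs k) :=
        DifferentiableAt.norm_sq ℝ (by fun_prop)
      fun_prop
    have hmem := neg_mem_regularSubdiff_of_isLocalMin hloc hg.hasGradientAt
    exact ⟨_, hmem, (hδball (Metric.ball_subset_closedBall hk)).2 _ hmem⟩
  obtain ⟨N, hN⟩ := eventually_atTop.mp hev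
  choose ζs hζ hζR using fun k => hN (k + N) (by omega)
  obtain ⟨ζ, -, σ, hσ, hζlim⟩ := tendsto_subseq_of_bounded
    (Metric.isBounded_closedBall (x := (0 : E)) (r := R)) (x := ζs) (fun k => by simpa using hζR k)
  have hz' : Tendsto (fun k => zs (σ k + N)) atTop (𝓝 x) :=
    hzlim.comp ((tendsto_add_atTop_nat N).comp hσ.tendsto_atTop)
  exact ⟨ζ, fun k => zs (σ k + N), fun k => ζs (σ k), hz',
    (hcont.self_of_nhds.tendsto.comp hz'), fun k => hζ _, hζlim⟩

end SubdifferentialCalculus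

/-! ### Carathéodory reduction and rank counting -/

section ConstantRankMultipliers

variable {E : Type*} [AddCommGroup E] [Module ℝ E]

/-- Carathéodory reduction modulo a subspace, preserving signs. -/
theorem exists_reduced_combination {σ : Type*} [Fintype σ] (L : Submodule ℝ E) (X : σ → E)
    (c : σ → ℝ) : ∃ c' : σ → ℝ, (∀ i, 0 ≤ c' i * c i) ∧ (∀ i, c i = 0 → c' i = 0) ∧
      (∑ i, c i • X i - ∑ i, c' i • X i ∈ L) ∧
      ∀ d : σ → ℝ, (∀ i, c' i = 0 → d i = 0) → ∑ i, d i • X i ∈ L → d = 0 := by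
  classical
  let P : (σ → ℝ) → Prop := fun c' => (∀ i, 0 ≤ c' i * c i) ∧ (∀ i, c i = 0 → c' i = 0) ∧
      (∑ i, c i • X i - ∑ i, c' i • X i ∈ L)
  have hP : {c' | P c'}.Nonempty := ⟨c, fun i => mul_self_nonneg _, fun i h => h, by simp⟩
  let N : (σ → ℝ) → ℕ := fun c' => (Finset.univ.filter fun i => c' i ≠ 0).card
  -- Among the sign-compatible coefficients with the same sum modulo L, one of minimal support is
  -- taken. A dependency d modulo L would shrink the support further.
  obtain ⟨c', hc', hmin⟩ := exists_minimalFor_of_wellFoundedLT P N hP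
  refine ⟨c', hc'.1, hc'.2.1, hc'.2.2, fun d hd hdL => ?_⟩
  by_contra hne
  obtain ⟨j, hj⟩ : ∃ j, d j ≠ 0 := by
    by_contra hcon
    push Not at hcon
    exact hne (funext hcon)
  -- The smallest ratio |c' i / d i| is the step along d at which a coefficient vanishes before any
  -- other changes sign.
  obtain ⟨i₀, hi₀, hi₀min⟩ := Finset.exists_min_image (Finset.univ.filter fun i => d i ≠ 0)
    (fun i => |c' i / d i|) ⟨j, by simpa using hj⟩
  have hdi₀ : d i₀ ≠ 0 := by simpa using hi₀
  set t := c' i₀ / d i₀ with ht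
  have hsign : ∀ i, 0 ≤ (c' i - t * d i) * c' i := by
    intro i
    by_cases hdi : d i = 0
    · rw [hdi]; simpa using mul_self_nonneg (c' i)
    · have h1 := hi₀min i (by simpa using hdi)
      rw [abs_div (c' i), le_div_iff₀ (abs_pos.mpr hdi), ← abs_mul] at h1
      have h2 : |t * d i| * |c' i| ≤ |c' i| * |c' i| := by gcongr
      rw [← abs_mul, abs_mul_abs_self] at h2
      nlinarith [le_abs_self (t * d i * c' i)]
  have hzero : ∀ i, c' i = 0 → c' i - t * d i = 0 := fun i hi => by simp [hi, hd i hi]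
  have hPnew : P (fun i => c' i - t * d i) := by
    refine ⟨fun i => ?_, fun i hi => hzero i (hc'.2.1 i hi), ?_⟩
    · by_cases hci : c' i = 0
      · simp [hzero i hci]
      · have h1 := mul_nonneg (hsign i) (hc'.1 i)
        have h2 : 0 < c' i * c' i := mul_self_pos.mpr hci
        have h3 : 0 ≤ ((c' i - t * d i) * c i) * (c' i * c' i) := by linarith
        exact nonneg_of_mul_nonneg_left h3 h2
    · have : ∑ i, c i • X i - ∑ i, (c' i - t * d i) • X i
          = (∑ i, c i • X i - ∑ i, c' i • X i) + t • ∑ i, d i • X i := by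
        simp only [sub_smul, Finset.sum_sub_distrib, Finset.smul_sum, smul_smul]
        abel
      rw [this]
      exact L.add_mem hc'.2.2 (L.smul_mem _ hdL)
  have hlt : N (fun i => c' i - t * d i) < N c' := by
    refine Finset.card_lt_card ⟨fun i hi => ?_, fun hsub => ?_⟩
    · simp only [Finset.mem_filter, Finset.mem_univ, true_and] at hi ⊢
      exact fun h => hi (hzero i h)
    · have hmem : i₀ ∈ Finset.univ.filter fun i => c' i ≠ 0 := by
        simpa using fun h => hdi₀ (hd i₀ h)
      have := hsub hmem
      simp [ht, hdi₀] at this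
  exact absurd (hmin hPnew hlt.le) (not_le.mpr hlt)

/-- Independence modulo the span of X '' A means that the vectors in T are independent and their
span meets that of A only in 0. The resulting count is a statement on ranks, which the constant rank
condition can transport to the limit. -/
theorem finrank_image_union_eq_add_ncard [FiniteDimensional ℝ E] {σ : Type*} [Fintype σ]
    (X : σ → E) (A T : Set σ)
    (h : ∀ d : σ → ℝ, (∀ i, i ∉ T → d i = 0) → ∑ i, d i • X i ∈ Submodule.span ℝ (X '' A) →
      d = 0) :
    Set.finrank ℝ (X '' (A ∪ T)) = Set.finrank ℝ (X '' A) + T.ncard := by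
  classical
  have hsum : ∀ d : T → ℝ, ∑ i : T, d i • X i
      = ∑ i, (if hi : i ∈ T then d ⟨i, hi⟩ else 0) • X i := by
    intro d
    rw [← Finset.sum_filter_of_ne (p := (· ∈ T)) (fun i _ h => by
      by_contra hi; simp [hi] at h), Finset.sum_subtype (p := (· ∈ T)) _ (by simp)]
    exact Finset.sum_congr rfl fun i _ => by simp
  have hinj : LinearIndependent ℝ (fun i : T => X i) := by
    rw [Fintype.linearIndependent_iff]
    intro d hd i
    have := h (fun i => if hi : i ∈ T then d ⟨i, hi⟩ else 0) (fun i hi => by simp [hi])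
      (by rw [← hsum, hd]; exact Submodule.zero_mem _)
    simpa using congrFun this i
  have hdisj : Submodule.span ℝ (X '' A) ⊓ Submodule.span ℝ (X '' T) = ⊥ := by
    rw [eq_bot_iff]
    rintro w ⟨hw1, hw2⟩
    rw [Set.image_eq_range] at hw2
    obtain ⟨d, rfl⟩ := (Submodule.mem_span_range_iff_exists_fun ℝ).mp hw2
    have := h (fun i => if hi : i ∈ T then d ⟨i, hi⟩ else 0) (fun i hi => by simp [hi])
      (by rw [← hsum]; exact hw1)
    have hd : ∀ i : T, d i = 0 := fun i => by simpa using congrFun this i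
    simp [hd]
  have hT : Module.finrank ℝ (Submodule.span ℝ (X '' T)) = T.ncard := by
    rw [Set.image_eq_range, finrank_span_eq_card hinj, ← Nat.card_eq_fintype_card,
      Nat.card_coe_set_eq]
  have := Submodule.finrank_sup_add_finrank_inf_eq (Submodule.span ℝ (X '' A))
    (Submodule.span ℝ (X '' T))
  rw [hdisj, hT, finrank_bot, add_zero, ← Submodule.span_union, ← Set.image_union] at this
  exact this

end ConstantRankMultipliers

/-! ### Convergence of multipliers under constant rank -/

section BoundedMultipliers

variable {E : Type*} [NormedAddCommGroup E] [NormedSpace ℝ E]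

/-- Coefficients of a convergent sequence of combinations of vectors which converge to linearly
independent vectors have a convergent subsequence. -/
theorem exists_tendsto_coefficients {σ : Type*} [Fintype σ] {Xs : ℕ → σ → E} {X : σ → E}
    (hX : ∀ i, Tendsto (fun k => Xs k i) atTop (𝓝 (X i))) (hli : LinearIndependent ℝ X)
    {c : ℕ → σ → ℝ} {y : E} (hy : Tendsto (fun k => ∑ i, c k i • Xs k i) atTop (𝓝 y)) :
    ∃ (c₀ : σ → ℝ) (φ : ℕ → ℕ), StrictMono φ ∧ Tendsto (fun k => c (φ k)) atTop (𝓝 c₀) ∧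
      ∑ i, c₀ i • X i = y := by
  let f : (σ → ℝ) →ₗ[ℝ] E := Fintype.linearCombination ℝ X
  have hf : ∀ e, f e = ∑ i, e i • X i := fun e => Fintype.linearCombination_apply ℝ X e
  have hker : LinearMap.ker f = ⊥ := by
    rw [LinearMap.ker_eq_bot']
    intro e he
    rw [hf] at he
    exact funext (Fintype.linearIndependent_iff.mp hli e he)
  obtain ⟨K, hK, hanti⟩ := f.exists_antilipschitzWith hker
  have hbound : ∀ e, ‖e‖ ≤ K * ‖f e‖ := fun e => by
    simpa using hanti.le_mul_dist e 0
  set δ : ℕ → ℝ := fun k => ∑ i, ‖Xs k i - X i‖ with hδ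
  have hδ0 : Tendsto δ atTop (𝓝 0) := by
    have : Tendsto δ atTop (𝓝 (∑ _i : σ, (0 : ℝ))) :=
      tendsto_finsetSum _ fun i _ => tendsto_iff_norm_sub_tendsto_zero.mp (hX i)
    simpa using this
  have hdiff : ∀ k, ‖∑ i, c k i • Xs k i - f (c k)‖ ≤ ‖c k‖ * δ k := by
    intro k
    rw [hf, ← Finset.sum_sub_distrib, hδ, Finset.mul_sum]
    refine (norm_sum_le _ _).trans (Finset.sum_le_sum fun i _ => ?_)
    rw [← smul_sub, norm_smul]
    gcongr
    exact norm_le_pi_norm (c k) i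
  have hyb : ∀ᶠ k in atTop, ‖∑ i, c k i • Xs k i‖ < ‖y‖ + 1 :=
    hy.norm.eventually_lt_const (by linarith)
  have hKpos : (0 : ℝ) < K := by exact_mod_cast hK
  -- With this threshold the error K‖c k‖ δ k is at most ‖c k‖/2 and is absorbed on the left.
  have hδs : ∀ᶠ k in atTop, δ k < 1 / (2 * K) := hδ0.eventually_lt_const (by positivity)
  have hcb : ∀ᶠ k in atTop, ‖c k‖ ≤ 2 * K * (‖y‖ + 1) := by
    filter_upwards [hyb, hδs] with k h1 h2
    rw [lt_div_iff₀ (by positivity)] at h2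
    have h3 := hbound (c k)
    have h4 : ‖f (c k)‖ ≤ ‖∑ i, c k i • Xs k i‖ + ‖c k‖ * δ k := by
      have := norm_sub_norm_le (f (c k)) (∑ i, c k i • Xs k i)
      rw [norm_sub_rev] at this
      linarith [hdiff k]
    have h5 : K * ‖f (c k)‖ ≤ K * ((‖y‖ + 1) + ‖c k‖ * δ k) := by gcongr; linarith
    have h6 : ‖c k‖ * (δ k * (2 * K)) ≤ ‖c k‖ * 1 := by gcongr
    linarith
  obtain ⟨N, hN⟩ := eventually_atTop.mp hcb
  obtain ⟨c₀, -, φ, hφ, hlim⟩ := tendsto_subseq_of_bounded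
    (Metric.isBounded_closedBall (x := (0 : σ → ℝ)) (r := 2 * K * (‖y‖ + 1)))
    (x := fun k => c (k + N)) (fun k => by simpa using hN (k + N) (by omega))
  have hφN : Tendsto (fun k => φ k + N) atTop atTop :=
    (tendsto_add_atTop_nat N).comp hφ.tendsto_atTop
  refine ⟨c₀, fun k => φ k + N, hφ.add_const N, hlim, ?_⟩
  have h1 : Tendsto (fun k => ∑ i, c (φ k + N) i • Xs (φ k + N) i) atTop
      (𝓝 (∑ i, c₀ i • X i)) :=
    tendsto_finsetSum _ fun i _ =>
      ((tendsto_pi_nhds.mp hlim i)).smul ((hX i).comp hφN)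
  exact tendsto_nhds_unique h1 (hy.comp hφN)

theorem exists_constant_subseq {α : Type*} [Finite α] (f : ℕ → α) :
    ∃ (a : α) (φ : ℕ → ℕ), StrictMono φ ∧ ∀ k, f (φ k) = a := by
  have : ∃ a, ∃ᶠ k in atTop, f k = a := by
    by_contra hcon
    push Not at hcon
    obtain ⟨k, hk⟩ := (eventually_all.mpr hcon).exists
    exact hk (f k) rfl
  obtain ⟨a, ha⟩ := this
  obtain ⟨φ, hφ, h⟩ := extraction_of_frequently_atTop ha
  exact ⟨a, φ, hφ, h⟩

/-- Under a relaxed constant rank condition the multipliers of a convergent sequence of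
combinations can be replaced by convergent ones, with the same signs outside of the set `A`
of unrestricted indices. -/
theorem exists_convergent_multipliers [FiniteDimensional ℝ E] {σ : Type*} [Fintype σ]
    {A T₀ : Set σ} {Xs : ℕ → σ → E} {X : σ → E}
    (hX : ∀ i, Tendsto (fun k => Xs k i) atTop (𝓝 (X i))) {c : ℕ → σ → ℝ}
    (hc : ∀ k i, i ∉ A → i ∉ T₀ → c k i = 0)
    (hrank : ∀ T ⊆ T₀, ∀ᶠ k in atTop,
      Set.finrank ℝ (Xs k '' (A ∪ T)) = Set.finrank ℝ (X '' (A ∪ T)))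
    {y : E} (hy : Tendsto (fun k => ∑ i, c k i • Xs k i) atTop (𝓝 y)) :
    ∃ (c' : ℕ → σ → ℝ) (c₀ : σ → ℝ) (φ : ℕ → ℕ), StrictMono φ ∧
      (∀ k, ∀ i ∉ A, 0 ≤ c' k i * c (φ k) i ∧ (c (φ k) i = 0 → c' k i = 0)) ∧
      (∀ i, Tendsto (fun k => c' k i) atTop (𝓝 (c₀ i))) ∧ ∑ i, c₀ i • X i = y := by
  classical
  -- The coefficients in A are set to zero first, so the reduction acts only on the sign-restricted
  -- ones; the part in A is recovered later from membership in the span.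
  choose c₁ hsign hzero hmem hli using fun k => exists_reduced_combination
    (Submodule.span ℝ (Xs k '' A)) (Xs k) (fun i => if i ∈ A then 0 else c k i)
  have hc₁A : ∀ k, ∀ i ∈ A, c₁ k i = 0 := fun k i hi => hzero k i (by simp [hi])
  have hmem' : ∀ k, ∑ i, c k i • Xs k i - ∑ i, c₁ k i • Xs k i
      ∈ Submodule.span ℝ (Xs k '' A) := by
    intro k
    have h1 : ∑ i, c k i • Xs k i - ∑ i, (if i ∈ A then 0 else c k i) • Xs k i
        ∈ Submodule.span ℝ (Xs k '' A) := by
      rw [← Finset.sum_sub_distrib]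
      refine Submodule.sum_mem _ fun i _ => ?_
      by_cases hi : i ∈ A
      · simpa [hi] using Submodule.smul_mem _ (c k i)
          (Submodule.subset_span (Set.mem_image_of_mem (Xs k) hi))
      · simp [hi]
    have := Submodule.add_mem _ h1 (hmem k)
    simpa using this
  -- There are finitely many possible supports, so one of them, T, may be assumed constant.
  obtain ⟨T, ψ, hψ, hT⟩ := exists_constant_subseq (fun k => {i | c₁ k i ≠ 0})
  have hTmem : ∀ k i, i ∈ T ↔ c₁ (ψ k) i ≠ 0 := fun k i => by rw [← hT k]; rfl
  have hTA : ∀ i ∈ T, i ∉ A := fun i hi hA => (hTmem 0 i).mp hi (hc₁A _ i hA)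
  have hTT₀ : T ⊆ T₀ := by
    intro i hi
    by_contra hcon
    exact (hTmem 0 i).mp hi (hzero _ i (by simp [hTA i hi, hc _ i (hTA i hi) hcon]))
  have hψt := hψ.tendsto_atTop
  -- The basis of the span over A is chosen at the limit; independence is an open condition, so it
  -- remains independent along the sequence.
  obtain ⟨κ, a, ha, hspan, hali⟩ := exists_linearIndependent' ℝ (fun i : A => X i)
  have : Finite κ := Finite.of_injective a ha
  have : Fintype κ := Fintype.ofFinite κ
  have hspan' : Submodule.span ℝ (Set.range fun j => X (a j)) = Submodule.span ℝ (X '' A) := by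
    rw [Set.image_eq_range]; exact hspan
  have hcard : Fintype.card κ = Set.finrank ℝ (X '' A) := by
    rw [Set.finrank, ← hspan']; exact (finrank_span_eq_card hali).symm
  have hrankA := hrank ∅ (Set.empty_subset _)
  rw [Set.union_empty] at hrankA
  let Y : (σ → E) → κ ⊕ T → E := fun Z => Sum.elim (fun j => Z (a j)) (fun i => Z i)
  -- For large k the rank over A ∪ T is the rank over A plus |T|. Both ranks are the same at the
  -- limit, where the basis vectors together with T thus have as many members as their span has
  -- dimensions.
  have hYli : LinearIndependent ℝ (Y X) := by
    obtain ⟨k, hk1, hk2⟩ := (hψt.eventually (hrankA.and (hrank T hTT₀))).exists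
    have h1 := finrank_image_union_eq_add_ncard (Xs (ψ k)) A T (fun d hd hdm =>
      hli (ψ k) d (fun i hi => hd i (fun h => (hTmem k i).mp h hi)) hdm)
    rw [hk1, hk2] at h1
    rw [linearIndependent_iff_card_eq_finrank_span, Fintype.card_sum, hcard,
      ← Nat.card_eq_fintype_card (α := T), Nat.card_coe_set_eq, ← h1]
    rw [Set.finrank, Set.finrank]
    have : Submodule.span ℝ (X '' (A ∪ T)) = Submodule.span ℝ (Set.range (Y X)) := by
      rw [Set.Sum.elim_range, Submodule.span_union, hspan', Set.image_union,
        Submodule.span_union, Set.image_eq_range X T]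
    rw [this]
  have hYlim : ∀ i, Tendsto (fun k => Y (Xs (ψ k)) i) atTop (𝓝 (Y X i)) := by
    rintro (j | i)
    · exact (hX _).comp hψt
    · exact (hX _).comp hψt
  -- The rank over A is constant, so the basis chosen at the limit also spans the vectors of A for
  -- large k.
  have hcoef : ∀ᶠ k in atTop, ∃ e : κ → ℝ,
      ∑ j, e j • Xs (ψ k) (a j)
        = ∑ i, c (ψ k) i • Xs (ψ k) i - ∑ i, c₁ (ψ k) i • Xs (ψ k) i := by
    have h1 : ∀ᶠ k in atTop, LinearIndependent ℝ (fun j => Xs (ψ k) (a j)) := by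
      have : Tendsto (fun k j => Xs (ψ k) (a j)) atTop (𝓝 fun j => X (a j)) :=
        tendsto_pi_nhds.mpr fun j => (hX _).comp hψt
      exact this.eventually (LinearIndependent.eventually hali)
    filter_upwards [h1, hψt.eventually hrankA] with k hk1 hk2
    rw [← Submodule.mem_span_range_iff_exists_fun]
    have hle : Submodule.span ℝ (Set.range fun j => Xs (ψ k) (a j))
        ≤ Submodule.span ℝ (Xs (ψ k) '' A) := by
      refine Submodule.span_mono ?_
      rintro _ ⟨j, rfl⟩
      exact ⟨a j, (a j).2, rfl⟩
    rw [Submodule.eq_of_le_of_finrank_eq hle]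
    · exact hmem' _
    · rw [finrank_span_eq_card hk1, hcard, ← hk2]; rfl
  obtain ⟨N, hN⟩ := eventually_atTop.mp hcoef
  choose e he using fun k => hN (k + N) (by omega)
  have hθt : Tendsto (fun k => ψ (k + N)) atTop atTop := hψt.comp (tendsto_add_atTop_nat N)
  have hTsum : ∀ (b : σ → ℝ), (∀ i, i ∉ T → b i = 0) → ∀ Z : σ → E,
      ∑ i : T, b i • Z i = ∑ i, b i • Z i := by
    intro b hb Z
    rw [← Finset.sum_subtype (Finset.univ.filter (· ∈ T)) (by simp) (fun i => b i • Z i),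
      Finset.sum_filter]
    refine Finset.sum_congr rfl fun i _ => ?_
    split_ifs with h
    · rfl
    · simp [hb i h]
  have hsum : ∀ k, ∑ i, (Sum.elim (e k) (fun i : T => c₁ (ψ (k + N)) i)) i • Y (Xs (ψ (k + N))) i
      = ∑ i, c (ψ (k + N)) i • Xs (ψ (k + N)) i := by
    intro k
    simp only [Fintype.sum_sum_type, Sum.elim_inl, Sum.elim_inr, Y]
    rw [he k, hTsum (c₁ (ψ (k + N))) (fun i hi => by
      by_contra h; exact hi ((hTmem _ i).mpr h))]
    abel
  obtain ⟨e₀, θ, hθ, hlim, hfin⟩ := exists_tendsto_coefficients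
    (fun i => (hYlim i).comp (tendsto_add_atTop_nat N)) hYli (y := y)
    (c := fun k => Sum.elim (e k) (fun i : T => c₁ (ψ (k + N)) i))
    (by simp only [Function.comp_def, hsum]; exact hy.comp hθt)
  rw [tendsto_pi_nhds] at hlim
  -- Since `a` is injective, the sum over j has at most one nonzero term; it vanishes off A, so
  -- there the reduced coefficients c₁ and their signs are unchanged.
  refine ⟨fun k i => c₁ (ψ (θ k + N)) i + ∑ j, if (a j : σ) = i then e (θ k) j else 0,
    fun i => (if hi : i ∈ T then e₀ (Sum.inr ⟨i, hi⟩) else 0) +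
      ∑ j, if (a j : σ) = i then e₀ (Sum.inl j) else 0,
    fun k => ψ (θ k + N), hψ.comp (hθ.add_const N), fun k i hi => ?_, fun i => ?_, ?_⟩
  · have h0 : ∑ j, (if (a j : σ) = i then e (θ k) j else 0) = 0 := by
      refine Finset.sum_eq_zero fun j _ => ?_
      rw [if_neg]
      rintro rfl
      exact hi (a j).2
    beta_reduce
    rw [h0, add_zero]
    have h1 := hsign (ψ (θ k + N)) i
    have h2 := hzero (ψ (θ k + N)) i
    simp only [hi, if_false] at h1 h2
    exact ⟨h1, h2⟩
  · refine Tendsto.add ?_ (tendsto_finsetSum _ fun j _ => ?_)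
    · split_ifs with hi
      · simpa using hlim (Sum.inr ⟨i, hi⟩)
      · have : ∀ k, c₁ (ψ (θ k + N)) i = 0 := fun k => by
          by_contra h; exact hi ((hTmem _ i).mpr h)
        simp [this]
    · split_ifs
      · simpa using hlim (Sum.inl j)
      · exact tendsto_const_nhds
  · rw [← hfin]
    simp only [Fintype.sum_sum_type, Y, Sum.elim_inl, Sum.elim_inr, add_smul,
      Finset.sum_add_distrib]
    rw [add_comm]
    congr 1
    · simp only [Finset.sum_smul]
      rw [Finset.sum_comm]
      refine Finset.sum_congr rfl fun j _ => ?_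
      simp [ite_smul]
    · rw [← hTsum _ (fun i hi => by simp [hi])]
      exact Finset.sum_congr rfl fun i _ => by simp

end BoundedMultipliers

/-! ### A theorem of the alternative -/

section Gordan

variable {E : Type*} [NormedAddCommGroup E] [InnerProductSpace ℝ E] [FiniteDimensional ℝ E]

/-- Theorem of the alternative of Gordan and Motzkin. -/
theorem exists_inner_pos_or_exists_combination_eq_zero {α β : Type*} [Fintype α] [Fintype β]
    (c : α → E) (b : β → E) :
    (∃ q : E, (∀ i, 0 < inner ℝ (c i) q) ∧ ∀ j, inner ℝ (b j) q = 0) ∨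
    ∃ (p : α → ℝ) (v : β → ℝ), (∀ i, 0 ≤ p i) ∧ (∃ i, p i ≠ 0) ∧
      ∑ i, p i • c i + ∑ j, v j • b j = 0 := by
  classical
  set L := Submodule.span ℝ (Set.range b) with hL
  set P := Lᗮ.starProjection with hP
  -- Projecting out the span of the `b j` reduces the alternative to whether 0 lies in the convex
  -- hull of the projected `c i`; if not, strict separation gives the direction.
  by_cases h0 : (0 : E) ∈ convexHull ℝ (Set.range fun i => P (c i))
  · right
    obtain ⟨ι, _, w, z, hw, hw1, hz, hsum⟩ := mem_convexHull_iff_exists_fintype.mp h0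
    choose a ha using hz
    have hcomb : ∀ g : α → E, ∑ j, (∑ i, if a i = j then w i else 0) • g j
        = ∑ i, w i • g (a i) := by
      intro g
      simp only [Finset.sum_smul]
      rw [Finset.sum_comm]
      exact Finset.sum_congr rfl fun i _ => by simp [ite_smul]
    have hproj : P (∑ j, (∑ i, if a i = j then w i else 0) • c j) = 0 := by
      rw [hcomb, map_sum, ← hsum]
      exact Finset.sum_congr rfl fun i _ => by rw [map_smul, ← ha]
    have hmem : ∑ j, (∑ i, if a i = j then w i else 0) • c j ∈ L := by
      rw [hP, Submodule.starProjection_apply_eq_zero_iff, Submodule.orthogonal_orthogonal] at hproj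
      exact hproj
    obtain ⟨v, hv⟩ := (Submodule.mem_span_range_iff_exists_fun ℝ).mp (Submodule.neg_mem _ hmem)
    refine ⟨fun j => ∑ i, if a i = j then w i else 0, v,
      fun j => Finset.sum_nonneg fun i _ => by split_ifs <;> simp [hw], ?_, ?_⟩
    · by_contra hcon
      push Not at hcon
      have : ∑ j, ∑ i, (if a i = j then w i else 0) = 1 := by
        rw [Finset.sum_comm]; simpa using hw1
      simp [hcon] at this
    · rw [hv, add_neg_cancel]
  · left
    have hcl : IsClosed (convexHull ℝ (Set.range fun i => P (c i))) :=
      ((Set.finite_range _).isCompact_convexHull (𝕜 := ℝ)).isClosed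
    obtain ⟨f, r, hf0, hf⟩ := geometric_hahn_banach_point_closed (convex_convexHull ℝ _) hcl h0
    set q' := (InnerProductSpace.toDual ℝ E).symm f with hq'
    have hfq : ∀ w, f w = inner ℝ q' w := fun w => by
      rw [hq', InnerProductSpace.toDual_symm_apply]
    refine ⟨P q', fun i => ?_, fun j => ?_⟩
    · rw [hP, ← Submodule.inner_starProjection_left_eq_right, ← hP, real_inner_comm, ← hfq]
      have := hf _ (subset_convexHull ℝ _ (Set.mem_range_self i))
      rw [map_zero] at hf0
      linarith
    · exact Submodule.inner_right_of_mem_orthogonal (Submodule.subset_span (Set.mem_range_self j))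
        (Submodule.starProjection_apply_mem _ _)

end Gordan

/-! ### Gradients of quadratic penalty terms -/

section GradientCalculus

variable {E : Type*} [NormedAddCommGroup E] [InnerProductSpace ℝ E] [CompleteSpace E]

theorem HasDerivAt.comp_hasGradientAt {p : ℝ → ℝ} {p' : ℝ} {g : E → ℝ} {q x : E}
    (hp : HasDerivAt p p' (g x)) (hg : HasGradientAt g q x) :
    HasGradientAt (fun z => p (g z)) (p' • q) x := by
  rw [hasGradientAt_iff_hasFDerivAt] at hg ⊢
  rw [map_smul]
  exact hp.comp_hasFDerivAt x hg

theorem HasGradientAt.fun_add' {f g : E → ℝ} {a b x : E} (hf : HasGradientAt f a x)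
    (hg : HasGradientAt g b x) : HasGradientAt (fun z => f z + g z) (a + b) x := by
  rw [hasGradientAt_iff_hasFDerivAt] at hf hg ⊢
  simpa using hf.fun_add hg

theorem HasGradientAt.fun_sum' {α : Type*} [Fintype α] {f : α → E → ℝ} {a : α → E} {x : E}
    (hf : ∀ i, HasGradientAt (f i) (a i) x) :
    HasGradientAt (fun z => ∑ i, f i z) (∑ i, a i) x := by
  simp only [hasGradientAt_iff_hasFDerivAt] at hf ⊢
  simpa using HasFDerivAt.fun_sum (u := Finset.univ) fun i _ => hf i

theorem hasGradientAt_half_norm_sub_sq (a x : E) :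
    HasGradientAt (fun z => 1 / 2 * ‖z - a‖ ^ 2) (x - a) x := by
  rw [hasGradientAt_iff_hasFDerivAt]
  have h1 : HasFDerivAt (fun z : E => z - a) (ContinuousLinearMap.id ℝ E) x :=
    (hasFDerivAt_id x).sub_const a
  have := (h1.norm_sq).const_mul (1 / 2)
  refine this.congr_fderiv ?_
  ext w
  simp

theorem hasDerivAt_half_posPart_sq (s : ℝ) :
    HasDerivAt (fun s : ℝ => 1 / 2 * (max s 0) ^ 2) (max s 0) s := by
  rcases lt_trichotomy s 0 with hs | rfl | hs
  · rw [max_eq_right hs.le]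
    refine (hasDerivAt_const s (0 : ℝ)).congr_of_eventuallyEq ?_
    filter_upwards [eventually_lt_nhds hs] with r hr
    simp [max_eq_right hr.le]
  · rw [hasDerivAt_iff_tendsto_slope_zero]
    simp only [zero_add, max_self, smul_eq_mul]
    refine squeeze_zero_norm (a := fun t : ℝ => |t|) (fun t => ?_)
      ((continuous_abs.tendsto' 0 0 abs_zero).mono_left nhdsWithin_le_nhds)
    rcases le_total t 0 with h | h
    · simp [max_eq_right h]
    · have e : t⁻¹ * (1 / 2 * t ^ 2 - 1 / 2 * 0 ^ 2) = t / 2 := by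
        rcases h.eq_or_lt with rfl | h'
        · simp
        · field_simp
          ring
      rw [max_eq_left h, e, Real.norm_eq_abs, abs_of_nonneg (by positivity), abs_of_nonneg h]
      linarith
  · rw [max_eq_left hs.le]
    have : HasDerivAt (fun r : ℝ => 1 / 2 * r ^ 2) s s := by
      have := (hasDerivAt_pow 2 s).const_mul (1 / 2)
      refine this.congr_deriv ?_
      norm_num
      ring
    refine this.congr_of_eventuallyEq ?_
    filter_upwards [eventually_gt_nhds hs] with r hr
    simp [max_eq_left hr.le]

theorem hasDerivAt_half_sub_sq (s c : ℝ) :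
    HasDerivAt (fun s : ℝ => 1 / 2 * (s - c) ^ 2) (s - c) s := by
  have := (((hasDerivAt_id s).sub_const c).pow 2).const_mul (1 / 2)
  refine this.congr_deriv ?_
  simp

omit [CompleteSpace E] in
theorem regularSubdiff_subset_limitingSubdiff {φ : E → ℝ} {x ζ : E}
    (h : ζ ∈ regularSubdiff φ x) : ζ ∈ limitingSubdiff φ x :=
  ⟨fun _ => x, fun _ => ζ, tendsto_const_nhds, tendsto_const_nhds, fun _ => h,
    tendsto_const_nhds⟩

end GradientCalculus

/-- First order conditions for the projection onto the complementarity set. -/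
theorem complementarity_projection_signs {a b c₁ c₂ : ℝ} (h₁ : 0 ≤ c₁) (h₂ : 0 ≤ c₂)
    (h₁₂ : c₁ * c₂ = 0)
    (hmin₁ : ∀ᶠ η in 𝓝[>] (0 : ℝ), 0 ≤ c₁ - η * (c₁ - a) → (c₁ - η * (c₁ - a)) * c₂ = 0 →
      (a - c₁) ^ 2 ≤ (a - (c₁ - η * (c₁ - a))) ^ 2)
    (hmin₂ : ∀ᶠ η in 𝓝[>] (0 : ℝ), 0 ≤ c₂ - η * (c₂ - b) → c₁ * (c₂ - η * (c₂ - b)) = 0 →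
      (b - c₂) ^ 2 ≤ (b - (c₂ - η * (c₂ - b))) ^ 2) :
    ((0 ≤ c₁ - a ∧ 0 ≤ c₂ - b) ∨ (c₁ - a) * (c₂ - b) = 0) ∧ (0 < c₁ → c₁ - a = 0) ∧
      (0 < c₂ → c₂ - b = 0) := by
  -- When the other coordinate is 0, c may move toward a as long as it stays nonnegative, and
  -- optimality then forces c = a. The move is always admissible if c < a, and for small η if c > 0.
  have key : ∀ {a c c' : ℝ}, 0 ≤ c → c' = 0 →
      (∀ᶠ η in 𝓝[>] (0 : ℝ), 0 ≤ c - η * (c - a) → (c - η * (c - a)) * c' = 0 →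
      (a - c) ^ 2 ≤ (a - (c - η * (c - a))) ^ 2) → 0 ≤ c - a ∧ (0 < c → c - a = 0) := by
    intro a c c' hc hc' hmin
    have hlt : ∀ᶠ η in 𝓝[>] (0 : ℝ), η < 1 :=
      (eventually_lt_nhds one_pos).filter_mono nhdsWithin_le_nhds
    have hzero : (∀ᶠ η in 𝓝[>] (0 : ℝ), 0 ≤ c - η * (c - a)) → c - a = 0 := by
      intro hpos
      obtain ⟨η, ⟨⟨h1, h2⟩, h3⟩, h4⟩ := (((hmin.and hpos).and hlt).and self_mem_nhdsWithin).exists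
      have h4 : 0 < η := h4
      have h5 := h1 h2 (by simp [hc'])
      have h6 : (c - a) ^ 2 * (η * (2 - η)) ≤ 0 := by nlinarith
      have h7 : 0 < η * (2 - η) := mul_pos h4 (by linarith)
      have h8 : (c - a) ^ 2 ≤ 0 := nonpos_of_mul_nonpos_left h6 h7
      exact pow_eq_zero_iff two_ne_zero |>.mp (le_antisymm h8 (sq_nonneg _))
    refine ⟨?_, fun hcpos => hzero ?_⟩
    · by_contra hcon
      push Not at hcon
      refine hcon.ne (hzero ?_)
      filter_upwards [self_mem_nhdsWithin] with η hη
      have hη : 0 < η := hη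
      nlinarith
    · have : Tendsto (fun η : ℝ => c - η * (c - a)) (𝓝 0) (𝓝 c) :=
        Continuous.tendsto' (by fun_prop) _ _ (by simp)
      exact ((this.mono_left nhdsWithin_le_nhds).eventually (lt_mem_nhds hcpos)).mono
        fun _ h => h.le
  rcases mul_eq_zero.mp h₁₂ with h | h
  · have k2 := key h₂ h (hmin₂.mono fun η hη => by rwa [mul_comm c₁] at hη)
    refine ⟨?_, fun h' => absurd h h'.ne', k2.2⟩
    rcases h₂.eq_or_lt with h' | h'
    · exact Or.inl ⟨(key h₁ h'.symm hmin₁).1, k2.1⟩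
    · right; rw [k2.2 h', mul_zero]
  · have k1 := key h₁ h hmin₁
    refine ⟨?_, k1.2, fun h' => absurd h h'.ne'⟩
    rcases h₁.eq_or_lt with h' | h'
    · exact Or.inl ⟨k1.1, (key h₂ h'.symm (hmin₂.mono fun η hη => by rwa [mul_comm c₁] at hη)).1⟩
    · right; rw [k1.2 h', zero_mul]

/-! ### Quadratic penalization -/

namespace FeasSystem

variable {E ι κ τ : Type*} [NormedAddCommGroup E] [InnerProductSpace ℝ E] [CompleteSpace E]
  [Fintype ι] [Fintype κ] [Fintype τ]

/-- Stationarity of the pair `(z, w)` for a quadratic penalization of the problem of minimizing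
`φ` over the feasible region with proximal centre `z₀`; the objective is evaluated at `z`, the
constraints at `w`. -/
def PenaltyStationary (S : FeasSystem E (Unit ⊕ ι) κ τ) (φ : E → ℝ) (z₀ z w : E) : Prop :=
  ∃ (ξ v : E) (lg : Unit ⊕ ι → ℝ) (lh : κ → ℝ) (lG lH : τ → ℝ),
    ξ ∈ regularSubdiff φ z ∧
    (lg (Sum.inl ()) ≠ 0 → v ∈ regularSubdiff (S.g (Sum.inl ())) w) ∧
    (∀ i, 0 ≤ lg i) ∧ (∀ i, S.g i z₀ < 0 → lg i = 0) ∧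
    (∀ i ∈ S.setI z₀, lH i = 0) ∧ (∀ i ∈ S.setK z₀, lG i = 0) ∧
    (∀ i, (0 ≤ lG i ∧ 0 ≤ lH i) ∨ lG i * lH i = 0) ∧
    ξ + (lg (Sum.inl ()) • v + ∑ i, lg (Sum.inr i) • gradient (S.g (Sum.inr i)) w)
      + ∑ i, lh i • gradient (S.h i) w - ∑ i, lG i • gradient (S.G i) w
      - ∑ i, lH i • gradient (S.H i) w = -(z - z₀)

/-- The smooth part of the penalty function. -/
noncomputable def penalty (S : FeasSystem E (Unit ⊕ ι) κ τ) (z : E) (c : τ → ℝ × ℝ) (w : E) : ℝ :=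
  1 / 2 * ‖w - z‖ ^ 2 + ∑ i, 1 / 2 * (max (S.g (Sum.inr i) w) 0) ^ 2
    + ∑ i, 1 / 2 * (S.h i w - 0) ^ 2
    + (∑ i, 1 / 2 * (S.G i w - (c i).1) ^ 2 + ∑ i, 1 / 2 * (S.H i w - (c i).2) ^ 2)

variable {S : FeasSystem E (Unit ⊕ ι) κ τ}

theorem hasGradientAt_penalty (hg : ∀ i, ContDiff ℝ 1 (S.g (Sum.inr i)))
    (hh : ∀ i, ContDiff ℝ 1 (S.h i)) (hG : ∀ i, ContDiff ℝ 1 (S.G i))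
    (hH : ∀ i, ContDiff ℝ 1 (S.H i)) (z : E) (c : τ → ℝ × ℝ) (w : E) :
    HasGradientAt (S.penalty z c)
      ((w - z) + ∑ i, (max (S.g (Sum.inr i) w) 0) • gradient (S.g (Sum.inr i)) w
        + ∑ i, (S.h i w - 0) • gradient (S.h i) w
        + (∑ i, (S.G i w - (c i).1) • gradient (S.G i) w
          + ∑ i, (S.H i w - (c i).2) • gradient (S.H i) w)) w :=
  (((hasGradientAt_half_norm_sub_sq z w).fun_add'
    (HasGradientAt.fun_sum' fun i =>
      (hasDerivAt_half_posPart_sq _).comp_hasGradientAt ((hg i).hasGradientAt_gradient w))).fun_add'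
    (HasGradientAt.fun_sum' fun i =>
      (hasDerivAt_half_sub_sq _ _).comp_hasGradientAt ((hh i).hasGradientAt_gradient w))).fun_add'
    ((HasGradientAt.fun_sum' fun i =>
      (hasDerivAt_half_sub_sq _ _).comp_hasGradientAt ((hG i).hasGradientAt_gradient w)).fun_add'
    (HasGradientAt.fun_sum' fun i =>
      (hasDerivAt_half_sub_sq _ _).comp_hasGradientAt ((hH i).hasGradientAt_gradient w)))

omit [CompleteSpace E] in
theorem continuous_penalty (hg : ∀ i, ContDiff ℝ 1 (S.g (Sum.inr i)))
    (hh : ∀ i, ContDiff ℝ 1 (S.h i)) (hG : ∀ i, ContDiff ℝ 1 (S.G i))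
    (hH : ∀ i, ContDiff ℝ 1 (S.H i)) :
    Continuous fun p : E × E × (τ → ℝ × ℝ) => S.penalty p.1 p.2.2 p.2.1 := by
  have hg' := fun i => (hg i).continuous
  have hh' := fun i => (hh i).continuous
  have hG' := fun i => (hG i).continuous
  have hH' := fun i => (hH i).continuous
  unfold penalty
  fun_prop

omit [InnerProductSpace ℝ E] [CompleteSpace E] in
theorem penalty_nonneg (z : E) (c : τ → ℝ × ℝ) (w : E) : 0 ≤ S.penalty z c w := by
  unfold penalty; positivity

omit [InnerProductSpace ℝ E] [CompleteSpace E] in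
theorem eq_zero_of_penalty_eq_zero {z : E} {c : τ → ℝ × ℝ} {w : E} (h : S.penalty z c w = 0) :
    w = z ∧ (∀ i, S.g (Sum.inr i) w ≤ 0) ∧ (∀ i, S.h i w = 0) ∧
      (∀ i, S.G i w = (c i).1) ∧ ∀ i, S.H i w = (c i).2 := by
  unfold penalty at h
  have e1 : 0 ≤ 1 / 2 * ‖w - z‖ ^ 2 := by positivity
  have e2 : 0 ≤ ∑ i, 1 / 2 * (max (S.g (Sum.inr i) w) 0) ^ 2 := by positivity
  have e3 : 0 ≤ ∑ i, 1 / 2 * (S.h i w - 0) ^ 2 := by positivity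
  have e4 : 0 ≤ ∑ i, 1 / 2 * (S.G i w - (c i).1) ^ 2 := by positivity
  have e5 : 0 ≤ ∑ i, 1 / 2 * (S.H i w - (c i).2) ^ 2 := by positivity
  have z1 : 1 / 2 * ‖w - z‖ ^ 2 = 0 := by linarith
  have z2 : ∑ i, 1 / 2 * (max (S.g (Sum.inr i) w) 0) ^ 2 = 0 := by linarith
  have z3 : ∑ i, 1 / 2 * (S.h i w - 0) ^ 2 = 0 := by linarith
  have z4 : ∑ i, 1 / 2 * (S.G i w - (c i).1) ^ 2 = 0 := by linarith
  have z5 : ∑ i, 1 / 2 * (S.H i w - (c i).2) ^ 2 = 0 := by linarith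
  rw [Finset.sum_eq_zero_iff_of_nonneg fun i _ => by positivity] at z2 z3 z4 z5
  refine ⟨?_, fun i => ?_, fun i => ?_, fun i => ?_, fun i => ?_⟩
  · simpa [sub_eq_zero] using z1
  · simpa using z2 i (Finset.mem_univ i)
  · simpa using z3 i (Finset.mem_univ i)
  · simpa [sub_eq_zero] using z4 i (Finset.mem_univ i)
  · simpa [sub_eq_zero] using z5 i (Finset.mem_univ i)

omit [InnerProductSpace ℝ E] [CompleteSpace E] in
theorem penalty_update_sub [DecidableEq τ] (z : E) (c : τ → ℝ × ℝ) (w : E) (t : τ) (e : ℝ × ℝ) :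
    S.penalty z (Function.update c t e) w - S.penalty z c w =
      (1 / 2 * (S.G t w - e.1) ^ 2 + 1 / 2 * (S.H t w - e.2) ^ 2)
        - (1 / 2 * (S.G t w - (c t).1) ^ 2 + 1 / 2 * (S.H t w - (c t).2) ^ 2) := by
  have key : ∀ q : τ → ℝ × ℝ → ℝ,
      ∑ i, q i (Function.update c t e i) - ∑ i, q i (c i) = q t e - q t (c t) := by
    intro q
    rw [← Finset.sum_sub_distrib, Finset.sum_eq_single t]
    · simp
    · intro i _ hi
      simp [Function.update_of_ne hi]
    · simp
  have k1 := key fun i p => 1 / 2 * (S.G i w - p.1) ^ 2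
  have k2 := key fun i p => 1 / 2 * (S.H i w - p.2) ^ 2
  unfold penalty
  linarith

/-- The penalized minimizers exist on a compact box. Their constraint residual R tends to 0, and the
proximal term forces the limit to be z₀. Partial minimality in z, in w and in each coordinate of c
then gives the stated relations, with multipliers equal to penalty parameter times residual. -/
theorem exists_penaltyStationary [FiniteDimensional ℝ E] {φ : E → ℝ} {z₀ : E}
    (hφ : Continuous φ) (hg : ∀ i, ContDiff ℝ 1 (S.g (Sum.inr i)))
    (hh : ∀ i, ContDiff ℝ 1 (S.h i)) (hG : ∀ i, ContDiff ℝ 1 (S.G i))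
    (hH : ∀ i, ContDiff ℝ 1 (S.H i))
    (hcont : ∀ᶠ z in 𝓝 z₀, ContinuousAt (S.g (Sum.inl ())) z)
    (hcalm : ∀ᶠ z in 𝓝 z₀, ∃ L : ℝ, ∀ᶠ z' in 𝓝 z,
      S.g (Sum.inl ()) z' - S.g (Sum.inl ()) z ≤ L * ‖z' - z‖)
    (hsol : S.IsLocalSolution φ z₀) :
    ∃ zs ws : ℕ → E, Tendsto zs atTop (𝓝 z₀) ∧ Tendsto ws atTop (𝓝 z₀) ∧
      ∀ k, S.PenaltyStationary φ z₀ (zs k) (ws k) := by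
  classical
  set g₀ := S.g (Sum.inl ()) with hg₀
  obtain ⟨hfeas, hloc⟩ := hsol
  have hloc' : ∀ᶠ z in 𝓝 z₀, z ∈ S.feasible → φ z₀ ≤ φ z :=
    eventually_nhdsWithin_iff.mp hloc
  obtain ⟨δ, hδ, hδball⟩ :=
    Metric.nhds_basis_closedBall.eventually_iff.mp ((hcont.and hcalm).and hloc')
  set c₀ : τ → ℝ × ℝ := fun i => (S.G i z₀, S.H i z₀) with hc₀
  set Cs : Set (τ → ℝ × ℝ) := {c | ∀ i, 0 ≤ (c i).1 ∧ 0 ≤ (c i).2 ∧ (c i).1 * (c i).2 = 0}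
    with hCs
  have hCcl : IsClosed Cs := by
    simp only [hCs, Set.ofPred_forall, Set.ofPred_and]
    refine isClosed_iInter fun i => (isClosed_le ?_ ?_).inter
      ((isClosed_le ?_ ?_).inter (isClosed_eq ?_ ?_)) <;> fun_prop
  set B := Metric.closedBall z₀ δ with hB
  set K := B ×ˢ B ×ˢ (Metric.closedBall c₀ 1 ∩ Cs) with hK
  have hz₀B : z₀ ∈ B := Metric.mem_closedBall_self hδ.le
  have hKc : IsCompact K := (isCompact_closedBall z₀ δ).prod
    ((isCompact_closedBall z₀ δ).prod ((isCompact_closedBall c₀ 1).inter_right hCcl))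
  have hK₀ : (z₀, z₀, c₀) ∈ K :=
    ⟨hz₀B, hz₀B, Metric.mem_closedBall_self zero_le_one, fun i => hfeas.2.2 i⟩
  have hgB : ContinuousOn g₀ B := fun z hz => (hδball hz).1.1.continuousWithinAt
  have hgK : ContinuousOn (fun p : E × E × (τ → ℝ × ℝ) => 1 / 2 * (max (g₀ p.2.1) 0) ^ 2) K := by
    have : ContinuousOn (fun p : E × E × (τ → ℝ × ℝ) => g₀ p.2.1) K :=
      hgB.comp (by fun_prop) fun p hp => hp.2.1
    exact continuousOn_const.mul ((this.sup continuousOn_const).pow 2)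
  set R : E × E × (τ → ℝ × ℝ) → ℝ :=
    fun p => S.penalty p.1 p.2.2 p.2.1 + 1 / 2 * (max (g₀ p.2.1) 0) ^ 2 with hR
  have hRK : ContinuousOn R K := (continuous_penalty hg hh hG hH).continuousOn.add hgK
  have hR0 : ∀ p, 0 ≤ R p := fun p => add_nonneg (penalty_nonneg _ _ _) (by positivity)
  have hRz₀ : R (z₀, z₀, c₀) = 0 := by
    have h1 : g₀ z₀ ≤ 0 := hfeas.1 _
    have h2 : ∀ i, max (S.g (Sum.inr i) z₀) 0 = 0 := fun i => max_eq_right (hfeas.1 _)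
    simp [hR, penalty, h2, max_eq_right h1, hfeas.2.1, hc₀]
  have hmin : ∀ k : ℕ, ∃ p ∈ K,
      IsMinOn (fun p => (φ p.1 + 1 / 2 * ‖p.1 - z₀‖ ^ 2) + ((k : ℝ) + 1) * R p) K p := fun k =>
    hKc.exists_isMinOn ⟨_, hK₀⟩ (by fun_prop)
  choose ps hpK hpmin using hmin
  have hval : ∀ k : ℕ, (φ (ps k).1 + 1 / 2 * ‖(ps k).1 - z₀‖ ^ 2) + ((k : ℝ) + 1) * R (ps k)
      ≤ φ z₀ := fun k => by
    have := isMinOn_iff.mp (hpmin k) _ hK₀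
    simpa [hRz₀] using this
  obtain ⟨m, -, hm⟩ := (isCompact_closedBall z₀ δ).exists_isMinOn ⟨z₀, hz₀B⟩ hφ.continuousOn
  have hlow : ∀ k, φ m ≤ φ (ps k).1 := fun k => hm (hpK k).1
  obtain ⟨⟨z', w', c'⟩, hpK', σ, hσ, hlim⟩ := hKc.tendsto_subseq hpK
  have hR' : R (z', w', c') = 0 := by
    have h1 : Tendsto (fun k => R (ps (σ k))) atTop (𝓝 (R (z', w', c'))) :=
      (hRK _ hpK').tendsto.comp (tendsto_nhdsWithin_iff.mpr
        ⟨hlim, Eventually.of_forall fun k => hpK _⟩)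
    have h2 : Tendsto (fun k => R (ps k)) atTop (𝓝 0) := by
      refine squeeze_zero (fun k => hR0 _) (fun k => ?_)
        ((tendsto_one_div_add_atTop_nhds_zero_nat).const_mul (φ z₀ - φ m) |>.trans (by simp))
      rw [mul_one_div, le_div_iff₀ (by positivity)]
      have : 0 ≤ 1 / 2 * ‖(ps k).1 - z₀‖ ^ 2 := by positivity
      linarith [hval k, hlow k]
    exact tendsto_nhds_unique h1 (h2.comp hσ.tendsto_atTop)
  have hpen : S.penalty z' c' w' = 0 ∧ 1 / 2 * (max (g₀ w') 0) ^ 2 = 0 := by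
    have h1 := penalty_nonneg (S := S) z' c' w'
    have h2 : 0 ≤ 1 / 2 * (max (g₀ w') 0) ^ 2 := by positivity
    simp only [hR] at hR'
    constructor <;> linarith
  obtain ⟨rfl, hf1, hf2, hf3, hf4⟩ := eq_zero_of_penalty_eq_zero hpen.1
  have hfeas' : w' ∈ S.feasible := by
    refine ⟨?_, hf2, fun i => ?_⟩
    · rintro (⟨⟩ | i)
      · simpa using hpen.2
      · exact hf1 i
    · rw [hf3, hf4]; exact hpK'.2.2.2 i
  have hw' : w' = z₀ := by
    have h1 : Tendsto (fun k => φ (ps (σ k)).1 + 1 / 2 * ‖(ps (σ k)).1 - z₀‖ ^ 2) atTop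
        (𝓝 (φ w' + 1 / 2 * ‖w' - z₀‖ ^ 2)) := by
      have : Continuous fun p : E × E × (τ → ℝ × ℝ) => φ p.1 + 1 / 2 * ‖p.1 - z₀‖ ^ 2 := by
        fun_prop
      exact (this.tendsto _).comp hlim
    have h2 : φ w' + 1 / 2 * ‖w' - z₀‖ ^ 2 ≤ φ z₀ := le_of_tendsto' h1 fun k => by
      have := mul_nonneg (by positivity : (0 : ℝ) ≤ (σ k : ℝ) + 1) (hR0 (ps (σ k)))
      linarith [hval (σ k)]
    have h3 := (hδball hpK'.1).2 hfeas'
    have h4 : ‖w' - z₀‖ ^ 2 ≤ 0 := by linarith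
    have h5 : ‖w' - z₀‖ = 0 := pow_eq_zero_iff two_ne_zero |>.mp (le_antisymm h4 (sq_nonneg _))
    exact sub_eq_zero.mp (norm_eq_zero.mp h5)
  subst hw'
  have hc' : c' = c₀ := funext fun i => Prod.ext (hf3 i).symm (hf4 i).symm
  subst hc'
  have hzlim : Tendsto (fun k => (ps (σ k)).1) atTop (𝓝 w') := (continuous_fst.tendsto _).comp hlim
  have hwlim : Tendsto (fun k => (ps (σ k)).2.1) atTop (𝓝 w') :=
    ((continuous_fst.comp continuous_snd).tendsto _).comp hlim
  have hclim : Tendsto (fun k => (ps (σ k)).2.2) atTop (𝓝 c₀) :=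
    ((continuous_snd.comp continuous_snd).tendsto _).comp hlim
  -- Eventually the minimizers lie in the interior of the balls, so the minima in z and w are local
  -- minima without constraint, and c may be perturbed within the complementarity set.
  have hev : ∀ᶠ k in atTop, S.PenaltyStationary φ w' (ps (σ k)).1 (ps (σ k)).2.1 := by
    have hginact : ∀ᶠ k in atTop, ∀ i, S.g i w' < 0 → S.g i (ps (σ k)).2.1 < 0 := by
      refine eventually_all.mpr fun i => ?_
      by_cases hi : S.g i w' < 0
      · have : ContinuousAt (S.g i) w' := by
          rcases i with ⟨⟩ | i
          · exact hcont.self_of_nhds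
          · exact (hg i).continuous.continuousAt
        exact ((this.tendsto.comp hwlim).eventually (gt_mem_nhds hi)).mono fun _ h _ => h
      · exact Eventually.of_forall fun _ h => absurd h hi
    have hcI : ∀ᶠ k in atTop, ∀ i ∈ S.setI w', 0 < ((ps (σ k)).2.2 i).2 := by
      refine eventually_all.mpr fun i => ?_
      by_cases hi : i ∈ S.setI w'
      · have : Tendsto (fun k => ((ps (σ k)).2.2 i).2) atTop (𝓝 (c₀ i).2) :=
          (continuous_snd.tendsto _).comp (tendsto_pi_nhds.mp hclim i)
        exact (this.eventually (lt_mem_nhds hi.2)).mono fun _ h _ => h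
      · exact Eventually.of_forall fun _ h => absurd h hi
    have hcK : ∀ᶠ k in atTop, ∀ i ∈ S.setK w', 0 < ((ps (σ k)).2.2 i).1 := by
      refine eventually_all.mpr fun i => ?_
      by_cases hi : i ∈ S.setK w'
      · have : Tendsto (fun k => ((ps (σ k)).2.2 i).1) atTop (𝓝 (c₀ i).1) :=
          (continuous_fst.tendsto _).comp (tendsto_pi_nhds.mp hclim i)
        exact (this.eventually (lt_mem_nhds hi.1)).mono fun _ h _ => h
      · exact Eventually.of_forall fun _ h => absurd h hi
    filter_upwards [hginact, hcI, hcK, hzlim.eventually (Metric.ball_mem_nhds _ hδ),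
      hwlim.eventually (Metric.ball_mem_nhds _ hδ),
      hclim.eventually (Metric.ball_mem_nhds _ one_pos)] with k h1 h2 h3 h4 h5 h6
    have hpKk := hpK (σ k)
    have hpm := hpmin (σ k)
    generalize ps (σ k) = p at *
    obtain ⟨z, w, c⟩ := p
    simp only at h1 h2 h3 h4 h5 h6
    set κ' : ℝ := (σ k : ℝ) + 1 with hκ'
    have hκ : 0 < κ' := by positivity
    have hc : c ∈ Cs := hpKk.2.2.2
    have hzmin : IsLocalMin (fun y => φ y + (1 / 2 * ‖y - w'‖ ^ 2 + κ' * (1 / 2 * ‖y - w‖ ^ 2)))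
        z := by
      filter_upwards [Metric.isOpen_ball.mem_nhds h4] with y hy
      have := isMinOn_iff.mp hpm _ (⟨Metric.ball_subset_closedBall hy, hpKk.2⟩ : (y, w, c) ∈ K)
      simp only [hR, penalty, norm_sub_rev w] at this
      linarith
    -- The coupling ½‖w - z‖² contributes κ'(z - w) here and κ'(w - z) in the condition for w; they
    -- cancel in the final identity, leaving only the proximal term.
    have hξ := neg_mem_regularSubdiff_of_isLocalMin hzmin
      ((hasGradientAt_half_norm_sub_sq w' z).fun_add'
        (((hasDerivAt_id _).const_mul κ').comp_hasGradientAt (hasGradientAt_half_norm_sub_sq w z)))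
    have hwmin : IsLocalMin (fun y => κ' / 2 * (max (g₀ y) 0) ^ 2 + κ' * S.penalty z c y) w := by
      filter_upwards [Metric.isOpen_ball.mem_nhds h5] with y hy
      have := isMinOn_iff.mp hpm _
        (⟨hpKk.1, Metric.ball_subset_closedBall hy, hpKk.2.2⟩ : (z, y, c) ∈ K)
      simp only [hR] at this
      linarith
    have hv := neg_mem_regularSubdiff_of_isLocalMin hwmin
      (((hasDerivAt_id _).const_mul κ').comp_hasGradientAt (hasGradientAt_penalty hg hh hG hH z c w))
    simp only [mul_one] at hξ hv
    have hcmin : ∀ t e, Function.update c t e ∈ Metric.closedBall c₀ 1 →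
        Function.update c t e ∈ Cs →
        (S.G t w - (c t).1) ^ 2 + (S.H t w - (c t).2) ^ 2
          ≤ (S.G t w - e.1) ^ 2 + (S.H t w - e.2) ^ 2 := by
      intro t e he1 he2
      have := isMinOn_iff.mp hpm _ (⟨hpKk.1, hpKk.2.1, he1, he2⟩ : (z, w, Function.update c t e) ∈ K)
      simp only [hR] at this
      have h7 := penalty_update_sub (S := S) z c w t e
      have h8 : κ' * S.penalty z c w ≤ κ' * S.penalty z (Function.update c t e) w := by linarith
      have h9 := le_of_mul_le_mul_left h8 hκ
      linarith
    have hupC : ∀ t (e : ℝ × ℝ), 0 ≤ e.1 → 0 ≤ e.2 → e.1 * e.2 = 0 →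
        Function.update c t e ∈ Cs := by
      intro t e h7 h8 h9 i
      by_cases hi : i = t
      · subst hi; simp [h7, h8, mul_eq_zero.mp h9]
      · rw [Function.update_of_ne hi]; exact hc i
    have hupball : ∀ t (γ : ℝ → ℝ × ℝ), Continuous γ → γ 0 = c t →
        ∀ᶠ η in 𝓝[>] (0 : ℝ), Function.update c t (γ η) ∈ Metric.closedBall c₀ 1 := by
      intro t γ hγ hγ0
      have : Tendsto (fun η => Function.update c t (γ η)) (𝓝 0) (𝓝 c) :=
        Continuous.tendsto' (by fun_prop) _ _ (by simp [hγ0])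
      exact ((this.mono_left nhdsWithin_le_nhds).eventually
        (Metric.isOpen_ball.mem_nhds h6)).mono fun _ h => Metric.ball_subset_closedBall h
    have hsigns := fun t => complementarity_projection_signs (a := S.G t w) (b := S.H t w)
      (hc t).1 (hc t).2.1 (hc t).2.2
      (by
        filter_upwards [hupball t (fun η => ((c t).1 - η * ((c t).1 - S.G t w), (c t).2))
          (by fun_prop) (by simp)] with η hη h7 h8
        have := hcmin t _ hη (hupC t _ h7 (hc t).2.1 h8)
        simpa using this)
      (by
        filter_upwards [hupball t (fun η => ((c t).1, (c t).2 - η * ((c t).2 - S.H t w)))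
          (by fun_prop) (by simp)] with η hη h7 h8
        have := hcmin t _ hη (hupC t _ (hc t).1 h7 h8)
        simpa using this)
    -- If g₀ w ≤ 0 the subgradient of the squared positive part is zero and the multiplier is 0,
    -- with v arbitrary; otherwise the chain rule yields the multiplier κ' g₀ w.
    obtain ⟨v, l₀, hl₀, hvl, hvw, hl₀in⟩ : ∃ (v : E) (l₀ : ℝ), 0 ≤ l₀ ∧
        (l₀ ≠ 0 → v ∈ regularSubdiff g₀ w) ∧
        l₀ • v = -(κ' • ((w - z) + ∑ i, (max (S.g (Sum.inr i) w) 0) • gradient (S.g (Sum.inr i)) w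
        + ∑ i, (S.h i w - 0) • gradient (S.h i) w
        + (∑ i, (S.G i w - (c i).1) • gradient (S.G i) w
          + ∑ i, (S.H i w - (c i).2) • gradient (S.H i) w))) ∧ (g₀ w < 0 → l₀ = 0) := by
      rcases le_or_gt (g₀ w) 0 with hgw | hgw
      · obtain ⟨L, hL⟩ := (hδball (Metric.ball_subset_closedBall h5)).1.2
        have := eq_zero_of_mem_regularSubdiff_sq_posPart hκ hgw hL hv
        exact ⟨0, 0, le_rfl, fun h => absurd rfl h, by rw [this]; simp, fun _ => rfl⟩
      · have := smul_mem_regularSubdiff_of_sq_posPart hκ hgw hv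
        refine ⟨_, κ' * g₀ w, by positivity, fun _ => this, ?_, fun h => absurd h hgw.le.not_gt⟩
        rw [smul_smul, mul_inv_cancel₀ (by positivity), one_smul]
    refine ⟨_, v, Sum.elim (fun _ => l₀) (fun i => κ' * max (S.g (Sum.inr i) w) 0),
      fun i => κ' * S.h i w, fun i => κ' * ((c i).1 - S.G i w), fun i => κ' * ((c i).2 - S.H i w),
      hξ, hvl, ?_, ?_, ?_, ?_, ?_, ?_⟩
    · rintro (⟨⟩ | i)
      · exact hl₀
      · exact mul_nonneg hκ.le (le_max_right _ _)
    · rintro (⟨⟩ | i) hi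
      · exact hl₀in (h1 _ hi)
      · simp [max_eq_right (h1 _ hi).le]
    · intro i hi
      simp [(hsigns i).2.2 (h2 i hi)]
    · intro i hi
      simp [(hsigns i).2.1 (h3 i hi)]
    · intro i
      rcases (hsigns i).1 with h | h
      · exact Or.inl ⟨mul_nonneg hκ.le h.1, mul_nonneg hκ.le h.2⟩
      · right; linear_combination κ' * κ' * h
    · have hG' : ∑ i, (κ' * ((c i).1 - S.G i w)) • gradient (S.G i) w
          = -(κ' • ∑ i, (S.G i w - (c i).1) • gradient (S.G i) w) := by
        rw [Finset.smul_sum, ← Finset.sum_neg_distrib]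
        exact Finset.sum_congr rfl fun i _ => by rw [smul_smul, ← neg_smul]; ring_nf
      have hH' : ∑ i, (κ' * ((c i).2 - S.H i w)) • gradient (S.H i) w
          = -(κ' • ∑ i, (S.H i w - (c i).2) • gradient (S.H i) w) := by
        rw [Finset.smul_sum, ← Finset.sum_neg_distrib]
        exact Finset.sum_congr rfl fun i _ => by rw [smul_smul, ← neg_smul]; ring_nf
      rw [hG', hH']
      simp only [Sum.elim_inl, Sum.elim_inr, hvw, mul_smul, ← Finset.smul_sum, sub_zero,
        smul_add, smul_sub]
      abel
  obtain ⟨N, hN⟩ := eventually_atTop.mp hev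
  have hσN : Tendsto (fun k => k + N) atTop atTop := tendsto_add_atTop_nat N
  exact ⟨fun k => (ps (σ (k + N))).1, fun k => (ps (σ (k + N))).2.1, hzlim.comp hσN,
    hwlim.comp hσN, fun k => hN (k + N) (by omega)⟩

end FeasSystem

/-! ### M-stationarity from constant rank -/

namespace FeasSystem

variable {E ι κ τ : Type*} [NormedAddCommGroup E] [InnerProductSpace ℝ E] [CompleteSpace E]

/-- The relaxed constant rank constraint qualification, for sequences that may take the value of
their limit. -/
def StrongRCRCQ (S : FeasSystem E ι κ τ) (z₀ : E) : Prop :=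
  ∀ (I₄ : Set ι) (I₅ I₆ : Set τ),
    I₄ ⊆ S.activeSet z₀ → I₅ ⊆ S.setJ z₀ → I₆ ⊆ S.setJ z₀ →
    ∀ v₀ : ι → E, (∀ i ∈ I₄, v₀ i ∈ limitingSubdiff (S.g i) z₀) →
    ∀ (zs : ℕ → E) (vs : ℕ → ι → E),
      Tendsto zs atTop (𝓝 z₀) →
      (∀ k, ∀ i ∈ I₄, vs k i ∈ limitingSubdiff (S.g i) (zs k)) →
      (∀ i ∈ I₄, Tendsto (fun k => vs k i) atTop (𝓝 (v₀ i))) →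
      ∀ᶠ k in atTop,
        Set.finrank ℝ (S.gradientSet I₄ (S.setI z₀ ∪ I₅) (S.setK z₀ ∪ I₆) (zs k) (vs k)) =
          Set.finrank ℝ (S.gradientSet I₄ (S.setI z₀ ∪ I₅) (S.setK z₀ ∪ I₆) z₀ v₀)

theorem StrongRCRCQ.rcrcq {S : FeasSystem E ι κ τ} {z₀ : E} (h : S.StrongRCRCQ z₀) :
    S.RCRCQ z₀ :=
  fun I₄ I₅ I₆ h₄ h₅ h₆ v₀ hv₀ zs vs _ hz hvs hlim =>
    h I₄ I₅ I₆ h₄ h₅ h₆ v₀ hv₀ zs vs hz hvs hlim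

/-- The family of all gradients (and subgradients `v`) at `z`. -/
noncomputable def gradientFamily (S : FeasSystem E ι κ τ) (z : E) (v : ι → E) :
    ι ⊕ κ ⊕ τ ⊕ τ → E :=
  Sum.elim v (Sum.elim (fun i => gradient (S.h i) z)
    (Sum.elim (fun i => gradient (S.G i) z) (fun i => gradient (S.H i) z)))

theorem gradientFamily_image (S : FeasSystem E ι κ τ) (z : E) (v : ι → E) (A : Set ι)
    (P Q : Set τ) :
    S.gradientFamily z v '' {i | Sum.elim (· ∈ A) (Sum.elim (fun _ => True)
      (Sum.elim (· ∈ P) (· ∈ Q))) i} = S.gradientSet A P Q z v := by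
  ext w
  simp only [gradientSet, gradientFamily, Set.mem_image, Set.mem_union, Set.mem_range]
  constructor
  · rintro ⟨i | i | i | i, hi, rfl⟩
    · exact Or.inl (Or.inl (Or.inl ⟨i, hi, rfl⟩))
    · exact Or.inl (Or.inl (Or.inr ⟨i, rfl⟩))
    · exact Or.inl (Or.inr ⟨i, hi, rfl⟩)
    · exact Or.inr ⟨i, hi, rfl⟩
  · rintro (((⟨i, hi, rfl⟩ | ⟨i, rfl⟩) | ⟨i, hi, rfl⟩) | ⟨i, hi, rfl⟩)
    · exact ⟨Sum.inl i, hi, rfl⟩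
    · exact ⟨Sum.inr (Sum.inl i), trivial, rfl⟩
    · exact ⟨Sum.inr (Sum.inr (Sum.inl i)), hi, rfl⟩
    · exact ⟨Sum.inr (Sum.inr (Sum.inr i)), hi, rfl⟩

variable [Fintype ι] [Fintype κ] [Fintype τ]

/-- Pass to the limit in the penalized stationarity relations after replacing their multipliers by
convergent ones. The points at which the gradients are taken may coincide with z₀, hence the strong
form of the qualification. -/
theorem mStationary_of_strongRCRCQ [FiniteDimensional ℝ E] {S : FeasSystem E (Unit ⊕ ι) κ τ}
    {φ : E → ℝ} {z₀ : E}
    (hφ : LocallyLipschitz φ) (hg : ∀ i, ContDiff ℝ 1 (S.g (Sum.inr i)))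
    (hh : ∀ i, ContDiff ℝ 1 (S.h i)) (hG : ∀ i, ContDiff ℝ 1 (S.G i))
    (hH : ∀ i, ContDiff ℝ 1 (S.H i))
    (hcont : ∀ᶠ z in 𝓝 z₀, ContinuousAt (S.g (Sum.inl ())) z)
    (hcalm : ∀ᶠ z in 𝓝 z₀, ∃ L : ℝ, ∀ᶠ z' in 𝓝 z,
      S.g (Sum.inl ()) z' - S.g (Sum.inl ()) z ≤ L * ‖z' - z‖)
    {R : ℝ} (hbdd : ∀ᶠ z in 𝓝 z₀, ∀ ζ ∈ regularSubdiff (S.g (Sum.inl ())) z, ‖ζ‖ ≤ R)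
    (hsol : S.IsLocalSolution φ z₀) (hcq : S.StrongRCRCQ z₀) : S.MStationary φ z₀ := by
  classical
  obtain ⟨zs, ws, hzs, hws, hstat⟩ :=
    exists_penaltyStationary hφ.continuous hg hh hG hH hcont hcalm hsol
  choose ξ v lg lh lG lH hξ hv hlg hin hI hK hJ heq using hstat
  -- a convergent subsequence of the subgradients of the objective
  obtain ⟨Kφ, t, ht, hLip⟩ := hφ z₀
  have hξb : ∀ᶠ k in atTop, ‖ξ k‖ ≤ Kφ := by
    filter_upwards [hzs.eventually (eventually_mem_nhds_iff.mpr ht)] with k hk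
    refine norm_le_of_mem_regularSubdiff Kφ.2 ?_ (hξ k)
    filter_upwards [hk] with z' hz'
    have := hLip.dist_le_mul z' hz' (zs k) (mem_of_mem_nhds hk)
    rw [Real.dist_eq, dist_eq_norm] at this
    exact (le_abs_self _).trans this
  obtain ⟨σ₁, hσ₁, ξ₀, hξ₀⟩ : ∃ σ : ℕ → ℕ, StrictMono σ ∧ ∃ ξ₀,
      Tendsto (fun k => ξ (σ k)) atTop (𝓝 ξ₀) := by
    obtain ⟨a, -, σ, hσ, h⟩ := tendsto_subseq_of_frequently_bounded
      (Metric.isBounded_closedBall (x := (0 : E)) (r := Kφ)) (x := ξ)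
      (hξb.mono fun k hk => by simpa using hk).frequently
    exact ⟨σ, hσ, a, h⟩
  have hξmem : ξ₀ ∈ limitingSubdiff φ z₀ :=
    ⟨fun k => zs (σ₁ k), fun k => ξ (σ₁ k), hzs.comp hσ₁.tendsto_atTop,
      (hφ.continuous.tendsto z₀).comp (hzs.comp hσ₁.tendsto_atTop), fun k => hξ _, hξ₀⟩
  -- a convergent subsequence of the subgradients of the nonsmooth constraint
  obtain ⟨P, σ₂, hσ₂, hP⟩ := exists_constant_subseq
    (fun k => lg (σ₁ k) (Sum.inl ()) ≠ 0)
  obtain ⟨σ, hσ, v', v₀, hv'lim, hv₀, hv'mem, hlgP, hv'eq, hξσ⟩ : ∃ σ : ℕ → ℕ, StrictMono σ ∧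
      ∃ (v' : ℕ → E) (v₀ : E), Tendsto v' atTop (𝓝 v₀) ∧
        v₀ ∈ limitingSubdiff (S.g (Sum.inl ())) z₀ ∧
        (P → ∀ k, v' k ∈ regularSubdiff (S.g (Sum.inl ())) (ws (σ k))) ∧
        (¬ P → ∀ k, lg (σ k) (Sum.inl ()) = 0) ∧
        (∀ k, lg (σ k) (Sum.inl ()) • v (σ k) = lg (σ k) (Sum.inl ()) • v' k) ∧
        Tendsto (fun k => ξ (σ k)) atTop (𝓝 ξ₀) := by
    -- If the multiplier of the nonsmooth constraint is nonzero throughout, v is a bounded sequence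
    -- of subgradients. If it is zero throughout, v carries no information and is replaced by a
    -- fixed limiting subgradient at z₀.
    by_cases hPt : P
    · have hne : ∀ k, lg (σ₁ (σ₂ k)) (Sum.inl ()) ≠ 0 := fun k => by
        have := hP k; simp only [hPt, eq_iff_iff, iff_true] at this; exact this
      have hσ₁₂ := (hσ₁.comp hσ₂).tendsto_atTop
      have hvb : ∀ᶠ k in atTop, ‖v (σ₁ (σ₂ k))‖ ≤ R := by
        filter_upwards [hσ₁₂.eventually (hws.eventually hbdd)] with k hk
        exact hk _ (hv _ (hne k))
      obtain ⟨a, -, θ, hθ, h⟩ := tendsto_subseq_of_frequently_bounded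
        (Metric.isBounded_closedBall (x := (0 : E)) (r := R)) (x := fun k => v (σ₁ (σ₂ k)))
        (hvb.mono fun k hk => by simpa using hk).frequently
      have hws' : Tendsto (fun k => ws (σ₁ (σ₂ (θ k)))) atTop (𝓝 z₀) :=
        hws.comp (hσ₁₂.comp hθ.tendsto_atTop)
      refine ⟨fun k => σ₁ (σ₂ (θ k)), hσ₁.comp (hσ₂.comp hθ), fun k => v (σ₁ (σ₂ (θ k))), a, h,
        ⟨fun k => ws (σ₁ (σ₂ (θ k))), fun k => v (σ₁ (σ₂ (θ k))), hws',
          hcont.self_of_nhds.tendsto.comp hws', fun k => hv _ (hne _), h⟩,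
        fun _ k => hv _ (hne _), fun h => absurd hPt h, fun k => rfl,
        hξ₀.comp (hσ₂.comp hθ).tendsto_atTop⟩
    · have hne : ∀ k, lg (σ₁ (σ₂ k)) (Sum.inl ()) = 0 := fun k => by
        have := hP k; simp only [hPt, eq_iff_iff, iff_false, not_not] at this; exact this
      obtain ⟨a, ha⟩ := limitingSubdiff_nonempty hcont hbdd
      exact ⟨fun k => σ₁ (σ₂ k), hσ₁.comp hσ₂, fun _ => a, a, tendsto_const_nhds, ha,
        fun h => absurd h hPt, fun _ => hne, fun k => by simp [hne],
        hξ₀.comp hσ₂.tendsto_atTop⟩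
  have hσt := hσ.tendsto_atTop
  have hwσ : Tendsto (fun k => ws (σ k)) atTop (𝓝 z₀) := hws.comp hσt
  set V : ℕ → Unit ⊕ ι → E := fun k =>
    Sum.elim (fun _ => v' k) (fun i => gradient (S.g (Sum.inr i)) (ws (σ k))) with hV
  set V₀ : Unit ⊕ ι → E := Sum.elim (fun _ => v₀) (fun i => gradient (S.g (Sum.inr i)) z₀)
    with hV₀
  have hVlim : ∀ i, Tendsto (fun k => V k i) atTop (𝓝 (V₀ i)) := by
    rintro (⟨⟩ | i)
    · exact hv'lim
    · exact ((hg i).continuous_gradient.tendsto _).comp hwσ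
  have hV₀mem : ∀ i, V₀ i ∈ limitingSubdiff (S.g i) z₀ := by
    rintro (⟨⟩ | i)
    · exact hv₀
    · rw [limitingSubdiff_of_contDiff (hg i)]; rfl
  have hVmem : ∀ k i, (i = Sum.inl () → P) → V k i ∈ limitingSubdiff (S.g i) (ws (σ k)) := by
    rintro k (⟨⟩ | i) hi
    · exact regularSubdiff_subset_limitingSubdiff (hv'mem (hi rfl) k)
    · rw [limitingSubdiff_of_contDiff (hg i)]; rfl
  -- A collects the gradients with multipliers of free sign, T₀ those whose sign or complementarity
  -- must survive. The nonsmooth index enters T₀ only under P: otherwise v' k need not be a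
  -- subgradient at `ws (σ k)` and the rank condition would not apply.
  set A : Set ((Unit ⊕ ι) ⊕ κ ⊕ τ ⊕ τ) := {i | Sum.elim (fun _ => False)
    (Sum.elim (fun _ => True) (Sum.elim (· ∈ S.setI z₀) (· ∈ S.setK z₀))) i} with hA
  set T₀ : Set ((Unit ⊕ ι) ⊕ κ ⊕ τ ⊕ τ) := {i | Sum.elim
    (fun i => i ∈ S.activeSet z₀ ∧ (i = Sum.inl () → P))
    (Sum.elim (fun _ => False) (Sum.elim (· ∈ S.setJ z₀) (· ∈ S.setJ z₀))) i} with hT₀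
  have hrank : ∀ T ⊆ T₀, ∀ᶠ k in atTop,
      Set.finrank ℝ (S.gradientFamily (ws (σ k)) (V k) '' (A ∪ T))
        = Set.finrank ℝ (S.gradientFamily z₀ V₀ '' (A ∪ T)) := by
    intro T hT
    have h := hcq {i | Sum.inl i ∈ T} {i | Sum.inr (Sum.inr (Sum.inl i)) ∈ T}
      {i | Sum.inr (Sum.inr (Sum.inr i)) ∈ T} (fun i hi => (hT hi).1) (fun i hi => hT hi)
      (fun i hi => hT hi) V₀ (fun i _ => hV₀mem i) (fun k => ws (σ k)) V hwσ
      (fun k i hi => hVmem k i (hT hi).2) (fun i _ => hVlim i)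
    have hset : A ∪ T = {i | Sum.elim (· ∈ {i | Sum.inl i ∈ T}) (Sum.elim (fun _ => True)
        (Sum.elim (· ∈ S.setI z₀ ∪ {i | Sum.inr (Sum.inr (Sum.inl i)) ∈ T})
        (· ∈ S.setK z₀ ∪ {i | Sum.inr (Sum.inr (Sum.inr i)) ∈ T}))) i} := by
      ext i
      rcases i with i | i | i | i <;> simp [hA]
    rw [hset]
    simpa only [gradientFamily_image] using h
  have hX : ∀ i, Tendsto (fun k => S.gradientFamily (ws (σ k)) (V k) i) atTop
      (𝓝 (S.gradientFamily z₀ V₀ i)) := by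
    rintro (i | i | i | i)
    · exact hVlim i
    · exact ((hh i).continuous_gradient.tendsto _).comp hwσ
    · exact ((hG i).continuous_gradient.tendsto _).comp hwσ
    · exact ((hH i).continuous_gradient.tendsto _).comp hwσ
  have htri : ∀ i, i ∉ S.setI z₀ → i ∉ S.setJ z₀ → i ∈ S.setK z₀ := by
    intro i h1 h2
    obtain ⟨hG0, hH0, hGH⟩ := hsol.1.2.2 i
    rcases mul_eq_zero.mp hGH with h | h
    · rcases hH0.eq_or_lt with h' | h'
      · exact absurd ⟨h, h'.symm⟩ h2
      · exact absurd ⟨h, h'⟩ h1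
    · rcases hG0.eq_or_lt with h' | h'
      · exact absurd ⟨h'.symm, h⟩ h2
      · exact ⟨h', h⟩
  set c : ℕ → (Unit ⊕ ι) ⊕ κ ⊕ τ ⊕ τ → ℝ := fun k => Sum.elim (lg (σ k)) (Sum.elim (lh (σ k))
    (Sum.elim (fun i => -lG (σ k) i) (fun i => -lH (σ k) i))) with hc
  have hcsupp : ∀ k i, i ∉ A → i ∉ T₀ → c k i = 0 := by
    rintro k (i | i | i | i) h1 h2
    · have h2 : ¬ (i ∈ S.activeSet z₀ ∧ (i = Sum.inl () → P)) := h2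
      change lg (σ k) i = 0
      by_cases hi : i ∈ S.activeSet z₀
      · have h3 : ¬ (i = Sum.inl () → P) := fun h => h2 ⟨hi, h⟩
        push Not at h3
        rw [h3.1]; exact hlgP h3.2 k
      · exact hin _ _ (lt_of_le_of_ne (hsol.1.1 i) hi)
    · exact absurd trivial h1
    · exact neg_eq_zero.mpr (hK _ _ (htri i h1 h2))
    · refine neg_eq_zero.mpr (hI _ _ ?_)
      by_contra h3
      exact h1 (htri i h3 h2)
  have hy : Tendsto (fun k => ∑ i, c k i • S.gradientFamily (ws (σ k)) (V k) i) atTop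
      (𝓝 (-ξ₀)) := by
    have : ∀ k, ∑ i, c k i • S.gradientFamily (ws (σ k)) (V k) i
        = -(zs (σ k) - z₀) - ξ (σ k) := by
      intro k
      rw [← heq (σ k), hv'eq]
      simp only [hc, gradientFamily, hV, Fintype.sum_sum_type, Sum.elim_inl, Sum.elim_inr,
        Finset.univ_unique, PUnit.default_eq_unit, Finset.sum_singleton, neg_smul,
        Finset.sum_neg_distrib]
      abel
    simp only [this]
    have h1 : Tendsto (fun k => -(zs (σ k) - z₀)) atTop (𝓝 (-(z₀ - z₀))) :=
      ((hzs.comp hσt).sub_const z₀).neg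
    simpa using h1.sub hξσ
  obtain ⟨c', c₀, θ, hθ, hsign, hlim, hfin⟩ := exists_convergent_multipliers hX hcsupp hrank hy
  refine ⟨hsol.1, ξ₀, V₀, fun i => c₀ (Sum.inl i), fun i => c₀ (Sum.inr (Sum.inl i)),
    fun i => -c₀ (Sum.inr (Sum.inr (Sum.inl i))), fun i => -c₀ (Sum.inr (Sum.inr (Sum.inr i))),
    hξmem, ?_, ?_, ?_, ?_, ?_, ?_⟩
  · refine fun i _ => ⟨hV₀mem i, ge_of_tendsto' (hlim (Sum.inl i)) fun k => ?_⟩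
    obtain ⟨h1, h2⟩ := hsign k (Sum.inl i) (fun h => h)
    rcases (hlg (σ (θ k)) i).eq_or_lt with h | h
    · exact (h2 h.symm).ge
    · exact nonneg_of_mul_nonneg_left h1 h
  · intro i hi
    have hz : ∀ k, c' k (Sum.inl i) = 0 := fun k =>
      (hsign k (Sum.inl i) (fun h => h)).2 (hin _ _ (lt_of_le_of_ne (hsol.1.1 i) hi))
    exact tendsto_nhds_unique (hlim (Sum.inl i)) (by simp [hz])
  · intro i hi
    have hnK : i ∉ S.setK z₀ := fun h => hi.2.ne' h.2
    have hz : ∀ k, c' k (Sum.inr (Sum.inr (Sum.inr i))) = 0 := fun k =>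
      (hsign k (Sum.inr (Sum.inr (Sum.inr i))) hnK).2 (neg_eq_zero.mpr (hI _ _ hi))
    exact neg_eq_zero.mpr
      (tendsto_nhds_unique (hlim (Sum.inr (Sum.inr (Sum.inr i)))) (by simp [hz]))
  · intro i hi
    have hnI : i ∉ S.setI z₀ := fun h => hi.1.ne' h.1
    have hz : ∀ k, c' k (Sum.inr (Sum.inr (Sum.inl i))) = 0 := fun k =>
      (hsign k (Sum.inr (Sum.inr (Sum.inl i))) hnI).2 (neg_eq_zero.mpr (hK _ _ hi))
    exact neg_eq_zero.mpr
      (tendsto_nhds_unique (hlim (Sum.inr (Sum.inr (Sum.inl i)))) (by simp [hz]))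
  · intro i hi
    have hnK : i ∉ S.setK z₀ := fun h => h.1.ne' hi.1
    have hnI : i ∉ S.setI z₀ := fun h => h.2.ne' hi.2
    -- The non-strict alternative is closed and passes to the limit; splitting off zero values
    -- recovers the strict one. The minus signs appear because `c` holds the negatives of `lG` and
    -- `lH`.
    have hcl : IsClosed {p : ℝ × ℝ | (0 ≤ -p.1 ∧ 0 ≤ -p.2) ∨ p.1 * p.2 = 0} := by
      simp only [Set.ofPred_or, Set.ofPred_and]
      refine ((isClosed_le ?_ ?_).inter (isClosed_le ?_ ?_)).union (isClosed_eq ?_ ?_) <;> fun_prop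
    have hmem := hcl.mem_of_tendsto ((hlim (Sum.inr (Sum.inr (Sum.inl i)))).prodMk_nhds
      (hlim (Sum.inr (Sum.inr (Sum.inr i))))) (Eventually.of_forall fun k => by
        obtain ⟨h1, h2⟩ := hsign k (Sum.inr (Sum.inr (Sum.inl i))) hnI
        obtain ⟨h3, h4⟩ := hsign k (Sum.inr (Sum.inr (Sum.inr i))) hnK
        simp only [hc, Sum.elim_inr, Sum.elim_inl, neg_eq_zero, mul_neg] at h1 h2 h3 h4
        have hneg : ∀ {a b : ℝ}, 0 ≤ -(a * b) → (b = 0 → a = 0) → 0 ≤ b → 0 ≤ -a := by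
          intro a b h5 h6 h7
          rcases h7.eq_or_lt with h8 | h8
          · rw [h6 h8.symm, neg_zero]
          · exact nonneg_of_mul_nonneg_left (by linarith : 0 ≤ -a * b) h8
        rcases hJ (σ (θ k)) i with h | h
        · exact Or.inl ⟨hneg h1 h2 h.1, hneg h3 h4 h.2⟩
        · rcases mul_eq_zero.mp h with h | h
          · right; simp [h2 h]
          · right; simp [h4 h])
    rcases hmem with ⟨h1, h2⟩ | h
    · rcases h1.eq_or_lt with h1' | h1'
      · right; beta_reduce; simp only at h1'; rw [← h1', zero_mul]
      · rcases h2.eq_or_lt with h2' | h2'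
        · right; beta_reduce; simp only at h2'; rw [← h2', mul_zero]
        · exact Or.inl ⟨h1', h2'⟩
    · right; simpa using h
  · have : ∑ i, c₀ i • S.gradientFamily z₀ V₀ i = ∑ i, c₀ (Sum.inl i) • V₀ i
        + ∑ i, c₀ (Sum.inr (Sum.inl i)) • gradient (S.h i) z₀
        + ∑ i, c₀ (Sum.inr (Sum.inr (Sum.inl i))) • gradient (S.G i) z₀
        + ∑ i, c₀ (Sum.inr (Sum.inr (Sum.inr i))) • gradient (S.H i) z₀ := by
      simp only [gradientFamily, Fintype.sum_sum_type, Sum.elim_inl, Sum.elim_inr]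
      abel
    rw [this] at hfin
    simp only [neg_smul, Finset.sum_neg_distrib]
    rw [eq_neg_iff_add_eq_zero] at hfin
    rw [← hfin]
    abel

end FeasSystem

/-! ### Block vectors -/

section Blocks

variable {ι κ : Type} [Fintype ι] [Fintype κ]

@[simp] theorem fstBlock_apply (z : Vec (ι ⊕ κ)) (i : ι) : fstBlock z i = z (Sum.inl i) := rfl
@[simp] theorem sndBlock_apply (z : Vec (ι ⊕ κ)) (i : κ) : sndBlock z i = z (Sum.inr i) := rfl
@[simp] theorem pair_apply_inl (a : Vec ι) (b : Vec κ) (i : ι) : pair a b (Sum.inl i) = a i := rfl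
@[simp] theorem pair_apply_inr (a : Vec ι) (b : Vec κ) (i : κ) : pair a b (Sum.inr i) = b i := rfl

@[simp] theorem fstBlock_pair (a : Vec ι) (b : Vec κ) : fstBlock (pair a b) = a := rfl
@[simp] theorem sndBlock_pair (a : Vec ι) (b : Vec κ) : sndBlock (pair a b) = b := rfl

@[simp] theorem pair_fstBlock_sndBlock (z : Vec (ι ⊕ κ)) : pair (fstBlock z) (sndBlock z) = z := by
  ext (i | i) <;> rfl

theorem inner_pair (a a' : Vec ι) (b b' : Vec κ) :
    inner ℝ (pair a b) (pair a' b') = inner ℝ a a' + inner ℝ b b' := by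
  simp [PiLp.inner_apply, Fintype.sum_sum_type]

theorem inner_pair_right (z : Vec (ι ⊕ κ)) (a : Vec ι) (b : Vec κ) :
    inner ℝ z (pair a b) = inner ℝ (fstBlock z) a + inner ℝ (sndBlock z) b := by
  rw [← inner_pair, pair_fstBlock_sndBlock]

/-- The first block as a continuous linear map. -/
noncomputable def fstBlockL : Vec (ι ⊕ κ) →L[ℝ] Vec ι :=
  LinearMap.toContinuousLinearMap
    { toFun := fstBlock
      map_add' := fun _ _ => rfl
      map_smul' := fun _ _ => rfl }

/-- The second block as a continuous linear map. -/
noncomputable def sndBlockL : Vec (ι ⊕ κ) →L[ℝ] Vec κ :=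
  LinearMap.toContinuousLinearMap
    { toFun := sndBlock
      map_add' := fun _ _ => rfl
      map_smul' := fun _ _ => rfl }

/-- Pairing as a continuous linear map. -/
noncomputable def pairL : Vec ι × Vec κ →L[ℝ] Vec (ι ⊕ κ) :=
  LinearMap.toContinuousLinearMap
    { toFun := fun p => pair p.1 p.2
      map_add' := fun _ _ => by ext (i | i) <;> rfl
      map_smul' := fun _ _ => by ext (i | i) <;> rfl }

@[fun_prop] theorem contDiff_fstBlock {n : WithTop ℕ∞} :
    ContDiff ℝ n (fstBlock : Vec (ι ⊕ κ) → Vec ι) :=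
  (fstBlockL (ι := ι) (κ := κ)).contDiff

@[fun_prop] theorem contDiff_sndBlock {n : WithTop ℕ∞} :
    ContDiff ℝ n (sndBlock : Vec (ι ⊕ κ) → Vec κ) :=
  (sndBlockL (ι := ι) (κ := κ)).contDiff

@[fun_prop] theorem continuous_fstBlock : Continuous (fstBlock : Vec (ι ⊕ κ) → Vec ι) :=
  (fstBlockL (ι := ι) (κ := κ)).continuous

@[fun_prop] theorem continuous_sndBlock : Continuous (sndBlock : Vec (ι ⊕ κ) → Vec κ) :=
  (sndBlockL (ι := ι) (κ := κ)).continuous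

@[fun_prop] theorem Continuous.pair {X : Type*} [TopologicalSpace X] {a : X → Vec ι}
    {b : X → Vec κ} (ha : Continuous a) (hb : Continuous b) :
    Continuous fun x => pair (a x) (b x) :=
  (pairL (ι := ι) (κ := κ)).continuous.comp (ha.prodMk hb)

theorem Filter.Tendsto.pair {X : Type*} {l : Filter X} {a : X → Vec ι} {b : X → Vec κ}
    {a₀ : Vec ι} {b₀ : Vec κ} (ha : Tendsto a l (𝓝 a₀)) (hb : Tendsto b l (𝓝 b₀)) :
    Tendsto (fun x => _root_.pair (a x) (b x)) l (𝓝 (_root_.pair a₀ b₀)) :=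
  ((pairL (ι := ι) (κ := κ)).continuous.tendsto (a₀, b₀)).comp (ha.prodMk_nhds hb)

theorem pair_add (a a' : Vec ι) (b b' : Vec κ) :
    pair (a + a') (b + b') = pair a b + pair a' b' := by ext (i | i) <;> rfl

theorem pair_sub (a a' : Vec ι) (b b' : Vec κ) :
    pair (a - a') (b - b') = pair a b - pair a' b' := by ext (i | i) <;> rfl

theorem smul_pair (t : ℝ) (a : Vec ι) (b : Vec κ) :
    t • pair a b = pair (t • a) (t • b) := by ext (i | i) <;> rfl

end Blocks

/-! ### Difference quotients and metric regularity -/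

section StrictDifferentiability

variable {E : Type*} [NormedAddCommGroup E] [InnerProductSpace ℝ E] [CompleteSpace E]

/-- Difference quotients of a continuously differentiable function along two sequences. -/
theorem tendsto_difference_quotient {φ : E → ℝ} (hφ : ContDiff ℝ 1 φ) {z q : E} {zs ws : ℕ → E}
    {t : ℕ → ℝ} (hz : Tendsto zs atTop (𝓝 z)) (hw : Tendsto ws atTop (𝓝 z))
    (hq : Tendsto (fun k => (t k)⁻¹ • (zs k - ws k)) atTop (𝓝 q)) :
    Tendsto (fun k => (t k)⁻¹ * (φ (zs k) - φ (ws k))) atTop (𝓝 (inner ℝ (gradient φ z) q)) := by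
  have hstrict : HasStrictFDerivAt φ (fderiv ℝ φ z) z :=
    hφ.contDiffAt.hasStrictFDerivAt one_ne_zero
  have h1 : Tendsto (fun k => (zs k, ws k)) atTop (𝓝 (z, z)) := hz.prodMk_nhds hw
  have h2 := hstrict.isLittleO.comp_tendsto h1
  have h3 : (fun k => (t k)⁻¹ * (φ (zs k) - φ (ws k)) - fderiv ℝ φ z ((t k)⁻¹ • (zs k - ws k)))
      =o[atTop] fun k => (t k)⁻¹ • (zs k - ws k) := by
    have := (Asymptotics.isBigO_refl (fun k => (t k)⁻¹) atTop).smul_isLittleO h2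
    refine this.congr_left fun k => ?_
    simp only [Function.comp, smul_eq_mul, map_smul]
    ring
  have h4 : Tendsto (fun k => (t k)⁻¹ * (φ (zs k) - φ (ws k))
      - fderiv ℝ φ z ((t k)⁻¹ • (zs k - ws k))) atTop (𝓝 0) := by
    rw [← Asymptotics.isLittleO_one_iff ℝ]
    exact h3.trans_isBigO (hq.isBigO_one ℝ)
  have h5 : Tendsto (fun k => fderiv ℝ φ z ((t k)⁻¹ • (zs k - ws k))) atTop
      (𝓝 (fderiv ℝ φ z q)) := ((fderiv ℝ φ z).continuous.tendsto q).comp hq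
  have h6 : fderiv ℝ φ z q = inner ℝ (gradient φ z) q := by
    rw [gradient, InnerProductSpace.toDual_symm_apply]
  rw [← h6]
  simpa using h4.add h5

/-- Prescribe a functional on the basis of the span, extend it to E, and represent it by a vector.
-/
theorem exists_inner_eq_of_linearIndependent [FiniteDimensional ℝ E] {β : Type*} {b : β → E}
    (hb : LinearIndependent ℝ b) (ρ : β → ℝ) : ∃ r : E, ∀ i, inner ℝ (b i) r = ρ i := by
  obtain ⟨g, hg⟩ := LinearMap.exists_extend ((Module.Basis.span hb).constr ℝ ρ)
  refine ⟨(InnerProductSpace.toDual ℝ E).symm (LinearMap.toContinuousLinearMap g), fun i => ?_⟩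
  rw [real_inner_comm, InnerProductSpace.toDual_symm_apply]
  have h1 := LinearMap.congr_fun hg (Module.Basis.span hb i)
  rw [Module.Basis.constr_basis] at h1
  rw [← h1]
  simp [Module.Basis.span_apply]

/-- Metric regularity of a strictly differentiable map with surjective derivative. -/
theorem exists_metric_regularity {F : Type*} [NormedAddCommGroup F] [NormedSpace ℝ F]
    [FiniteDimensional ℝ E] [CompleteSpace F] {Φ : E → F} {Φ' : E →L[ℝ] F} {z : E}
    (h : HasStrictFDerivAt Φ Φ' z) (hsurj : Function.Surjective Φ') :
    ∃ C > 0, ∃ δ > 0, ∀ᶠ z' in 𝓝 z, ∀ w, ‖w - Φ z'‖ ≤ δ →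
      ∃ z'', Φ z'' = w ∧ ‖z'' - z'‖ ≤ C * ‖w - Φ z'‖ := by
  set f := Φ'.nonlinearRightInverseOfSurjective (LinearMap.range_eq_top.mpr hsurj) with hf
  have hfpos : 0 < f.nnnorm :=
    ContinuousLinearMap.nonlinearRightInverseOfSurjective_nnnorm_pos Φ' _
  -- Half of the inverse norm of the right inverse is spent on the approximation error, so the other
  -- half, again c, is the openness rate and c⁻¹ the regularity constant.
  set c : NNReal := f.nnnorm⁻¹ / 2 with hc
  have hcpos : 0 < c := by positivity
  obtain ⟨s, hs, hsa⟩ := h.approximates_deriv_on_nhds (c := c) (Or.inr hcpos)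
  obtain ⟨ε, hε, hball⟩ := Metric.nhds_basis_closedBall.mem_iff.mp hs
  have hpos : (0 : ℝ) < c := hcpos
  have hcc : ((f.nnnorm : ℝ)⁻¹ - c) = c := by
    rw [hc]; push_cast; ring
  refine ⟨(c : ℝ)⁻¹, by positivity, c * (ε / 2), by positivity, ?_⟩
  filter_upwards [Metric.closedBall_mem_nhds z (half_pos hε)] with z' hz' w hw
  have hsub : Metric.closedBall z' ((c : ℝ)⁻¹ * ‖w - Φ z'‖) ⊆ s := by
    refine subset_trans (Metric.closedBall_subset_closedBall' ?_) hball
    have : (c : ℝ)⁻¹ * ‖w - Φ z'‖ ≤ ε / 2 := by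
      rw [inv_mul_le_iff₀ hpos]; exact hw
    linarith [Metric.mem_closedBall.mp hz']
  obtain ⟨z'', hz'', hw'⟩ := hsa.surjOn_closedBall_of_nonlinearRightInverse f (by positivity) hsub
    (show w ∈ _ by
      rw [hcc, Metric.mem_closedBall, dist_eq_norm, mul_inv_cancel_left₀ hpos.ne'])
  exact ⟨z'', hw', by simpa [dist_eq_norm] using hz''⟩

end StrictDifferentiability

/-! ### Moving feasible points of the lower level -/

namespace BilevelProgram

variable {d s p q m n : ℕ}

theorem inner_gradient_pair (φ : Vec (Fin d ⊕ Fin s) → ℝ) (z : Vec (Fin d ⊕ Fin s))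
    (e : Vec (Fin d)) (r : Vec (Fin s)) :
    inner ℝ (gradient φ z) (pair e r) = inner ℝ (gradX φ z) e + inner ℝ (gradY φ z) r :=
  inner_pair_right _ _ _

/-- Restoration of equality constraints without changing the first block. -/
theorem exists_restoration {h : Fin n → Vec (Fin d ⊕ Fin s) → ℝ} (hh : ∀ i, ContDiff ℝ 1 (h i))
    {z : Vec (Fin d ⊕ Fin s)} (hli : LinearIndependent ℝ fun i => gradY (h i) z)
    (hz : ∀ i, h i z = 0) :
    ∃ C > 0, ∀ᶠ z' in 𝓝 z, ∃ z'', fstBlock z'' = fstBlock z' ∧ (∀ i, h i z'' = 0) ∧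
      ‖z'' - z'‖ ≤ C * ‖fun i => h i z'‖ := by
  -- Making x a component of Φ forces the corrected point to keep its first block. The derivative is
  -- onto because the y-gradients of h are independent.
  set Φ : Vec (Fin d ⊕ Fin s) → Vec (Fin d) × (Fin n → ℝ) := fun z => (fstBlock z, fun i => h i z)
    with hΦ
  have hstrict : HasStrictFDerivAt Φ
      (fstBlockL.prod (ContinuousLinearMap.pi fun i => fderiv ℝ (h i) z)) z :=
    (fstBlockL.hasStrictFDerivAt).prodMk (hasStrictFDerivAt_pi.mpr fun i =>
      (hh i).contDiffAt.hasStrictFDerivAt one_ne_zero)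
  have hsurj : Function.Surjective
      (fstBlockL.prod (ContinuousLinearMap.pi fun i => fderiv ℝ (h i) z)) := by
    rintro ⟨e, ρ⟩
    obtain ⟨r, hr⟩ := exists_inner_eq_of_linearIndependent hli
      (fun i => ρ i - inner ℝ (gradX (h i) z) e)
    refine ⟨pair e r, Prod.ext rfl (funext fun i => ?_)⟩
    have h6 : fderiv ℝ (h i) z (pair e r) = inner ℝ (gradient (h i) z) (pair e r) := by
      rw [gradient, InnerProductSpace.toDual_symm_apply]
    change fderiv ℝ (h i) z (pair e r) = ρ i
    rw [h6, inner_gradient_pair, hr]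
    ring
  obtain ⟨C, hC, δ, hδ, hev⟩ := exists_metric_regularity hstrict hsurj
  have hsmall : ∀ᶠ z' in 𝓝 z, ‖fun i => h i z'‖ < δ := by
    have hc : Continuous fun z' => ‖fun i => h i z'‖ :=
      (continuous_pi fun i => (hh i).continuous).norm
    have : ‖fun i => h i z‖ = 0 := by
      rw [norm_eq_zero]; exact funext hz
    exact (hc.tendsto z).eventually (gt_mem_nhds (by rw [this]; exact hδ))
  refine ⟨C, hC, ?_⟩
  filter_upwards [hev, hsmall] with z' h1 h2
  have hnorm : ‖((fstBlock z', 0) : Vec (Fin d) × (Fin n → ℝ)) - Φ z'‖ = ‖fun i => h i z'‖ := by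
    have : ((fstBlock z', 0) : Vec (Fin d) × (Fin n → ℝ)) - Φ z' = (0, -fun i => h i z') := by
      simp [hΦ]
    rw [this, Prod.norm_def]
    simp
  obtain ⟨z'', hz'', hle⟩ := h1 (fstBlock z', 0) (by rw [hnorm]; exact h2.le)
  refine ⟨z'', congrArg Prod.fst hz'', fun i => congrFun (congrArg Prod.snd hz'') i, ?_⟩
  rwa [hnorm] at hle

/-- Feasibility of `(x, y)` for the lower level constraints. -/
theorem mem_Y_iff (B : BilevelProgram d s p q m n) (z : Vec (Fin d ⊕ Fin s)) :
    sndBlock z ∈ B.Y (fstBlock z) ↔ (∀ i, B.g i z ≤ 0) ∧ ∀ i, B.h i z = 0 := by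
  simp [Y]

/-- Perturbation of feasible points of the lower level problem in a direction that is strictly
feasible for the linearized constraints. -/
theorem exists_feasible_perturbation {B : BilevelProgram d s p q m n} (hB : B.Regular)
    {z : Vec (Fin d ⊕ Fin s)} (hli : LinearIndependent ℝ fun i => gradY (B.h i) z)
    {zs : ℕ → Vec (Fin d ⊕ Fin s)} (hzs : Tendsto zs atTop (𝓝 z))
    (hfeas : ∀ k, sndBlock (zs k) ∈ B.Y (fstBlock (zs k)))
    {t : ℕ → ℝ} (ht : ∀ k, 0 < t k) (ht0 : Tendsto t atTop (𝓝 0))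
    {es : ℕ → Vec (Fin d)} {e : Vec (Fin d)} (hes : Tendsto es atTop (𝓝 e)) {r : Vec (Fin s)}
    (hg : ∀ i, B.g i z = 0 → 0 < inner ℝ (gradient (B.g i) z) (pair e r))
    (hh : ∀ i, inner ℝ (gradient (B.h i) z) (pair e r) = 0) :
    ∃ ws : ℕ → Vec (Fin d ⊕ Fin s), Tendsto ws atTop (𝓝 z) ∧
      Tendsto (fun k => (t k)⁻¹ • (zs k - ws k)) atTop (𝓝 (pair e r)) ∧
      ∀ᶠ k in atTop, fstBlock (ws k) = fstBlock (zs k) - t k • es k ∧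
        sndBlock (ws k) ∈ B.Y (fstBlock (ws k)) := by
  have hhz : ∀ i, B.h i z = 0 := fun i =>
    tendsto_nhds_unique (((hB.h_smooth i).continuous.tendsto z).comp hzs)
      (by simp [Function.comp_def, ((B.mem_Y_iff _).mp (hfeas _)).2 i])
  have hgz : ∀ i, B.g i z ≤ 0 := fun i =>
    le_of_tendsto' (((hB.g_smooth i).continuous.tendsto z).comp hzs)
      fun k => ((B.mem_Y_iff _).mp (hfeas k)).1 i
  obtain ⟨C, hC, hrest⟩ := exists_restoration hB.h_smooth hli hhz
  set ps : ℕ → Vec (Fin d ⊕ Fin s) := fun k => zs k - t k • pair (es k) r with hps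
  have hpq : ∀ k, (t k)⁻¹ • (zs k - ps k) = pair (es k) r := fun k => by
    simp only [hps, sub_sub_cancel]
    rw [smul_smul, inv_mul_cancel₀ (ht k).ne', one_smul]
  have hpair : Tendsto (fun k => pair (es k) r) atTop (𝓝 (pair e r)) :=
    hes.pair tendsto_const_nhds
  have hps0 : Tendsto ps atTop (𝓝 z) := by
    simpa using hzs.sub (ht0.smul hpair)
  -- The equalities hold at `zs k` and (e, r) is tangent to them, so the shifted point violates them
  -- by o(t) and restoring them does not change the limit quotient.
  have hhp : Tendsto (fun k => (t k)⁻¹ * ‖fun i => B.h i (ps k)‖) atTop (𝓝 0) := by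
    have h1 : ∀ i, Tendsto (fun k => (t k)⁻¹ * B.h i (ps k)) atTop (𝓝 0) := by
      intro i
      have := tendsto_difference_quotient (t := t) (q := pair e r) (hB.h_smooth i) hzs hps0
        (by simpa only [hpq] using hpair)
      rw [hh i] at this
      have h2 := this.neg
      simpa [((B.mem_Y_iff _).mp (hfeas _)).2 i] using h2
    have h2 : Tendsto (fun k => ‖fun i => (t k)⁻¹ * B.h i (ps k)‖) atTop (𝓝 ‖(0 : Fin n → ℝ)‖) :=
      (tendsto_pi_nhds.mpr h1).norm
    rw [norm_zero] at h2
    refine h2.congr fun k => ?_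
    have : (fun i => (t k)⁻¹ * B.h i (ps k)) = (t k)⁻¹ • fun i => B.h i (ps k) := rfl
    rw [this, norm_smul, Real.norm_eq_abs, abs_of_pos (inv_pos.mpr (ht k))]
  have hchoice : ∀ k, ∃ w, (∃ z'', fstBlock z'' = fstBlock (ps k) ∧ (∀ i, B.h i z'' = 0) ∧
      ‖z'' - ps k‖ ≤ C * ‖fun i => B.h i (ps k)‖) → fstBlock w = fstBlock (ps k) ∧
      (∀ i, B.h i w = 0) ∧ ‖w - ps k‖ ≤ C * ‖fun i => B.h i (ps k)‖ := by
    intro k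
    by_cases hk : ∃ z'', fstBlock z'' = fstBlock (ps k) ∧ (∀ i, B.h i z'' = 0) ∧
      ‖z'' - ps k‖ ≤ C * ‖fun i => B.h i (ps k)‖
    · exact ⟨hk.choose, fun _ => hk.choose_spec⟩
    · exact ⟨z, fun h => absurd h hk⟩
  choose ws hws using hchoice
  have hev : ∀ᶠ k in atTop, fstBlock (ws k) = fstBlock (ps k) ∧
      (∀ i, B.h i (ws k) = 0) ∧ ‖ws k - ps k‖ ≤ C * ‖fun i => B.h i (ps k)‖ :=
    (hps0.eventually hrest).mono fun k hk => hws k hk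
  have hdiff : Tendsto (fun k => (t k)⁻¹ • (ps k - ws k)) atTop (𝓝 0) := by
    refine squeeze_zero_norm' ?_ (by simpa using hhp.const_mul C)
    filter_upwards [hev] with k hk
    rw [norm_smul, Real.norm_eq_abs, abs_of_pos (inv_pos.mpr (ht k)), norm_sub_rev]
    calc (t k)⁻¹ * ‖ws k - ps k‖ ≤ (t k)⁻¹ * (C * ‖fun i => B.h i (ps k)‖) := by
          have := inv_pos.mpr (ht k)
          gcongr
          exact hk.2.2
      _ = C * ((t k)⁻¹ * ‖fun i => B.h i (ps k)‖) := by ring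
  have hquot : Tendsto (fun k => (t k)⁻¹ • (zs k - ws k)) atTop (𝓝 (pair e r)) := by
    have := hpair.add hdiff
    rw [add_zero] at this
    refine this.congr fun k => ?_
    rw [← hpq k, ← smul_add, sub_add_sub_cancel]
  have hws0 : Tendsto ws atTop (𝓝 z) := by
    have := hzs.sub (ht0.smul hquot)
    rw [zero_smul, sub_zero] at this
    refine this.congr fun k => ?_
    rw [smul_smul, mul_inv_cancel₀ (ht k).ne', one_smul, sub_sub_cancel]
  -- For an active constraint the difference quotient has a positive limit, so g decreases strictly
  -- from `zs k` to `ws k`; inactive constraints stay negative by continuity.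
  have hgev : ∀ᶠ k in atTop, ∀ i, B.g i (ws k) ≤ 0 := by
    refine eventually_all.mpr fun i => ?_
    rcases (hgz i).eq_or_lt with h0 | h0
    · have := tendsto_difference_quotient (hB.g_smooth i) hzs hws0 hquot
      filter_upwards [this.eventually (lt_mem_nhds (hg i h0))] with k hk
      have h1 : 0 < B.g i (zs k) - B.g i (ws k) := pos_of_mul_pos_right hk (inv_pos.mpr (ht k)).le
      linarith [((B.mem_Y_iff _).mp (hfeas k)).1 i]
    · exact ((((hB.g_smooth i).continuous.tendsto z).comp hws0).eventually
        (gt_mem_nhds h0)).mono fun k hk => hk.le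
  refine ⟨ws, hws0, hquot, ?_⟩
  filter_upwards [hev, hgev] with k h1 h2
  exact ⟨h1.1, (B.mem_Y_iff _).mpr ⟨h2, h1.2.1⟩⟩

end BilevelProgram

/-! ### MFCQ and linear programming duality -/

namespace BilevelProgram

variable {d s p q m n : ℕ} {B : BilevelProgram d s p q m n}

/-- The dual form of the Mangasarian-Fromovitz constraint qualification: positive linear
independence of the lower level constraint gradients. -/
def DualMFCQ (B : BilevelProgram d s p q m n) (z : Vec (Fin d ⊕ Fin s)) : Prop :=
  ∀ (u : Fin m → ℝ) (v : Fin n → ℝ), (∀ i, 0 ≤ u i) → (∀ i, B.g i z ≠ 0 → u i = 0) →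
    ∑ i, u i • gradY (B.g i) z + ∑ i, v i • gradY (B.h i) z = 0 → u = 0 ∧ v = 0

/-- Pairing a vanishing combination with the direction t kills the h-terms and leaves nonpositive
g-terms, strictly negative wherever an active multiplier is positive. -/
theorem MFCQ.dualMFCQ {x : Vec (Fin d)} {y : Vec (Fin s)} (h : B.MFCQ x y) :
    B.DualMFCQ (pair x y) := by
  obtain ⟨hli, t, hth, htg⟩ := h
  intro u v hu hact hsum
  have h1 : ∑ i, u i * inner ℝ (gradY (B.g i) (pair x y)) t = 0 := by
    have := congrArg (fun w => inner ℝ w t) hsum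
    simpa [inner_add_left, sum_inner, real_inner_smul_left, hth] using this
  have hterm : ∀ i, u i * inner ℝ (gradY (B.g i) (pair x y)) t ≤ 0 := by
    intro i
    by_cases hi : B.g i (pair x y) = 0
    · exact mul_nonpos_of_nonneg_of_nonpos (hu i) (htg i hi).le
    · simp [hact i hi]
  have hu0 : u = 0 := by
    funext i
    by_contra hne
    have hi : B.g i (pair x y) = 0 := by
      by_contra hi
      exact hne (hact i hi)
    have h2 := (Finset.sum_eq_zero_iff_of_nonpos fun i _ => hterm i).mp h1 i (Finset.mem_univ i)
    rcases mul_eq_zero.mp h2 with h3 | h3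
    · exact hne h3
    · exact (htg i hi).ne h3
  refine ⟨hu0, ?_⟩
  rw [hu0] at hsum
  simp only [Pi.zero_apply, zero_smul, Finset.sum_const_zero, zero_add] at hsum
  exact funext (Fintype.linearIndependent_iff.mp hli v hsum)

theorem DualMFCQ.linearIndependent {z : Vec (Fin d ⊕ Fin s)} (h : B.DualMFCQ z) :
    LinearIndependent ℝ fun i => gradY (B.h i) z := by
  rw [Fintype.linearIndependent_iff]
  intro v hv i
  have := h 0 v (fun _ => le_rfl) (fun _ _ => rfl) (by simpa using hv)
  exact congrFun this.2 i

theorem Regular.continuous_gradX {φ : Vec (Fin d ⊕ Fin s) → ℝ} (hφ : ContDiff ℝ 1 φ) :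
    Continuous (gradX φ) :=
  continuous_fstBlock.comp hφ.continuous_gradient

theorem Regular.continuous_gradY {φ : Vec (Fin d ⊕ Fin s) → ℝ} (hφ : ContDiff ℝ 1 φ) :
    Continuous (gradY φ) :=
  continuous_sndBlock.comp hφ.continuous_gradient

/-- Quantitative and locally uniform form of positive linear independence. -/
theorem DualMFCQ.exists_bound (hB : B.Regular) {z : Vec (Fin d ⊕ Fin s)} (h : B.DualMFCQ z) :
    ∃ ε > 0, ∀ᶠ z' in 𝓝 z, ∀ (u : Fin m → ℝ) (v : Fin n → ℝ), (∀ i, 0 ≤ u i) →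
      (∀ i, B.g i z' ≠ 0 → u i = 0) →
      ε * ‖(u, v)‖ ≤ ‖∑ i, u i • gradY (B.g i) z' + ∑ i, v i • gradY (B.h i) z'‖ := by
  by_contra hcon
  push Not at hcon
  -- The estimate is positively homogeneous, so failures can be rescaled to multipliers of norm one
  -- whose combinations tend to 0; a limit point contradicts positive linear independence at z.
  have hseq : ∀ k : ℕ, ∃ z', ‖z' - z‖ < 1 / ((k : ℝ) + 1) ∧ ∃ (u : Fin m → ℝ) (v : Fin n → ℝ),
      (∀ i, 0 ≤ u i) ∧ (∀ i, B.g i z' ≠ 0 → u i = 0) ∧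
      ‖∑ i, u i • gradY (B.g i) z' + ∑ i, v i • gradY (B.h i) z'‖ < 1 / ((k : ℝ) + 1) ∧
      ‖(u, v)‖ = 1 := by
    intro k
    have hk : (0 : ℝ) < 1 / ((k : ℝ) + 1) := by positivity
    obtain ⟨z', ⟨u, v, h1, h2, h3⟩, h4⟩ :=
      ((hcon _ hk).and_eventually (Metric.ball_mem_nhds z hk)).exists
    have hpos : 0 < ‖(u, v)‖ := by
      rcases (norm_nonneg (u, v)).eq_or_lt with h0 | h0
      · rw [← h0, mul_zero] at h3
        exact absurd h3 (norm_nonneg _).not_gt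
      · exact h0
    set ρ := ‖(u, v)‖⁻¹ with hρ
    have hρ0 : 0 < ρ := inv_pos.mpr hpos
    refine ⟨z', by simpa [dist_eq_norm] using h4, ρ • u, ρ • v, fun i => mul_nonneg hρ0.le (h1 i),
      fun i hi => by simp [h2 i hi], ?_, ?_⟩
    · have : ∑ i, (ρ • u) i • gradY (B.g i) z' + ∑ i, (ρ • v) i • gradY (B.h i) z'
          = ρ • (∑ i, u i • gradY (B.g i) z' + ∑ i, v i • gradY (B.h i) z') := by
        simp [Finset.smul_sum, smul_smul]
      rw [this, norm_smul, Real.norm_eq_abs, abs_of_pos hρ0, hρ, inv_mul_lt_iff₀ hpos, mul_comm]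
      exact h3
    · have : (ρ • u, ρ • v) = ρ • (u, v) := rfl
      rw [this, norm_smul, Real.norm_eq_abs, abs_of_pos hρ0, hρ, inv_mul_cancel₀ hpos.ne']
  choose zs hzs u v hu hact hsmall hone using hseq
  have hlim0 := tendsto_one_div_add_atTop_nhds_zero_nat (𝕜 := ℝ)
  have hz : Tendsto zs atTop (𝓝 z) :=
    tendsto_iff_norm_sub_tendsto_zero.mpr
      (squeeze_zero (fun _ => norm_nonneg _) (fun k => (hzs k).le) hlim0)
  obtain ⟨⟨u₀, v₀⟩, hmem, σ, hσ, hlim⟩ := (isCompact_sphere (0 : (Fin m → ℝ) × (Fin n → ℝ)) 1).tendsto_subseq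
    (x := fun k => (u k, v k)) (fun k => by simpa using hone k)
  have hzσ := hz.comp hσ.tendsto_atTop
  have hu₀ : ∀ i, Tendsto (fun k => u (σ k) i) atTop (𝓝 (u₀ i)) :=
    tendsto_pi_nhds.mp ((continuous_fst.tendsto _).comp hlim)
  have hv₀ : ∀ i, Tendsto (fun k => v (σ k) i) atTop (𝓝 (v₀ i)) :=
    tendsto_pi_nhds.mp ((continuous_snd.tendsto _).comp hlim)
  have hzero := h u₀ v₀ (fun i => ge_of_tendsto' (hu₀ i) fun k => hu _ i) (fun i hi => by
      have h1 : ∀ᶠ k in atTop, B.g i (zs (σ k)) ≠ 0 :=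
        (((hB.g_smooth i).continuous.tendsto z).comp hzσ).eventually_ne hi
      exact tendsto_nhds_unique (hu₀ i) (tendsto_const_nhds.congr' (h1.mono fun k hk =>
        (hact _ i hk).symm))) (by
      have h1 : Tendsto (fun k => ∑ i, u (σ k) i • gradY (B.g i) (zs (σ k))
          + ∑ i, v (σ k) i • gradY (B.h i) (zs (σ k))) atTop
          (𝓝 (∑ i, u₀ i • gradY (B.g i) z + ∑ i, v₀ i • gradY (B.h i) z)) :=
        (tendsto_finsetSum _ fun i _ => (hu₀ i).smul
          (((Regular.continuous_gradY (hB.g_smooth i)).tendsto z).comp hzσ)).add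
        (tendsto_finsetSum _ fun i _ => (hv₀ i).smul
          (((Regular.continuous_gradY (hB.h_smooth i)).tendsto z).comp hzσ))
      exact tendsto_nhds_unique h1 (squeeze_zero_norm (fun k => (hsmall (σ k)).le)
        (hlim0.comp hσ.tendsto_atTop)))
  have : ‖(u₀, v₀)‖ = 1 := by simpa using hmem
  rw [hzero.1, hzero.2] at this
  simp at this

theorem DualMFCQ.eventually (hB : B.Regular) {z : Vec (Fin d ⊕ Fin s)} (h : B.DualMFCQ z) :
    ∀ᶠ z' in 𝓝 z, B.DualMFCQ z' := by
  obtain ⟨ε, hε, hev⟩ := h.exists_bound hB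
  filter_upwards [hev] with z' hz' u v hu hact hsum
  have h1 := hz' u v hu hact
  rw [hsum, norm_zero] at h1
  have h2 : ‖(u, v)‖ ≤ 0 := nonpos_of_mul_nonpos_right h1 hε
  have h3 := norm_le_zero_iff.mp h2
  exact Prod.mk_eq_zero.mp h3

/-- The set of all `∇_x f + u ∇_x g + v ∇_x h` at `(x, y)` is indexed by the multipliers. -/
noncomputable def gradXLagrangian (B : BilevelProgram d s p q m n) (u : Vec (Fin m))
    (v : Vec (Fin n)) (w : Vec (Fin d ⊕ Fin s)) : Vec (Fin d) :=
  gradX B.f w + ∑ i, u i • gradX (B.g i) w + ∑ i, v i • gradX (B.h i) w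

/-- Linear programming duality for the sensitivity of the lower level problem in direction `e`. -/
theorem exists_multiplier_or_direction {x : Vec (Fin d)} {y : Vec (Fin s)}
    (h : B.DualMFCQ (pair x y)) (e : Vec (Fin d)) (c : ℝ) :
    (∃ uv ∈ B.multipliers x y, inner ℝ (B.gradXLagrangian uv.1 uv.2 (pair x y)) e ≤ c) ∨
    ∃ r : Vec (Fin s), (∀ i, B.g i (pair x y) = 0 →
      0 < inner ℝ (gradient (B.g i) (pair x y)) (pair e r)) ∧
      (∀ i, inner ℝ (gradient (B.h i) (pair x y)) (pair e r) = 0) ∧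
      c < inner ℝ (gradient B.f (pair x y)) (pair e r) := by
  classical
  set z := pair x y with hz
  -- Homogenization: the extra coordinate τ scales the fixed part e. The vector `L 0 1` in `cf`
  -- forces τ > 0, and division by τ recovers r.
  let L : Vec (Fin s) → ℝ → Vec (Fin s ⊕ Unit) := fun a α => pair a (WithLp.toLp 2 fun _ => α)
  have hinner : ∀ a α (q' : Vec (Fin s ⊕ Unit)),
      inner ℝ (L a α) q' = inner ℝ a (fstBlock q') + α * q' (Sum.inr ()) := by
    intro a α q'
    rw [← pair_fstBlock_sndBlock q', inner_pair]
    simp [PiLp.inner_apply, mul_comm]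
  let cf : {i // B.g i z = 0} ⊕ Unit ⊕ Unit → Vec (Fin s ⊕ Unit) :=
    Sum.elim (fun i => L (gradY (B.g i) z) (inner ℝ (gradX (B.g i) z) e))
      (Sum.elim (fun _ => L (gradY B.f z) (inner ℝ (gradX B.f z) e - c)) (fun _ => L 0 1))
  let bf : Fin n → Vec (Fin s ⊕ Unit) :=
    fun i => L (gradY (B.h i) z) (inner ℝ (gradX (B.h i) z) e)
  rcases exists_inner_pos_or_exists_combination_eq_zero cf bf with
    ⟨w, hpos, hzero⟩ | ⟨P, v, hP, hPne, hsum⟩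
  · right
    set τ := w (Sum.inr ()) with hτ
    have hτ0 : 0 < τ := by
      have := hpos (Sum.inr (Sum.inr ()))
      simpa [cf, hinner] using this
    have hscale : ∀ φ : Vec (Fin d ⊕ Fin s) → ℝ,
        inner ℝ (gradient φ z) (pair e (τ⁻¹ • fstBlock w)) =
          τ⁻¹ * (inner ℝ (gradY φ z) (fstBlock w) + inner ℝ (gradX φ z) e * τ) := by
      intro φ
      rw [inner_gradient_pair, inner_smul_right]
      field_simp
      ring
    refine ⟨τ⁻¹ • fstBlock w, fun i hi => ?_, fun i => ?_, ?_⟩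
    · rw [hscale]
      have := hpos (Sum.inl ⟨i, hi⟩)
      simp only [cf, Sum.elim_inl, hinner] at this
      exact mul_pos (inv_pos.mpr hτ0) this
    · rw [hscale]
      have := hzero i
      simp only [bf, hinner] at this
      rw [this, mul_zero]
    · rw [hscale, ← div_eq_inv_mul, lt_div_iff₀ hτ0]
      have := hpos (Sum.inr (Sum.inl ()))
      simp only [cf, Sum.elim_inl, Sum.elim_inr, hinner] at this
      linarith
  · left
    set p₀ := P (Sum.inr (Sum.inl ())) with hp₀
    set p₁ := P (Sum.inr (Sum.inr ())) with hp₁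
    set u' : Fin m → ℝ := fun i => if hi : B.g i z = 0 then P (Sum.inl ⟨i, hi⟩) else 0 with hu'
    have hu'0 : ∀ i, 0 ≤ u' i := fun i => by
      simp only [hu']; split_ifs
      · exact hP _
      · exact le_rfl
    have hact : ∀ i, B.g i z ≠ 0 → u' i = 0 := fun i hi => by simp [hu', hi]
    have hsub : ∀ {M : Type} [AddCommGroup M] [Module ℝ M] (a : Fin m → M),
        ∑ i : {i // B.g i z = 0}, P (Sum.inl i) • a i = ∑ i, u' i • a i := by
      intro M _ _ a
      rw [← Finset.sum_filter_of_ne (p := fun i => B.g i z = 0) (fun i _ h => by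
        by_contra hi; simp [hact i hi] at h),
        Finset.sum_subtype (p := fun i => B.g i z = 0) _ (by simp)]
      exact Finset.sum_congr rfl fun i _ => by simp [hu', i.2]
    have hq := fun w : Vec (Fin s ⊕ Unit) => congrArg (fun w' => inner ℝ w' w) hsum
    simp only [inner_add_left, sum_inner, real_inner_smul_left, Fintype.sum_sum_type, cf, bf,
      Sum.elim_inl, Sum.elim_inr, hinner, inner_zero_left, Finset.univ_unique,
      PUnit.default_eq_unit, Finset.sum_singleton, ← hp₀, ← hp₁, zero_add, one_mul] at hq
    have hfirst : p₀ • gradY B.f z + ∑ i, u' i • gradY (B.g i) z + ∑ i, v i • gradY (B.h i) z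
        = 0 := by
      refine ext_inner_right ℝ fun r => ?_
      have := hq (L r 0)
      simp only [L, fstBlock_pair, pair_apply_inr, mul_zero, add_zero] at this
      rw [← hsub]
      simp only [inner_add_left, sum_inner, real_inner_smul_left, inner_zero_left]
      linarith
    have hsecond : p₀ * (inner ℝ (gradX B.f z) e - c) + p₁ +
        ∑ i, u' i * inner ℝ (gradX (B.g i) z) e + ∑ i, v i * inner ℝ (gradX (B.h i) z) e = 0 := by
      have := hq (L 0 1)
      simp only [L, fstBlock_pair, pair_apply_inr, mul_one, inner_zero_right, zero_add] at this
      have h2 := hsub fun i => inner ℝ (gradX (B.g i) z) e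
      simp only [smul_eq_mul] at h2
      linarith
    have hp₀0 : 0 ≤ p₀ := hP _
    have hp₁0 : 0 ≤ p₁ := hP _
    -- If the coefficient p₀ of ∇f vanished, `DualMFCQ` would annihilate all coefficients. Otherwise
    -- division by p₀ gives a multiplier, and p₁ ≥ 0 is the slack in the inequality with c.
    rcases hp₀0.eq_or_lt with h0 | h0
    · exfalso
      rw [← h0, zero_smul, zero_add] at hfirst
      obtain ⟨hu0, hv0⟩ := h u' v hu'0 hact hfirst
      rw [← h0, hu0, hv0] at hsecond
      simp only [Pi.zero_apply, zero_mul, Finset.sum_const_zero, zero_add, add_zero] at hsecond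
      obtain ⟨i, hi⟩ := hPne
      rcases i with i | i | i
      · have := congrFun hu0 i
        simp only [hu', i.2, dif_pos, Pi.zero_apply] at this
        exact hi this
      · exact hi h0.symm
      · exact hi hsecond
    · refine ⟨(WithLp.toLp 2 (p₀⁻¹ • u'), WithLp.toLp 2 (p₀⁻¹ • v)), ⟨?_, fun i => ?_, ?_⟩, ?_⟩
      · have := congrArg (fun w => p₀⁻¹ • w) hfirst
        simpa [gradYLagrangian, smul_add, Finset.smul_sum, smul_smul, h0.ne'] using this
      · exact mul_nonneg (inv_nonneg.mpr hp₀0) (hu'0 i)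
      · refine Finset.sum_eq_zero fun i _ => ?_
        by_cases hi : B.g i z = 0
        · simp [← hz, hi]
        · simp [hact i hi]
      · have h3 : inner ℝ (B.gradXLagrangian (WithLp.toLp 2 (p₀⁻¹ • u')) (WithLp.toLp 2 (p₀⁻¹ • v)) z) e
            = p₀⁻¹ * (p₀ * inner ℝ (gradX B.f z) e + ∑ i, u' i * inner ℝ (gradX (B.g i) z) e
              + ∑ i, v i * inner ℝ (gradX (B.h i) z) e) := by
          simp only [gradXLagrangian, inner_add_left, sum_inner, real_inner_smul_left, mul_add,
            inv_mul_cancel_left₀ h0.ne', Finset.mul_sum, Pi.smul_apply, smul_eq_mul, mul_assoc]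
        change inner ℝ (B.gradXLagrangian _ _ z) e ≤ c
        rw [h3, inv_mul_le_iff₀ h0]
        linarith

end BilevelProgram

/-! ### Stability of the lower level and growth of the value function -/

namespace BilevelProgram

variable {d s p q m n : ℕ} {B : BilevelProgram d s p q m n}

theorem mem_Y_of_tendsto (hB : B.Regular) {xs : ℕ → Vec (Fin d)} {ys : ℕ → Vec (Fin s)}
    {x : Vec (Fin d)} {y : Vec (Fin s)} (hx : Tendsto xs atTop (𝓝 x))
    (hy : Tendsto ys atTop (𝓝 y)) (h : ∀ᶠ k in atTop, ys k ∈ B.Y (xs k)) : y ∈ B.Y x := by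
  have hz := hx.pair hy
  refine ⟨fun i => le_of_tendsto (((hB.g_smooth i).continuous.tendsto _).comp hz)
    (h.mono fun k hk => hk.1 i), fun i => tendsto_nhds_unique
    (((hB.h_smooth i).continuous.tendsto _).comp hz)
    (tendsto_const_nhds.congr' (h.mono fun k hk => (hk.2 i).symm))⟩

theorem isClosed_Y (hB : B.Regular) (x : Vec (Fin d)) : IsClosed (B.Y x) :=
  IsSeqClosed.isClosed fun _ _ h hy =>
    mem_Y_of_tendsto hB (tendsto_const_nhds (x := x)) hy (Eventually.of_forall h)

theorem S_nonempty (hB : B.Regular) {x : Vec (Fin d)} {K : Set (Vec (Fin s))} (hK : IsCompact K)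
    (hYK : B.Y x ⊆ K) (hY : (B.Y x).Nonempty) : (B.S x).Nonempty := by
  have hc : Continuous fun y => B.f (pair x y) :=
    hB.f_smooth.continuous.comp (continuous_const.pair continuous_id)
  obtain ⟨y, hy, hmin⟩ := (hK.of_isClosed_subset (isClosed_Y hB x) hYK).exists_isMinOn hY
    hc.continuousOn
  exact ⟨y, hy, fun y' hy' => hmin hy'⟩

theorem V_eq {x : Vec (Fin d)} {y : Vec (Fin s)} (hy : y ∈ B.S x) : B.V x = B.f (pair x y) := by
  refine IsLeast.csInf_eq ⟨⟨y, hy.1, rfl⟩, ?_⟩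
  rintro _ ⟨y', hy', rfl⟩
  exact hy.2 y' hy'

theorem V_le {x : Vec (Fin d)} {y : Vec (Fin s)} (hS : (B.S x).Nonempty) (hy : y ∈ B.Y x) :
    B.V x ≤ B.f (pair x y) := by
  obtain ⟨y', hy'⟩ := hS
  rw [V_eq hy']
  exact hy'.2 y hy

/-- Inner semicontinuity of the lower level feasible set at some lower level solution. -/
def InnerSemicontinuousAt (B : BilevelProgram d s p q m n) (x : Vec (Fin d)) : Prop :=
  ∀ xs : ℕ → Vec (Fin d), Tendsto xs atTop (𝓝 x) →
    ∃ y ∈ B.S x, ∃ ys : ℕ → Vec (Fin s), Tendsto ys atTop (𝓝 y) ∧ ∀ᶠ k in atTop, ys k ∈ B.Y (xs k)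

/-- Stability of the lower level problem at `x`. -/
structure StableAt (B : BilevelProgram d s p q m n) (x : Vec (Fin d)) : Prop where
  bounded : ∃ K, IsCompact K ∧ ∀ᶠ x' in 𝓝 x, B.Y x' ⊆ K
  inner : B.InnerSemicontinuousAt x
  nonempty : ∀ᶠ x' in 𝓝 x, (B.S x').Nonempty

/-- Boundedness gives a limit and closedness its feasibility. For optimality it suffices that a
single solution at x is approximated by feasible points at the `xs k`. -/
theorem exists_S_subseq (hB : B.Regular) {x : Vec (Fin d)}
    (hbdd : ∃ K, IsCompact K ∧ ∀ᶠ x' in 𝓝 x, B.Y x' ⊆ K) (hinner : B.InnerSemicontinuousAt x)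
    {xs : ℕ → Vec (Fin d)} (hx : Tendsto xs atTop (𝓝 x)) {ys : ℕ → Vec (Fin s)}
    (hys : ∀ k, ys k ∈ B.S (xs k)) :
    ∃ y ∈ B.S x, ∃ σ : ℕ → ℕ, StrictMono σ ∧ Tendsto (fun k => ys (σ k)) atTop (𝓝 y) := by
  obtain ⟨K, hK, hYK⟩ := hbdd
  obtain ⟨y, -, σ, hσ, hlim⟩ := tendsto_subseq_of_frequently_bounded hK.isBounded
    ((hx.eventually hYK).mono fun k hk => hk (hys k).1).frequently
  have hxσ := hx.comp hσ.tendsto_atTop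
  refine ⟨y, ⟨mem_Y_of_tendsto hB hxσ hlim (Eventually.of_forall fun k => (hys _).1),
    fun y' hy' => ?_⟩, σ, hσ, hlim⟩
  obtain ⟨y₁, hy₁, ys', hys'lim, hys'⟩ := hinner (fun k => xs (σ k)) hxσ
  have h1 : B.f (pair x y) ≤ B.f (pair x y₁) :=
    le_of_tendsto_of_tendsto ((hB.f_smooth.continuous.tendsto _).comp (hxσ.pair hlim))
      ((hB.f_smooth.continuous.tendsto _).comp (hxσ.pair hys'lim))
      (hys'.mono fun k hk => (hys (σ k)).2 _ hk)
  exact h1.trans (hy₁.2 y' hy')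

theorem StableAt.exists_minimizers (hB : B.Regular) {x : Vec (Fin d)} (h : B.StableAt x)
    {xs : ℕ → Vec (Fin d)} (hx : Tendsto xs atTop (𝓝 x)) :
    ∃ y ∈ B.S x, ∃ (σ : ℕ → ℕ) (ys : ℕ → Vec (Fin s)), StrictMono σ ∧
      (∀ k, ys k ∈ B.S (xs (σ k))) ∧ Tendsto ys atTop (𝓝 y) := by
  obtain ⟨N, hN⟩ := eventually_atTop.mp (hx.eventually h.nonempty)
  choose ys hys using fun k => hN (k + N) (by omega)
  obtain ⟨y, hy, σ, hσ, hlim⟩ := exists_S_subseq hB h.bounded h.inner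
    (hx.comp (tendsto_add_atTop_nat N)) hys
  exact ⟨y, hy, fun k => σ k + N, fun k => ys (σ k), hσ.add_const N, fun k => hys _, hlim⟩

theorem StableAt.continuousAt_V (hB : B.Regular) {x : Vec (Fin d)} (h : B.StableAt x) :
    ContinuousAt B.V x := by
  refine tendsto_of_seq_tendsto fun xs hx => ?_
  refine tendsto_of_subseq_tendsto fun ns hns => ?_
  obtain ⟨y, hy, σ, ys, hσ, hys, hlim⟩ := h.exists_minimizers hB (hx.comp hns)
  refine ⟨σ, ?_⟩
  have h1 : ∀ k, B.V (xs (ns (σ k))) = B.f (pair (xs (ns (σ k))) (ys k)) := fun k => V_eq (hys k)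
  simp only [Function.comp_apply, h1, V_eq hy]
  exact (hB.f_smooth.continuous.tendsto _).comp
    (((hx.comp hns).comp hσ.tendsto_atTop).pair hlim)

/-- The properties of a set-valued map `𝒲` at `x` which make `co 𝒲` an outer approximation of
the subdifferential of the value function. -/
structure GradientMapAt (B : BilevelProgram d s p q m n) (𝒲 : Vec (Fin d) → Set (Vec (Fin d)))
    (x : Vec (Fin d)) : Prop where
  continuousAt : ContinuousAt B.V x
  closed : ∀ xs : ℕ → Vec (Fin d), Tendsto xs atTop (𝓝 x) → ∀ ws : ℕ → Vec (Fin d),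
    (∀ k, ws k ∈ 𝒲 (xs k)) →
      ∃ w ∈ 𝒲 x, ∃ σ : ℕ → ℕ, StrictMono σ ∧ Tendsto (fun k => ws (σ k)) atTop (𝓝 w)
  descent : ∀ (t : ℕ → ℝ) (es : ℕ → Vec (Fin d)) (e : Vec (Fin d)) (c : ℝ), (∀ k, 0 < t k) →
    Tendsto t atTop (𝓝 0) → Tendsto es atTop (𝓝 e) → (∀ w ∈ 𝒲 x, c < inner ℝ w e) →
      ∃ᶠ k in atTop, B.V x - B.V (x + t k • es k) ≤ -(c * t k)

theorem tendsto_add_smul {E : Type*} [NormedAddCommGroup E] [NormedSpace ℝ E] {t : ℕ → ℝ}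
    {es : ℕ → E} {x e : E} (ht : Tendsto t atTop (𝓝 0)) (hes : Tendsto es atTop (𝓝 e)) :
    Tendsto (fun k => x + t k • es k) atTop (𝓝 x) := by
  simpa using (ht.smul hes).const_add x

/-- Minimizers converge only along a subsequence; this is why `descent` claims its estimate
infinitely often and not eventually. -/
theorem frequently_of_eventually_comp {P : ℕ → Prop} {σ : ℕ → ℕ} (hσ : StrictMono σ)
    (h : ∀ᶠ k in atTop, P (σ k)) : ∃ᶠ k in atTop, P k :=
  hσ.tendsto_atTop.frequently h.frequently

/-- With Y fixed, a minimizer at x + t e is a competitor at x, so V grows at least as f(·, y_k)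
does, at a rate tending to ⟨∇_x f(x,y), e⟩ for the limit minimizer y. -/
theorem gradientMapAt_WFixed (hB : B.Regular) {Y₀ : Set (Vec (Fin s))} (hY₀ : IsCompact Y₀)
    (hY : ∀ x', B.Y x' = Y₀) (hne : Y₀.Nonempty) (x : Vec (Fin d)) :
    B.GradientMapAt B.WFixed x := by
  have hS : ∀ x', (B.S x').Nonempty := fun x' =>
    S_nonempty hB hY₀ (hY x').subset (by rw [hY]; exact hne)
  have hstable : B.StableAt x :=
    { bounded := ⟨Y₀, hY₀, Eventually.of_forall fun x' => (hY x').subset⟩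
      inner := fun xs _ => by
        obtain ⟨y, hy⟩ := hS x
        refine ⟨y, hy, fun _ => y, tendsto_const_nhds, Eventually.of_forall fun k => ?_⟩
        have := hy.1
        rw [hY] at this ⊢
        exact this
      nonempty := Eventually.of_forall hS }
  refine ⟨hstable.continuousAt_V hB, fun xs hx ws hws => ?_, fun t es e c ht ht0 hes hc => ?_⟩
  · choose ys hys hw using hws
    obtain ⟨y, hy, σ, hσ, hlim⟩ := exists_S_subseq hB hstable.bounded hstable.inner hx hys
    refine ⟨_, ⟨y, hy, rfl⟩, σ, hσ, ?_⟩
    simp only [← hw]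
    exact ((Regular.continuous_gradX hB.f_smooth).tendsto _).comp
      ((hx.comp hσ.tendsto_atTop).pair hlim)
  · have hx := tendsto_add_smul (x := x) ht0 hes
    obtain ⟨y, hy, σ, ys, hσ, hys, hlim⟩ := hstable.exists_minimizers hB hx
    have hq : Tendsto (fun k => (t (σ k))⁻¹ •
        (pair (x + t (σ k) • es (σ k)) (ys k) - pair x (ys k))) atTop (𝓝 (pair e 0)) := by
      have : ∀ k, (t (σ k))⁻¹ • (pair (x + t (σ k) • es (σ k)) (ys k) - pair x (ys k))
          = pair (es (σ k)) 0 := fun k => by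
        rw [← pair_sub, smul_pair, add_sub_cancel_left, smul_smul,
          inv_mul_cancel₀ (ht _).ne', one_smul, sub_self, smul_zero]
      simp only [this]
      exact (hes.comp hσ.tendsto_atTop).pair tendsto_const_nhds
    have hlim' := tendsto_difference_quotient hB.f_smooth
      ((hx.comp hσ.tendsto_atTop).pair hlim) (tendsto_const_nhds.pair hlim) hq
    rw [inner_gradient_pair, inner_zero_right, add_zero] at hlim'
    refine frequently_of_eventually_comp hσ ?_
    filter_upwards [hlim'.eventually (lt_mem_nhds (hc _ ⟨y, hy, rfl⟩))] with k hk
    rw [lt_inv_mul_iff₀ (ht _)] at hk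
    have h1 := V_eq (hys k)
    have h2 : B.V x ≤ B.f (pair x (ys k)) := V_le (hS x) (by
      have := (hys k).1
      rw [hY] at this ⊢
      exact this)
    simp only [Function.comp_apply] at hk
    rw [h1]
    linarith

theorem mem_W_iff {x w : Vec (Fin d)} : w ∈ B.W x ↔
    ∃ y ∈ B.S x, ∃ uv ∈ B.multipliers x y, w = B.gradXLagrangian uv.1 uv.2 (pair x y) := Iff.rfl

/-- Move y along a strictly feasible direction by a step that is large compared with ‖x - x_k‖; the
displacement in x is then negligible to first order. -/
theorem innerSemicontinuousAt_of_dualMFCQ (hB : B.Regular) {x : Vec (Fin d)} {y : Vec (Fin s)}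
    (hy : y ∈ B.S x) (h : B.DualMFCQ (pair x y)) : B.InnerSemicontinuousAt x := by
  intro xs hx
  -- For e = 0 and c = -1 the multiplier alternative reads 0 ≤ -1, so the direction alternative
  -- holds.
  rcases exists_multiplier_or_direction h 0 (-1) with ⟨uv, -, hle⟩ | ⟨r, hg, hh, -⟩
  · rw [inner_zero_right] at hle
    norm_num at hle
  have hn : Tendsto (fun k => ‖x - xs k‖) atTop (𝓝 0) := by
    have := (hx.const_sub x).norm
    simpa using this
  -- The square root makes (x - x_k)/t_k tend to 0; the summand 1/(k+1) keeps t_k positive even if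
  -- x_k = x.
  set t : ℕ → ℝ := fun k => √‖x - xs k‖ + 1 / ((k : ℝ) + 1) with ht
  have htpos : ∀ k, 0 < t k := fun k => by
    have : (0 : ℝ) < 1 / ((k : ℝ) + 1) := by positivity
    have := Real.sqrt_nonneg ‖x - xs k‖
    simp only [ht]
    linarith
  have hsq : Tendsto (fun k => √‖x - xs k‖) atTop (𝓝 0) := by
    have := (Real.continuous_sqrt.tendsto 0).comp hn
    simpa [Function.comp_def] using this
  have ht0 : Tendsto t atTop (𝓝 0) := by
    rw [← add_zero (0 : ℝ)]
    exact hsq.add tendsto_one_div_add_atTop_nhds_zero_nat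
  have hes : Tendsto (fun k => (t k)⁻¹ • (x - xs k)) atTop (𝓝 0) := by
    refine squeeze_zero_norm (fun k => ?_) hsq
    rw [norm_smul, Real.norm_eq_abs, abs_of_pos (inv_pos.mpr (htpos k)),
      inv_mul_le_iff₀ (htpos k)]
    have h1 := Real.mul_self_sqrt (norm_nonneg (x - xs k))
    have h2 := Real.sqrt_nonneg ‖x - xs k‖
    have h3 : √‖x - xs k‖ ≤ t k := by
      have : (0 : ℝ) < 1 / ((k : ℝ) + 1) := by positivity
      simp only [ht]; linarith
    nlinarith
  obtain ⟨ws, hws, -, hev⟩ := exists_feasible_perturbation hB h.linearIndependent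
    (zs := fun _ => pair x y) tendsto_const_nhds (fun _ => hy.1) htpos ht0 hes hg hh
  refine ⟨y, hy, fun k => sndBlock (ws k), ?_, ?_⟩
  · exact (continuous_sndBlock.tendsto _).comp hws
  · filter_upwards [hev] with k hk
    have h1 : fstBlock (ws k) = xs k := by
      rw [hk.1, smul_smul, mul_inv_cancel₀ (htpos k).ne', one_smul, fstBlock_pair, sub_sub_cancel]
    rw [← h1]
    exact hk.2

/-- Closedness: the quantitative MFCQ bounds the multipliers at minimizers near x. Growth: since
every w exceeds c, duality excludes the multiplier alternative, and minimizers at x + t e are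
carried back to Y(x) along (e, r), where f drops at a rate above c. -/
theorem gradientMapAt_W (hB : B.Regular) {x : Vec (Fin d)} (hstable : B.StableAt x)
    (hdual : ∀ y ∈ B.S x, B.DualMFCQ (pair x y)) : B.GradientMapAt B.W x := by
  refine ⟨hstable.continuousAt_V hB, fun xs hx ws hws => ?_, fun t es e c ht ht0 hes hc => ?_⟩
  · choose ys hys uv huv hw using fun k => mem_W_iff.mp (hws k)
    obtain ⟨y, hy, σ, hσ, hlim⟩ := exists_S_subseq hB hstable.bounded hstable.inner hx hys
    have hz : Tendsto (fun k => pair (xs (σ k)) (ys (σ k))) atTop (𝓝 (pair x y)) :=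
      (hx.comp hσ.tendsto_atTop).pair hlim
    obtain ⟨ε, hε, hbound⟩ := (hdual y hy).exists_bound hB
    have hfb : ∀ᶠ k in atTop, ‖gradY B.f (pair (xs (σ k)) (ys (σ k)))‖
        < ‖gradY B.f (pair x y)‖ + 1 :=
      (((Regular.continuous_gradY hB.f_smooth).norm.tendsto _).comp hz).eventually
        (gt_mem_nhds (by linarith))
    have hcompl : ∀ k i, B.g i (pair (xs k) (ys k)) ≠ 0 → (uv k).1 i = 0 := by
      intro k i hi
      have h1 := (Finset.sum_eq_zero_iff_of_nonpos fun i _ =>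
        mul_nonpos_of_nonpos_of_nonneg ((hys k).1.1 i) ((huv k).2.1 i)).mp (huv k).2.2 i
        (Finset.mem_univ i)
      exact (mul_eq_zero.mp h1).resolve_left hi
    have hub : ∀ᶠ k in atTop, ((uv (σ k)).1.ofLp, (uv (σ k)).2.ofLp) ∈
        Metric.closedBall (0 : (Fin m → ℝ) × (Fin n → ℝ))
          (ε⁻¹ * (‖gradY B.f (pair x y)‖ + 1)) := by
      filter_upwards [hz.eventually hbound, hfb] with k h1 h2
      have h3 := h1 (uv (σ k)).1.ofLp (uv (σ k)).2.ofLp (huv _).2.1 (hcompl _)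
      have h4 : ∑ i, (uv (σ k)).1 i • gradY (B.g i) (pair (xs (σ k)) (ys (σ k)))
          + ∑ i, (uv (σ k)).2 i • gradY (B.h i) (pair (xs (σ k)) (ys (σ k)))
          = -gradY B.f (pair (xs (σ k)) (ys (σ k))) := by
        have := (huv (σ k)).1
        rw [gradYLagrangian, add_assoc] at this
        exact eq_neg_of_add_eq_zero_right this
      rw [h4, norm_neg] at h3
      rw [mem_closedBall_zero_iff, le_inv_mul_iff₀ hε]
      linarith
    obtain ⟨⟨u₀, v₀⟩, -, θ, hθ, hlim'⟩ := tendsto_subseq_of_frequently_bounded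
      Metric.isBounded_closedBall hub.frequently
    have hu₀ : ∀ i, Tendsto (fun k => (uv (σ (θ k))).1 i) atTop (𝓝 (u₀ i)) :=
      tendsto_pi_nhds.mp ((continuous_fst.tendsto _).comp hlim')
    have hv₀ : ∀ i, Tendsto (fun k => (uv (σ (θ k))).2 i) atTop (𝓝 (v₀ i)) :=
      tendsto_pi_nhds.mp ((continuous_snd.tendsto _).comp hlim')
    have hzθ := hz.comp hθ.tendsto_atTop
    refine ⟨B.gradXLagrangian (WithLp.toLp 2 u₀) (WithLp.toLp 2 v₀) (pair x y),
      mem_W_iff.mpr ⟨y, hy, (WithLp.toLp 2 u₀, WithLp.toLp 2 v₀), ⟨?_, fun i => ?_, ?_⟩, rfl⟩,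
      fun k => σ (θ k), hσ.comp hθ, ?_⟩
    · have h1 : Tendsto (fun k => B.gradYLagrangian (uv (σ (θ k))).1 (uv (σ (θ k))).2
          (pair (xs (σ (θ k))) (ys (σ (θ k))))) atTop
          (𝓝 (B.gradYLagrangian (WithLp.toLp 2 u₀) (WithLp.toLp 2 v₀) (pair x y))) :=
        ((((Regular.continuous_gradY hB.f_smooth).tendsto _).comp hzθ).add
          (tendsto_finsetSum _ fun i _ => (hu₀ i).smul
            (((Regular.continuous_gradY (hB.g_smooth i)).tendsto _).comp hzθ))).add
          (tendsto_finsetSum _ fun i _ => (hv₀ i).smul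
            (((Regular.continuous_gradY (hB.h_smooth i)).tendsto _).comp hzθ))
      exact tendsto_nhds_unique h1 (by simp only [(huv _).1]; exact tendsto_const_nhds)
    · exact ge_of_tendsto' (hu₀ i) fun k => (huv _).2.1 i
    · have h1 : Tendsto (fun k => ∑ i, B.g i (pair (xs (σ (θ k))) (ys (σ (θ k))))
          * (uv (σ (θ k))).1 i) atTop (𝓝 (∑ i, B.g i (pair x y) * u₀ i)) :=
        tendsto_finsetSum _ fun i _ =>
          (((hB.g_smooth i).continuous.tendsto _).comp hzθ).mul (hu₀ i)
      exact tendsto_nhds_unique h1 (by simp only [(huv _).2.2]; exact tendsto_const_nhds)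
    · simp only [hw]
      exact ((((Regular.continuous_gradX hB.f_smooth).tendsto _).comp hzθ).add
          (tendsto_finsetSum _ fun i _ => (hu₀ i).smul
            (((Regular.continuous_gradX (hB.g_smooth i)).tendsto _).comp hzθ))).add
          (tendsto_finsetSum _ fun i _ => (hv₀ i).smul
            (((Regular.continuous_gradX (hB.h_smooth i)).tendsto _).comp hzθ))
  · have hx := tendsto_add_smul (x := x) ht0 hes
    obtain ⟨y, hy, σ, ys, hσ, hys, hlim⟩ := hstable.exists_minimizers hB hx
    rcases exists_multiplier_or_direction (hdual y hy) e c with ⟨uv, huv, hle⟩ | ⟨r, hg, hh, hf⟩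
    · exact absurd (hc _ (mem_W_iff.mpr ⟨y, hy, uv, huv, rfl⟩)) hle.not_gt
    have hσt := hσ.tendsto_atTop
    have hzs := (hx.comp hσt).pair hlim
    obtain ⟨ws, hws, hquot, hev⟩ := exists_feasible_perturbation hB (hdual y hy).linearIndependent
      (zs := fun k => pair (x + t (σ k) • es (σ k)) (ys k)) hzs (fun k => (hys k).1)
      (fun k => ht (σ k)) (ht0.comp hσt) (hes.comp hσt) hg hh
    have hlim' := tendsto_difference_quotient hB.f_smooth hzs hws hquot
    refine frequently_of_eventually_comp hσ ?_
    filter_upwards [hlim'.eventually (lt_mem_nhds hf), hev] with k hk hk'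
    have h1 : fstBlock (ws k) = x := by
      rw [hk'.1]
      simp
    rw [h1] at hk'
    have h2 := V_le ⟨y, hy⟩ hk'.2
    rw [← h1, pair_fstBlock_sndBlock, h1] at h2
    have hk : c < (t (σ k))⁻¹ * _ := hk
    rw [lt_inv_mul_iff₀ (ht _)] at hk
    rw [V_eq (hys k)]
    simp only [Function.comp_apply] at hk
    linarith

/-- Limiting subgradients involve nearby points, so the properties are needed around x. `DualMFCQ`
is open, and minimizers at points near x accumulate only in S(x), where it holds. -/
theorem eventually_gradientMapAt_W (hB : B.Regular) {x : Vec (Fin d)}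
    (hY : (B.Y x).Nonempty) (hbdd : ∃ U ∈ 𝓝 x, Bornology.IsBounded (⋃ x' ∈ U, B.Y x'))
    (hcq : ∀ y ∈ B.S x, B.MFCQ x y) : ∀ᶠ x' in 𝓝 x, B.GradientMapAt B.W x' := by
  obtain ⟨U, hU, hUb⟩ := hbdd
  obtain ⟨K, hK, hYK⟩ : ∃ K, IsCompact K ∧ ∀ᶠ x' in 𝓝 x, B.Y x' ⊆ K :=
    ⟨_, hUb.isCompact_closure, by
      filter_upwards [hU] with x' hx'
      exact (Set.subset_biUnion_of_mem (u := B.Y) hx').trans subset_closure⟩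
  have hdual : ∀ y ∈ B.S x, B.DualMFCQ (pair x y) := fun y hy => (hcq y hy).dualMFCQ
  obtain ⟨y₀, hy₀⟩ := S_nonempty hB hK hYK.self_of_nhds hY
  have hinner := innerSemicontinuousAt_of_dualMFCQ hB hy₀ (hdual y₀ hy₀)
  have hYne : ∀ᶠ x' in 𝓝 x, (B.Y x').Nonempty := by
    by_contra hcon
    obtain ⟨xs, hxs, hemp⟩ := exists_seq_forall_of_frequently (not_eventually.mp hcon)
    obtain ⟨y, -, ys, -, hys⟩ := hinner xs hxs
    obtain ⟨k, hk⟩ := hys.exists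
    exact hemp k ⟨_, hk⟩
  have hSne : ∀ᶠ x' in 𝓝 x, (B.S x').Nonempty := by
    filter_upwards [hYne, hYK] with x' h1 h2
    exact S_nonempty hB hK h2 h1
  have hdual' : ∀ᶠ x' in 𝓝 x, ∀ y ∈ B.S x', B.DualMFCQ (pair x' y) := by
    by_contra hcon
    obtain ⟨xs, hxs, hbad⟩ := exists_seq_forall_of_frequently (not_eventually.mp hcon)
    push Not at hbad
    choose ys hys hnd using hbad
    obtain ⟨y, hy, σ, hσ, hlim⟩ := exists_S_subseq hB ⟨K, hK, hYK⟩ hinner hxs hys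
    obtain ⟨k, hk⟩ := (((hxs.comp hσ.tendsto_atTop).pair hlim).eventually
      ((hdual y hy).eventually hB)).exists
    exact hnd _ hk
  filter_upwards [hYK.eventually_nhds, hSne.eventually_nhds, hdual'] with x' h1 h2 h3
  obtain ⟨y', hy'⟩ := h2.self_of_nhds
  exact gradientMapAt_W hB
    ⟨⟨K, hK, h1⟩, innerSemicontinuousAt_of_dualMFCQ hB hy' (h3 y' hy'), h2⟩ h3

end BilevelProgram

/-- By Carathéodory, the hull is the continuous image of a simplex times a power of K. -/
theorem IsCompact.convexHull_of_finiteDimensional {E : Type*} [NormedAddCommGroup E]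
    [NormedSpace ℝ E] [FiniteDimensional ℝ E] {K : Set E} (hK : IsCompact K) : IsCompact (convexHull ℝ K) := by
  rcases K.eq_empty_or_nonempty with rfl | ⟨k₀, hk₀⟩
  · simp
  set N := Module.finrank ℝ E + 1 with hN
  have himg : convexHull ℝ K =
      (fun p : (Fin N → ℝ) × (Fin N → E) => ∑ i, p.1 i • p.2 i) ''
        (stdSimplex ℝ (Fin N) ×ˢ Set.univ.pi fun _ => K) := by
    ext x
    constructor
    · intro hx
      obtain ⟨ι, _, z, w, hz, hz', hw, hw1, hsum⟩ := eq_pos_convex_span_of_mem_convexHull hx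
      have hcard : Fintype.card ι ≤ Fintype.card (Fin N) := by
        rw [Fintype.card_fin]
        exact hz'.card_le_finrank_succ.trans (Nat.succ_le_succ (Submodule.finrank_le _))
      obtain ⟨e⟩ := Function.Embedding.nonempty_of_card_le hcard
      -- A shorter combination is padded with weight 0 at the point k₀.
      have hw' : ∀ i, Function.extend e w 0 (e i) = w i := fun i => e.injective.extend_apply _ _ _
      have hz'' : ∀ i, Function.extend e z (fun _ => k₀) (e i) = z i :=
        fun i => e.injective.extend_apply _ _ _
      have hout : ∀ j ∉ Set.range e, Function.extend e w 0 j = 0 := fun j hj => by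
        rw [Function.extend_apply' _ _ _ (by simpa using hj)]; rfl
      refine ⟨(Function.extend e w 0, Function.extend e z fun _ => k₀), ⟨⟨fun j => ?_, ?_⟩,
        fun j _ => ?_⟩, ?_⟩
      · by_cases hj : j ∈ Set.range e
        · obtain ⟨i, rfl⟩ := hj
          exact (hw i).le.trans_eq (hw' i).symm
        · exact (hout j hj).ge
      · rw [← hw1]
        exact (Fintype.sum_of_injective e e.injective _ _ hout fun i => (hw' i).symm).symm
      · by_cases hj : j ∈ Set.range e
        · obtain ⟨i, rfl⟩ := hj
          change Function.extend e z (fun _ => k₀) (e i) ∈ K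
          rw [hz'']
          exact hz ⟨i, rfl⟩
        · change Function.extend e z (fun _ => k₀) j ∈ K
          rw [Function.extend_apply' _ _ _ (by simpa using hj)]
          exact hk₀
      · rw [← hsum]
        exact (Fintype.sum_of_injective e e.injective _ _
          (fun j hj => by simp [hout j hj]) fun i => by simp only [hw', hz'']).symm
    · rintro ⟨⟨w, z⟩, ⟨hw, hz⟩, rfl⟩
      exact (convex_convexHull ℝ K).sum_mem (fun i _ => hw.1 i) hw.2 fun i _ =>
        subset_convexHull ℝ K (hz i trivial)
  rw [himg]
  exact ((isCompact_stdSimplex ℝ (Fin N)).prod (isCompact_univ_pi fun _ => hK)).image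
    (by fun_prop)

/-! ### Subgradients and gradients in blocks -/

section BlockSubdifferentials

variable {ι κ : Type} [Fintype ι] [Fintype κ]

theorem norm_pair_left (a : Vec ι) : ‖pair a (0 : Vec κ)‖ = ‖a‖ := by
  rw [← sq_eq_sq₀ (norm_nonneg _) (norm_nonneg _), ← real_inner_self_eq_norm_sq, inner_pair,
    inner_zero_left, add_zero, real_inner_self_eq_norm_sq]

theorem norm_pair_right (b : Vec κ) : ‖pair (0 : Vec ι) b‖ = ‖b‖ := by
  rw [← sq_eq_sq₀ (norm_nonneg _) (norm_nonneg _), ← real_inner_self_eq_norm_sq, inner_pair,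
    inner_zero_left, zero_add, real_inner_self_eq_norm_sq]

theorem norm_fstBlock_le (z : Vec (ι ⊕ κ)) : ‖fstBlock z‖ ≤ ‖z‖ := by
  rw [← sq_le_sq₀ (norm_nonneg _) (norm_nonneg _), ← real_inner_self_eq_norm_sq,
    ← real_inner_self_eq_norm_sq z, ← pair_fstBlock_sndBlock z, inner_pair, fstBlock_pair]
  linarith [real_inner_self_nonneg (x := sndBlock z)]

theorem pair_sub_pair_left (a a' : Vec ι) (b : Vec κ) : pair a' b - pair a b = pair (a' - a) 0 := by
  rw [← pair_sub, sub_self]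

theorem pair_sub_pair_right (a : Vec ι) (b b' : Vec κ) : pair a b' - pair a b = pair 0 (b' - b) := by
  rw [← pair_sub, sub_self]

theorem fstBlock_mem_regularSubdiff {φ : Vec (ι ⊕ κ) → ℝ} {a : Vec ι} {b : Vec κ}
    {ζ : Vec (ι ⊕ κ)} (h : ζ ∈ regularSubdiff φ (pair a b)) :
    fstBlock ζ ∈ regularSubdiff (fun a' => φ (pair a' b)) a := by
  intro ε hε
  have hc : Tendsto (fun a' : Vec ι => pair a' b) (𝓝 a) (𝓝 (pair a b)) :=
    tendsto_id.pair tendsto_const_nhds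
  filter_upwards [hc.eventually (h ε hε)] with a' ha'
  rw [pair_sub_pair_left, norm_pair_left, inner_pair_right, inner_zero_right, add_zero] at ha'
  exact ha'

theorem sndBlock_mem_regularSubdiff {φ : Vec (ι ⊕ κ) → ℝ} {a : Vec ι} {b : Vec κ}
    {ζ : Vec (ι ⊕ κ)} (h : ζ ∈ regularSubdiff φ (pair a b)) :
    sndBlock ζ ∈ regularSubdiff (fun b' => φ (pair a b')) b := by
  intro ε hε
  have hc : Tendsto (fun b' : Vec κ => pair a b') (𝓝 b) (𝓝 (pair a b)) :=
    tendsto_const_nhds.pair tendsto_id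
  filter_upwards [hc.eventually (h ε hε)] with b' hb'
  rw [pair_sub_pair_right, norm_pair_right, inner_pair_right, inner_zero_right, zero_add] at hb'
  exact hb'

theorem hasGradientAt_fstBlock_gradient {φ : Vec (ι ⊕ κ) → ℝ} {a : Vec ι} {b : Vec κ}
    (h : DifferentiableAt ℝ φ (pair a b)) :
    HasGradientAt (fun a' => φ (pair a' b)) (fstBlock (gradient φ (pair a b))) a := by
  have h0 : HasFDerivAt (fun a' : Vec ι => pair a' b)
      ((pairL (ι := ι) (κ := κ)).comp (ContinuousLinearMap.inl ℝ _ _)) a :=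
    ((pairL (ι := ι) (κ := κ)).hasFDerivAt).comp a (hasFDerivAt_prodMk_left a b)
  have h1 := (hasGradientAt_iff_hasFDerivAt.mp h.hasGradientAt).comp a h0
  rw [hasGradientAt_iff_hasFDerivAt]
  refine h1.congr_fderiv ?_
  ext w
  have : inner ℝ (gradient φ (pair a b)) (pair w 0) = inner ℝ (fstBlock (gradient φ (pair a b))) w := by
    rw [inner_pair_right, inner_zero_right, add_zero]
  exact this

theorem hasGradientAt_sndBlock_gradient {φ : Vec (ι ⊕ κ) → ℝ} {a : Vec ι} {b : Vec κ}
    (h : DifferentiableAt ℝ φ (pair a b)) :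
    HasGradientAt (fun b' => φ (pair a b')) (sndBlock (gradient φ (pair a b))) b := by
  have h0 : HasFDerivAt (fun b' : Vec κ => pair a b')
      ((pairL (ι := ι) (κ := κ)).comp (ContinuousLinearMap.inr ℝ _ _)) b :=
    ((pairL (ι := ι) (κ := κ)).hasFDerivAt).comp b (hasFDerivAt_prodMk_right a b)
  have h1 := (hasGradientAt_iff_hasFDerivAt.mp h.hasGradientAt).comp b h0
  rw [hasGradientAt_iff_hasFDerivAt]
  refine h1.congr_fderiv ?_
  ext w
  have : inner ℝ (gradient φ (pair a b)) (pair 0 w) = inner ℝ (sndBlock (gradient φ (pair a b))) w := by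
    rw [inner_pair_right, inner_zero_right, zero_add]
  exact this

theorem gradient_comp_fstBlock {φ : Vec ι → ℝ} (hφ : ContDiff ℝ 1 φ) (z : Vec (ι ⊕ κ)) :
    gradient (fun z : Vec (ι ⊕ κ) => φ (fstBlock z)) z = pair (gradient φ (fstBlock z)) 0 := by
  have hd : DifferentiableAt ℝ (fun z : Vec (ι ⊕ κ) => φ (fstBlock z))
      (pair (fstBlock z) (sndBlock z)) :=
    (hφ.comp contDiff_fstBlock).differentiable one_ne_zero _
  have h1 := (hasGradientAt_fstBlock_gradient hd).gradient
  have h2 := (hasGradientAt_sndBlock_gradient hd).gradient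
  simp only [fstBlock_pair, gradient_fun_const, pair_fstBlock_sndBlock] at h1 h2
  rw [← pair_fstBlock_sndBlock (gradient _ z), ← h1, ← h2]

end BlockSubdifferentials

/-! ### Subgradients of the value constraint -/

namespace BilevelProgram

variable {d s p q m n : ℕ} {B : BilevelProgram d s p q m n} {𝒲 : Vec (Fin d) → Set (Vec (Fin d))}
  {x : Vec (Fin d)}

theorem tendsto_one_div_succ : Tendsto (fun k : ℕ => 1 / ((k : ℝ) + 1)) atTop (𝓝 0) :=
  tendsto_one_div_add_atTop_nhds_zero_nat

theorem one_div_succ_pos (k : ℕ) : (0 : ℝ) < 1 / ((k : ℝ) + 1) := by positivity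

/-- For empty 𝒲 x, `descent` with e = 0 and c = 1 would give 0 ≤ -t. -/
theorem GradientMapAt.nonempty (h : B.GradientMapAt 𝒲 x) : (𝒲 x).Nonempty := by
  by_contra hemp
  rw [Set.not_nonempty_iff_eq_empty] at hemp
  obtain ⟨k, hk⟩ := (h.descent (fun k : ℕ => 1 / ((k : ℝ) + 1)) (fun _ => 0) 0 1 one_div_succ_pos
    tendsto_one_div_succ tendsto_const_nhds (by simp [hemp])).exists
  rw [smul_zero, add_zero, sub_self] at hk
  linarith [one_div_succ_pos k]

/-- Elements with norms tending to infinity at points tending to x would have a convergent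
subsequence by `closed`. -/
theorem GradientMapAt.exists_bound (h : B.GradientMapAt 𝒲 x) :
    ∃ R : ℝ, ∀ᶠ x' in 𝓝 x, ∀ w ∈ 𝒲 x', ‖w‖ ≤ R := by
  by_contra hcon
  push Not at hcon
  have hseq : ∀ k : ℕ, ∃ x', ‖x' - x‖ < 1 / ((k : ℝ) + 1) ∧ ∃ w ∈ 𝒲 x', (k : ℝ) < ‖w‖ := by
    intro k
    obtain ⟨x', h1, h2⟩ := ((hcon k).and_eventually
      (Metric.ball_mem_nhds x (one_div_succ_pos k))).exists
    exact ⟨x', by simpa [dist_eq_norm] using h2, h1⟩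
  choose xs hxs ws hws hlarge using hseq
  have hx : Tendsto xs atTop (𝓝 x) := tendsto_iff_norm_sub_tendsto_zero.mpr
    (squeeze_zero (fun _ => norm_nonneg _) (fun k => (hxs k).le) tendsto_one_div_succ)
  obtain ⟨w, -, σ, hσ, hlim⟩ := h.closed xs hx ws hws
  have h1 : Tendsto (fun k => (σ k : ℝ)) atTop atTop :=
    tendsto_natCast_atTop_atTop.comp hσ.tendsto_atTop
  exact not_tendsto_nhds_of_tendsto_atTop
    (tendsto_atTop_mono (fun k => (hlarge (σ k)).le) h1) _ hlim.norm

theorem GradientMapAt.isCompact_convexHull (h : B.GradientMapAt 𝒲 x) :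
    IsCompact (convexHull ℝ (𝒲 x)) :=
  IsCompact.convexHull_of_finiteDimensional (IsSeqCompact.isCompact fun _ hws =>
    h.closed _ (tendsto_const_nhds (x := x)) _ hws)

theorem GradientMapAt.exists_separation (h : B.GradientMapAt 𝒲 x) {w : Vec (Fin d)}
    (hw : w ∉ convexHull ℝ (𝒲 x)) :
    ∃ (e : Vec (Fin d)) (r : ℝ), inner ℝ w e < r ∧ ∀ w' ∈ 𝒲 x, r < inner ℝ w' e := by
  obtain ⟨f, r, h1, h2⟩ := geometric_hahn_banach_point_closed (convex_convexHull ℝ (𝒲 x))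
    h.isCompact_convexHull.isClosed hw
  have hf : ∀ w', f w' = inner ℝ w' ((InnerProductSpace.toDual ℝ _).symm f) := fun w' => by
    rw [real_inner_comm, InnerProductSpace.toDual_symm_apply]
  exact ⟨(InnerProductSpace.toDual ℝ _).symm f, r, by rwa [← hf],
    fun w' hw' => by rw [← hf]; exact h2 _ (subset_convexHull ℝ _ hw')⟩

/-- Outer semicontinuity of `co 𝒲`. -/
theorem GradientMapAt.closed_convexHull (h : B.GradientMapAt 𝒲 x) {xs : ℕ → Vec (Fin d)}
    (hx : Tendsto xs atTop (𝓝 x)) {ws : ℕ → Vec (Fin d)}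
    (hws : ∀ k, ws k ∈ convexHull ℝ (𝒲 (xs k))) :
    ∃ w ∈ convexHull ℝ (𝒲 x), ∃ σ : ℕ → ℕ, StrictMono σ ∧
      Tendsto (fun k => ws (σ k)) atTop (𝓝 w) := by
  obtain ⟨R, hR⟩ := h.exists_bound
  have hb : ∀ᶠ k in atTop, ws k ∈ Metric.closedBall (0 : Vec (Fin d)) R := by
    filter_upwards [hx.eventually hR] with k hk
    exact convexHull_min (fun w hw => by simpa using hk w hw) (convex_closedBall _ _) (hws k)
  obtain ⟨w, -, σ, hσ, hlim⟩ := tendsto_subseq_of_frequently_bounded Metric.isBounded_closedBall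
    hb.frequently
  refine ⟨w, ?_, σ, hσ, hlim⟩
  by_contra hw
  obtain ⟨e, r, h1, h2⟩ := h.exists_separation hw
  -- A linear function attains a value on 𝒲 no larger than at a given point of its convex hull; this
  -- brings the question back to `closed` for 𝒲 itself.
  have hex : ∀ k, ∃ w' ∈ 𝒲 (xs k), inner ℝ w' e ≤ inner ℝ (ws k) e := by
    intro k
    by_contra hcon
    push Not at hcon
    have hconv : Convex ℝ {w' : Vec (Fin d) | inner ℝ (ws k) e < inner ℝ w' e} :=
      convex_halfSpace_gt ⟨fun _ _ => inner_add_left _ _ _, fun _ _ => real_inner_smul_left _ _ _⟩ _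
    exact lt_irrefl (inner ℝ (ws k) e) (convexHull_min hcon hconv (hws k))
  choose ws' hws' hle using hex
  obtain ⟨w', hw', θ, hθ, hlim'⟩ := h.closed _ (hx.comp hσ.tendsto_atTop) _ fun k => hws' (σ k)
  have h3 : inner ℝ w' e ≤ inner ℝ w e :=
    le_of_tendsto_of_tendsto' (hlim'.inner tendsto_const_nhds)
      ((hlim.comp hθ.tendsto_atTop).inner tendsto_const_nhds) fun k => hle _
  linarith [h2 w' hw']

/-- Separate -ζ strictly from co 𝒲 by a direction e: `descent` makes V grow along e faster than the
subgradient ζ of -V allows. -/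
theorem GradientMapAt.neg_mem_convexHull (h : B.GradientMapAt 𝒲 x) {ζ : Vec (Fin d)}
    (hζ : ζ ∈ regularSubdiff (fun x' => -B.V x') x) : -ζ ∈ convexHull ℝ (𝒲 x) := by
  by_contra hcon
  obtain ⟨e, r, h1, h2⟩ := h.exists_separation hcon
  rw [inner_neg_left] at h1
  -- This makes ε‖e‖ smaller than the separation gap r + ⟨ζ, e⟩.
  set ε := (r + inner ℝ ζ e) / (2 * (‖e‖ + 1)) with hε
  have hen := norm_nonneg e
  have hε0 : 0 < ε := div_pos (by linarith) (by positivity)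
  have hεe : ε * (2 * (‖e‖ + 1)) = r + inner ℝ ζ e := by
    rw [hε]; field_simp
  have hx : Tendsto (fun k : ℕ => x + (1 / ((k : ℝ) + 1)) • e) atTop (𝓝 x) :=
    tendsto_add_smul tendsto_one_div_succ tendsto_const_nhds
  obtain ⟨k, hk1, hk2⟩ := ((h.descent _ (fun _ => e) e r one_div_succ_pos tendsto_one_div_succ
    tendsto_const_nhds h2).and_eventually (hx.eventually (hζ ε hε0))).exists
  have ht := one_div_succ_pos k
  set t : ℝ := 1 / ((k : ℝ) + 1) with htdef
  rw [add_sub_cancel_left, inner_smul_right, norm_smul, Real.norm_eq_abs, abs_of_pos ht] at hk2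
  have h3 : t * (r + inner ℝ ζ e) ≤ t * (ε * ‖e‖) := by linarith
  have h4 := le_of_mul_le_mul_left h3 ht
  nlinarith

/-- If the bound R + 1 failed along a sequence, its unit directions would accumulate at some e.
Elements of 𝒲 x have norm at most R, so ⟨w, e⟩ > -(R + 1), and `descent` contradicts the failure. -/
theorem GradientMapAt.calm (h : B.GradientMapAt 𝒲 x) :
    ∃ L : ℝ, ∀ᶠ x' in 𝓝 x, B.V x - B.V x' ≤ L * ‖x' - x‖ := by
  obtain ⟨R, hR⟩ := h.exists_bound
  refine ⟨R + 1, ?_⟩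
  by_contra hcon
  obtain ⟨xs, hxs, hbad⟩ := exists_seq_forall_of_frequently (not_eventually.mp hcon)
  push Not at hbad
  have hpos : ∀ k, 0 < ‖xs k - x‖ := by
    intro k
    rw [norm_pos_iff, sub_ne_zero]
    intro h0
    have := hbad k
    rw [h0] at this
    simp at this
  have hunit : ∀ k, (‖xs k - x‖)⁻¹ • (xs k - x) ∈ Metric.sphere (0 : Vec (Fin d)) 1 := fun k => by
    rw [mem_sphere_zero_iff_norm, norm_smul, norm_inv, norm_norm, inv_mul_cancel₀ (hpos k).ne']
  obtain ⟨e, he, σ, hσ, hlim⟩ := (isCompact_sphere (0 : Vec (Fin d)) 1).tendsto_subseq hunit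
  have ht0 : Tendsto (fun k => ‖xs (σ k) - x‖) atTop (𝓝 0) :=
    (tendsto_iff_norm_sub_tendsto_zero.mp hxs).comp hσ.tendsto_atTop
  obtain ⟨k, hk⟩ := (h.descent _ _ e (-(R + 1)) (fun k => hpos (σ k)) ht0 hlim (fun w hw => by
    have h1 := hR.self_of_nhds w hw
    have h2 := abs_real_inner_le_norm w e
    rw [mem_sphere_zero_iff_norm.mp he, mul_one] at h2
    linarith [neg_le_of_abs_le h2])).exists
  have h3 : x + ‖xs (σ k) - x‖ • ((fun k => (‖xs k - x‖)⁻¹ • (xs k - x)) ∘ σ) k = xs (σ k) := by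
    simp only [Function.comp_apply]
    rw [smul_smul, mul_inv_cancel₀ (hpos _).ne', one_smul, add_sub_cancel]
  rw [h3] at hk
  linarith [hbad (σ k)]

/-- The vector `∇f(x,y) - (w,0)`, regarded as a vector in the space of all variables. -/
noncomputable def valueGradient (B : BilevelProgram d s p q m n) (z : Var d s m n)
    (w : Vec (Fin d)) : Var d s m n :=
  pair (gradient B.f (fstBlock z) - pair w 0) 0

/-- Subtracting the smooth f leaves a subgradient of -V, which does not depend on y, u, v; the
corresponding blocks vanish and the x-block is the negative of an element of co 𝒲. -/
theorem mem_regularSubdiff_value (hB : B.Regular) {z : Var d s m n}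
    (h : B.GradientMapAt 𝒲 (fstBlock (fstBlock z))) {ζ : Var d s m n}
    (hζ : ζ ∈ regularSubdiff (B.cp.g (Sum.inl ())) z) :
    ∃ w ∈ convexHull ℝ (𝒲 (fstBlock (fstBlock z))), ζ = B.valueGradient z w := by
  have hf : HasGradientAt (fun z' : Var d s m n => -B.f (fstBlock z'))
      (-pair (gradient B.f (fstBlock z)) 0) z := by
    have h1 : ContDiff ℝ 1 (fun z' : Var d s m n => B.f (fstBlock z')) :=
      hB.f_smooth.comp contDiff_fstBlock
    have h2 := h1.hasGradientAt_gradient z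
    rw [gradient_comp_fstBlock hB.f_smooth, hasGradientAt_iff_hasFDerivAt] at h2
    rw [hasGradientAt_iff_hasFDerivAt]
    simpa using h2.fun_neg
  have h1 := add_mem_regularSubdiff hζ hf
  set ζ' := ζ + -pair (gradient B.f (fstBlock z)) 0 with hζ'
  have h2 : ζ' ∈ regularSubdiff (fun z' : Var d s m n => -B.V (fstBlock (fstBlock z')))
      (pair (pair (fstBlock (fstBlock z)) (sndBlock (fstBlock z))) (sndBlock z)) := by
    simp only [pair_fstBlock_sndBlock]
    refine regularSubdiff_congr (Eventually.of_forall fun z' => ?_) h1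
    simp only [cp, Sum.elim_inl]
    ring
  have h3 := sndBlock_mem_regularSubdiff h2
  have h4 := fstBlock_mem_regularSubdiff h2
  have h5 := sndBlock_mem_regularSubdiff h4
  simp only [fstBlock_pair] at h3 h5
  replace h3 := eq_of_mem_regularSubdiff_of_hasGradientAt (hasGradientAt_const _ _) h3
  replace h5 := eq_of_mem_regularSubdiff_of_hasGradientAt (hasGradientAt_const _ _) h5
  have h6 := h.neg_mem_convexHull (fstBlock_mem_regularSubdiff h4)
  refine ⟨_, h6, ?_⟩
  have h7 : ζ' = pair (pair (fstBlock (fstBlock ζ')) 0) 0 := by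
    rw [← h5, pair_fstBlock_sndBlock, ← h3, pair_fstBlock_sndBlock]
  have h8 : ζ = ζ' + pair (gradient B.f (fstBlock z)) 0 := by rw [hζ']; abel
  rw [valueGradient, h8]
  nth_rewrite 1 [h7]
  rw [← pair_add, add_zero]
  congr 1
  have h9 : pair (-fstBlock (fstBlock ζ')) (0 : Vec (Fin s)) = -pair (fstBlock (fstBlock ζ')) 0 := by
    ext (i | i) <;> simp
  rw [h9]
  abel

theorem continuous_valueGradient (hB : B.Regular) :
    Continuous fun pr : Var d s m n × Vec (Fin d) => B.valueGradient pr.1 pr.2 := by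
  have h1 := hB.f_smooth.continuous_gradient
  unfold valueGradient
  fun_prop

theorem mem_limitingSubdiff_value (hB : B.Regular) {z : Var d s m n}
    (h : ∀ᶠ x' in 𝓝 (fstBlock (fstBlock z)), B.GradientMapAt 𝒲 x') {ζ : Var d s m n}
    (hζ : ζ ∈ limitingSubdiff (B.cp.g (Sum.inl ())) z) :
    ∃ w ∈ convexHull ℝ (𝒲 (fstBlock (fstBlock z))), ζ = B.valueGradient z w := by
  obtain ⟨zs, ζs, hz, -, hmem, hlim⟩ := hζ
  have hx : Tendsto (fun k => fstBlock (fstBlock (zs k))) atTop (𝓝 (fstBlock (fstBlock z))) :=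
    ((continuous_fstBlock.comp continuous_fstBlock).tendsto _).comp hz
  obtain ⟨N, hN⟩ := eventually_atTop.mp (hx.eventually h)
  choose ws hws heq using fun k => mem_regularSubdiff_value hB (hN (k + N) (by omega)) (hmem (k + N))
  have hNt := tendsto_add_atTop_nat N
  obtain ⟨w, hw, σ, hσ, hwlim⟩ := h.self_of_nhds.closed_convexHull (hx.comp hNt) hws
  have hσN := hNt.comp hσ.tendsto_atTop
  refine ⟨w, hw, tendsto_nhds_unique (hlim.comp hσN) ?_⟩
  have h1 := ((continuous_valueGradient hB).tendsto (z, w)).comp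
    ((hz.comp hσN).prodMk_nhds hwlim)
  refine h1.congr fun k => ?_
  exact (heq (σ k)).symm

theorem eventually_fst_fst {P : Vec (Fin d) → Prop} {z : Var d s m n}
    (h : ∀ᶠ x' in 𝓝 (fstBlock (fstBlock z)), P x') :
    ∀ᶠ z' in 𝓝 z, P (fstBlock (fstBlock z')) :=
  ((continuous_fstBlock.comp continuous_fstBlock).tendsto z).eventually h

theorem continuousAt_value (hB : B.Regular) {z : Var d s m n}
    (h : B.GradientMapAt 𝒲 (fstBlock (fstBlock z))) : ContinuousAt (B.cp.g (Sum.inl ())) z := by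
  have h1 : ContinuousAt (fun z : Var d s m n => B.V (fstBlock (fstBlock z))) z :=
    ContinuousAt.comp (f := fun z : Var d s m n => fstBlock (fstBlock z)) h.continuousAt
      (continuous_fstBlock.comp continuous_fstBlock).continuousAt
  exact (hB.f_smooth.continuous.comp continuous_fstBlock).continuousAt.sub h1

theorem calm_value (hB : B.Regular) {z : Var d s m n}
    (h : B.GradientMapAt 𝒲 (fstBlock (fstBlock z))) : ∃ L : ℝ, ∀ᶠ z' in 𝓝 z,
      B.cp.g (Sum.inl ()) z' - B.cp.g (Sum.inl ()) z ≤ L * ‖z' - z‖ := by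
  obtain ⟨L, hL⟩ := h.calm
  have h1 : ContDiff ℝ 1 (fun z' : Var d s m n => B.f (fstBlock z')) :=
    hB.f_smooth.comp contDiff_fstBlock
  obtain ⟨K, t, ht, hK⟩ := h1.locallyLipschitz z
  refine ⟨K + |L|, ?_⟩
  filter_upwards [ht, eventually_fst_fst hL] with z' hz' hL'
  have h2 := hK.dist_le_mul z' hz' z (mem_of_mem_nhds ht)
  rw [Real.dist_eq, dist_eq_norm] at h2
  have h3 := le_of_abs_le h2
  have h4 : ‖fstBlock (fstBlock z') - fstBlock (fstBlock z)‖ ≤ ‖z' - z‖ :=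
    (norm_fstBlock_le (fstBlock (z' - z))).trans (norm_fstBlock_le _)
  have h5 : L * ‖fstBlock (fstBlock z') - fstBlock (fstBlock z)‖ ≤ |L| * ‖z' - z‖ := by
    calc _ ≤ |L| * ‖fstBlock (fstBlock z') - fstBlock (fstBlock z)‖ := by
          gcongr; exact le_abs_self L
      _ ≤ _ := by gcongr
  simp only [cp, Sum.elim_inl]
  linarith

theorem eventually_bounded_regularSubdiff_value (hB : B.Regular) {z : Var d s m n}
    (h : ∀ᶠ x' in 𝓝 (fstBlock (fstBlock z)), B.GradientMapAt 𝒲 x') :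
    ∃ R : ℝ, ∀ᶠ z' in 𝓝 z, ∀ ζ ∈ regularSubdiff (B.cp.g (Sum.inl ())) z', ‖ζ‖ ≤ R := by
  obtain ⟨R, hR⟩ := h.self_of_nhds.exists_bound
  have hf : ∀ᶠ z' in 𝓝 z, ‖gradient B.f (fstBlock z')‖ < ‖gradient B.f (fstBlock z)‖ + 1 :=
    ((hB.f_smooth.continuous_gradient.comp continuous_fstBlock).norm.tendsto z).eventually
      (gt_mem_nhds (by simp))
  refine ⟨‖gradient B.f (fstBlock z)‖ + 1 + R, ?_⟩
  filter_upwards [eventually_fst_fst h, eventually_fst_fst hR, hf] with z' h1 h2 h3 ζ hζ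
  obtain ⟨w, hw, rfl⟩ := mem_regularSubdiff_value hB h1 hζ
  have hwR : ‖w‖ ≤ R := by
    have := convexHull_min (t := Metric.closedBall (0 : Vec (Fin d)) R)
      (fun w hw => by simpa using h2 w hw) (convex_closedBall _ _) hw
    simpa using this
  rw [valueGradient, norm_pair_left]
  refine (norm_sub_le _ _).trans ?_
  rw [norm_pair_left]
  linarith

end BilevelProgram

/-! ### Constraint gradients of (CP) and the rows of J' -/

theorem hasGradientAt_const_add_inner {E : Type*} [NormedAddCommGroup E] [InnerProductSpace ℝ E]
    [CompleteSpace E] (c : ℝ) (q x : E) : HasGradientAt (fun x' => c + inner ℝ q x') q x := by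
  rw [hasGradientAt_iff_hasFDerivAt]
  exact ((InnerProductSpace.toDual ℝ E q).hasFDerivAt (x := x)).const_add c

theorem gradient_neg {E : Type*} [NormedAddCommGroup E] [InnerProductSpace ℝ E]
    [CompleteSpace E] (φ : E → ℝ) (x : E) : gradient (fun x' => -φ x') x = -gradient φ x := by
  simp [gradient, fderiv_fun_neg]

namespace BilevelProgram

variable {d s p q m n : ℕ} {B : BilevelProgram d s p q m n}

theorem Regular.contDiff_gradYLagrangian (hB : B.Regular) :
    ContDiff ℝ 1 fun z : Var d s m n =>
      B.gradYLagrangian (fstBlock (sndBlock z)) (sndBlock (sndBlock z)) (fstBlock z) := by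
  have hu : ∀ i, ContDiff ℝ 1 fun z : Var d s m n => fstBlock (sndBlock z) i := fun i =>
    contDiff_euclidean.mp (contDiff_fstBlock.comp contDiff_sndBlock) i
  have hv : ∀ i, ContDiff ℝ 1 fun z : Var d s m n => sndBlock (sndBlock z) i := fun i =>
    contDiff_euclidean.mp (contDiff_sndBlock.comp contDiff_sndBlock) i
  exact ((hB.f_gradY_smooth.comp contDiff_fstBlock).add (ContDiff.sum fun i _ =>
    (hu i).smul ((hB.g_gradY_smooth i).comp contDiff_fstBlock))).add (ContDiff.sum fun i _ =>
    (hv i).smul ((hB.h_gradY_smooth i).comp contDiff_fstBlock))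

theorem gradYLagrangian_apply (u : Vec (Fin m)) (v : Vec (Fin n)) (w : Vec (Fin d ⊕ Fin s))
    (j : Fin s) : B.gradYLagrangian u v w j = gradY B.f w j +
      inner ℝ (pair (WithLp.toLp 2 fun i => gradY (B.g i) w j)
        (WithLp.toLp 2 fun i => gradY (B.h i) w j)) (pair u v) := by
  rw [inner_pair]
  simp only [gradYLagrangian, PiLp.add_apply, WithLp.ofLp_sum, Finset.sum_apply, PiLp.smul_apply,
    smul_eq_mul, PiLp.inner_apply, RCLike.inner_apply, conj_trivial]
  ring

/-- The first block freezes the multipliers; the second is immediate since the Lagrangian gradient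
is affine in (u, v). -/
theorem gradient_gradYLagrangian (hB : B.Regular) (z : Var d s m n) (j : Fin s) :
    gradient (fun z : Var d s m n => B.gradYLagrangian (fstBlock (sndBlock z))
        (sndBlock (sndBlock z)) (fstBlock z) j) z =
      pair (gradient (fun w => B.gradYLagrangian (fstBlock (sndBlock z)) (sndBlock (sndBlock z)) w j)
          (fstBlock z))
        (pair (WithLp.toLp 2 fun i => gradY (B.g i) (fstBlock z) j)
          (WithLp.toLp 2 fun i => gradY (B.h i) (fstBlock z) j)) := by
  set φ := fun z : Var d s m n => B.gradYLagrangian (fstBlock (sndBlock z))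
        (sndBlock (sndBlock z)) (fstBlock z) j with hφ
  have hd : DifferentiableAt ℝ φ (pair (fstBlock z) (sndBlock z)) :=
    (contDiff_euclidean.mp hB.contDiff_gradYLagrangian j).differentiable one_ne_zero _
  have h1 := (hasGradientAt_fstBlock_gradient hd).gradient
  have h2 := hasGradientAt_sndBlock_gradient hd
  simp only [hφ, fstBlock_pair, sndBlock_pair] at h1 h2
  have h3 := h2.unique ((hasGradientAt_const_add_inner (gradY B.f (fstBlock z) j)
    (pair (WithLp.toLp 2 fun i => gradY (B.g i) (fstBlock z) j)
      (WithLp.toLp 2 fun i => gradY (B.h i) (fstBlock z) j)) (sndBlock z)).congr_of_eventuallyEq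
        (Eventually.of_forall fun b =>
          (gradYLagrangian_apply _ _ _ j).trans (by rw [pair_fstBlock_sndBlock])))
  simp only [pair_fstBlock_sndBlock] at h1 h3
  rw [← pair_fstBlock_sndBlock (gradient φ z), h1, ← h3]

theorem gradient_multiplier (z : Var d s m n) (i : Fin m) :
    gradient (B.cp.H i) z = pair 0 (pair (EuclideanSpace.single i 1) 0) := by
  refine HasGradientAt.gradient ?_
  refine (hasGradientAt_const_add_inner 0 _ z).congr_of_eventuallyEq
    (Eventually.of_forall fun z' => ?_)
  simp only [cp]
  rw [real_inner_comm, inner_pair_right, inner_pair_right, EuclideanSpace.inner_single_right]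
  simp

theorem gradient_neg_comp_fstBlock (hB : B.Regular) (z : Var d s m n) (i : Fin m) :
    gradient (B.cp.G i) z = -pair (gradient (B.g i) (fstBlock z)) 0 := by
  rw [← gradient_comp_fstBlock (hB.g_smooth i), ← gradient_neg]
  rfl

/-- The passage from the variables `((x,y),(u,v))` to the columns `(x,y)`, `v`, `u`. -/
noncomputable def columnEquiv (d s m n : ℕ) :
    Var d s m n ≃ₗ[ℝ] ((Fin d ⊕ Fin s) ⊕ Fin n ⊕ Fin m → ℝ) :=
  (WithLp.linearEquiv 2 ℝ _).trans
    (LinearEquiv.funCongrLeft ℝ ℝ ((Equiv.refl _).sumCongr (Equiv.sumComm _ _)))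

theorem columnEquiv_pair (a : Vec (Fin d ⊕ Fin s)) (b : Vec (Fin m)) (c : Vec (Fin n)) :
    columnEquiv d s m n (pair a (pair b c)) = Sum.elim a.ofLp (Sum.elim c.ofLp b.ofLp) := by
  ext (i | i | i) <;> rfl

theorem columnEquiv_pair_zero (a : Vec (Fin d ⊕ Fin s)) :
    columnEquiv d s m n (pair a 0) = Sum.elim a.ofLp 0 := by
  ext (i | i | i) <;> rfl

/-- After exchanging the columns of u and v the vectors are the rows of the matrix, up to the sign
of the rows of g. For α = 0 the last row vanishes and w plays no role. -/
theorem finrank_gradientSet (hB : B.Regular) (I₄ : Set (Unit ⊕ Fin p)) (P Q : Set (Fin m))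
    (z : Var d s m n) (v : Unit ⊕ Fin p → Var d s m n) (α : ℝ) (w : Vec (Fin d))
    (hG : ∀ i, Sum.inr i ∈ I₄ → v (Sum.inr i) = gradient (B.cp.g (Sum.inr i)) z)
    (hV : Sum.inl () ∈ I₄ → α = 1 ∧ v (Sum.inl ()) = B.valueGradient z w)
    (hα : Sum.inl () ∉ I₄ → α = 0) :
    Set.finrank ℝ (B.cp.gradientSet I₄ P Q z v) =
      (B.Jmat {i | Sum.inr i ∈ I₄} P Q (fstBlock (fstBlock z)) (sndBlock (fstBlock z))
        (fstBlock (sndBlock z)) (sndBlock (sndBlock z)) α w).rank := by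
  rw [Matrix.rank_eq_finrank_span_row, Set.finrank,
    ← LinearEquiv.finrank_map_eq (columnEquiv d s m n), Submodule.map_span]
  have hGi : ∀ i, gradient (B.cp.g (Sum.inr i)) z = pair (gradient (B.G i) (fstBlock z)) 0 :=
    fun i => gradient_comp_fstBlock (hB.G_smooth i) z
  have hHi : ∀ i, gradient (B.cp.h (Sum.inl i)) z = pair (gradient (B.H i) (fstBlock z)) 0 :=
    fun i => gradient_comp_fstBlock (hB.H_smooth i) z
  have hhi : ∀ i, gradient (B.cp.h (Sum.inr (Sum.inl i))) z =
      pair (gradient (B.h i) (fstBlock z)) 0 := fun i => gradient_comp_fstBlock (hB.h_smooth i) z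
  have hLj := gradient_gradYLagrangian hB z
  set J := B.Jmat {i | Sum.inr i ∈ I₄} P Q (fstBlock (fstBlock z)) (sndBlock (fstBlock z))
        (fstBlock (sndBlock z)) (sndBlock (sndBlock z)) α w with hJ
  have hr1 : ∀ j, J.row (Sum.inl j) = columnEquiv d s m n
      (gradient (B.cp.h (Sum.inr (Sum.inr j))) z) := fun j => by
    refine Eq.trans ?_ (congrArg _ (hLj j)).symm
    rw [columnEquiv_pair, ← pair_fstBlock_sndBlock (fstBlock z)]
    rfl
  have hr2 : ∀ i, J.row (Sum.inr (Sum.inl i)) = columnEquiv d s m n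
      (gradient (B.cp.h (Sum.inr (Sum.inl i))) z) := fun i => by
    rw [hhi, columnEquiv_pair_zero, ← pair_fstBlock_sndBlock (fstBlock z)]; rfl
  have hr3 : ∀ i, J.row (Sum.inr (Sum.inr (Sum.inl i))) = columnEquiv d s m n
      (gradient (B.cp.h (Sum.inl i)) z) := fun i => by
    rw [hHi, columnEquiv_pair_zero, ← pair_fstBlock_sndBlock (fstBlock z)]; rfl
  have hr4 : ∀ i, J.row (Sum.inr (Sum.inr (Sum.inr (Sum.inl i)))) = columnEquiv d s m n
      (v (Sum.inr i)) := fun i => by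
    rw [hG i i.2, hGi, columnEquiv_pair_zero, ← pair_fstBlock_sndBlock (fstBlock z)]; rfl
  have hr5 : ∀ i, J.row (Sum.inr (Sum.inr (Sum.inr (Sum.inr (Sum.inl i))))) =
      -columnEquiv d s m n (gradient (B.cp.G i) z) := fun i => by
    rw [gradient_neg_comp_fstBlock hB, map_neg, neg_neg, columnEquiv_pair_zero,
      ← pair_fstBlock_sndBlock (fstBlock z)]; rfl
  have hr6 : ∀ i, J.row (Sum.inr (Sum.inr (Sum.inr (Sum.inr (Sum.inr (Sum.inl i)))))) =
      columnEquiv d s m n (gradient (B.cp.H i) z) := fun i => by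
    rw [gradient_multiplier, columnEquiv_pair]; rfl
  have hr7 : J.row (Sum.inr (Sum.inr (Sum.inr (Sum.inr (Sum.inr (Sum.inr ())))))) =
      α • columnEquiv d s m n (B.valueGradient z w) := by
    rw [valueGradient, ← map_smul, smul_pair, smul_zero, columnEquiv_pair_zero,
      ← pair_fstBlock_sndBlock (fstBlock z)]; rfl
  have hrow : ∀ r, J.row r ∈ Submodule.span ℝ (Set.range J.row) := fun r =>
    Submodule.subset_span ⟨r, rfl⟩
  have hgen : ∀ a ∈ B.cp.gradientSet I₄ P Q z v, columnEquiv d s m n a ∈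
      Submodule.span ℝ (columnEquiv d s m n '' B.cp.gradientSet I₄ P Q z v) := fun a ha =>
    Submodule.subset_span ⟨a, ha, rfl⟩
  refine congrArg (fun V : Submodule ℝ _ => Module.finrank ℝ V) (Submodule.span_eq_span ?_ ?_)
  · rintro _ ⟨a, ((⟨i, hi, rfl⟩ | ⟨i, rfl⟩) | ⟨i, hi, rfl⟩) | ⟨i, hi, rfl⟩, rfl⟩
    · rcases i with i | i
      · obtain ⟨rfl, h2⟩ := hV hi
        have := hrow (Sum.inr (Sum.inr (Sum.inr (Sum.inr (Sum.inr (Sum.inr ()))))))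
        rw [hr7, one_smul, ← h2] at this
        exact this
      · have := hrow (Sum.inr (Sum.inr (Sum.inr (Sum.inl ⟨i, hi⟩))))
        rwa [hr4] at this
    · rcases i with i | i | i
      · exact hr3 i ▸ hrow _
      · exact hr2 i ▸ hrow _
      · exact hr1 i ▸ hrow _
    · have := hrow (Sum.inr (Sum.inr (Sum.inr (Sum.inr (Sum.inl ⟨i, hi⟩)))))
      rw [hr5] at this
      exact neg_mem_iff.mp this
    · have := hrow (Sum.inr (Sum.inr (Sum.inr (Sum.inr (Sum.inr (Sum.inl ⟨i, hi⟩))))))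
      rwa [hr6] at this
  · rintro _ ⟨i | i | i | i | i | i | i, rfl⟩
    · exact hr1 i ▸ hgen _ (Or.inl (Or.inl (Or.inr ⟨_, rfl⟩)))
    · exact hr2 i ▸ hgen _ (Or.inl (Or.inl (Or.inr ⟨_, rfl⟩)))
    · exact hr3 i ▸ hgen _ (Or.inl (Or.inl (Or.inr ⟨_, rfl⟩)))
    · exact hr4 i ▸ hgen _ (Or.inl (Or.inl (Or.inl ⟨_, i.2, rfl⟩)))
    · exact hr5 i ▸ neg_mem (hgen _ (Or.inl (Or.inr ⟨_, i.2, rfl⟩)))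
    · exact hr6 i ▸ hgen _ (Or.inr ⟨_, i.2, rfl⟩)
    · rw [hr7]
      by_cases h : Sum.inl () ∈ I₄
      · rw [← (hV h).2]
        exact Submodule.smul_mem _ _ (hgen _ (Or.inl (Or.inl (Or.inl ⟨_, h, rfl⟩))))
      · rw [hα h, zero_smul]
        exact Submodule.zero_mem _

theorem limitingSubdiff_cp_inr (hB : B.Regular) (i : Fin p) (z : Var d s m n) :
    limitingSubdiff (B.cp.g (Sum.inr i)) z = {gradient (B.cp.g (Sum.inr i)) z} :=
  limitingSubdiff_of_contDiff ((hB.G_smooth i).comp contDiff_fstBlock) z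

/-- The elements w_k representing the subgradients of f - V converge only along subsequences. A
failure of the rank condition is therefore assumed on a subsequence, refined until w_k converges,
and refuted by the hypothesis on J'. -/
theorem strongRCRCQ_of_constantRank (hB : B.Regular) {𝒲 : Vec (Fin d) → Set (Vec (Fin d))}
    {x : Vec (Fin d)} {y : Vec (Fin s)} {u : Vec (Fin m)} {v : Vec (Fin n)}
    (h𝒲 : ∀ᶠ x' in 𝓝 x, B.GradientMapAt 𝒲 x') (hrank : B.ConstantRank 𝒲 x y u v) :
    B.cp.StrongRCRCQ (point x y u v) := by
  classical
  intro I₄ I₅ I₆ h₄ h₅ h₆ v₀ hv₀ zs vs hz hvs hlim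
  by_contra hcon
  obtain ⟨σ, hσ, hbad⟩ := extraction_of_frequently_atTop (not_eventually.mp hcon)
  have hx : Tendsto (fun k => fstBlock (fstBlock (zs k))) atTop (𝓝 x) :=
    ((continuous_fstBlock.comp continuous_fstBlock).tendsto (point x y u v)).comp hz
  obtain ⟨N, hN⟩ := eventually_atTop.mp (hx.eventually h𝒲.eventually_nhds)
  set ρ : ℕ → ℕ := fun k => σ (k + N) with hρ
  have hρt : Tendsto ρ atTop atTop := hσ.tendsto_atTop.comp (tendsto_add_atTop_nat N)
  have hρN : ∀ k, N ≤ ρ k := fun k => (Nat.le_add_left N k).trans (hσ.id_le _)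
  have hw : ∀ k, ∃ w ∈ convexHull ℝ (𝒲 (fstBlock (fstBlock (zs (ρ k))))),
      Sum.inl () ∈ I₄ → vs (ρ k) (Sum.inl ()) = B.valueGradient (zs (ρ k)) w := by
    intro k
    have hk := hN _ (hρN k)
    by_cases h : Sum.inl () ∈ I₄
    · obtain ⟨w, hw, heq⟩ := mem_limitingSubdiff_value hB hk (hvs (ρ k) _ h)
      exact ⟨w, hw, fun _ => heq⟩
    -- When the value constraint is not selected, any w serves: α = 0 removes it from the matrix.
    · obtain ⟨w, hw⟩ := hk.self_of_nhds.nonempty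
      exact ⟨w, subset_convexHull ℝ _ hw, fun h' => (h h').elim⟩
  choose ws hws heq using hw
  obtain ⟨w, hwm, θ, hθ, hwlim⟩ :=
    h𝒲.self_of_nhds.closed_convexHull (hx.comp hρt) hws
  have hτ : Tendsto (fun k => ρ (θ k)) atTop atTop := hρt.comp hθ.tendsto_atTop
  have hzτ := hz.comp hτ
  have hv₀w : Sum.inl () ∈ I₄ → v₀ (Sum.inl ()) = B.valueGradient (point x y u v) w := fun h => by
    refine tendsto_nhds_unique ((hlim _ h).comp hτ) ?_
    refine (((continuous_valueGradient hB).tendsto (point x y u v, w)).comp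
      (hzτ.prodMk_nhds hwlim)).congr fun k => ?_
    exact (heq (θ k) h).symm
  set α : ℝ := if Sum.inl () ∈ I₄ then 1 else 0 with hα
  have hα1 : Sum.inl () ∈ I₄ → α = 1 := fun h => if_pos h
  have hα0 : Sum.inl () ∉ I₄ → α = 0 := fun h => if_neg h
  have hα01 : α = 0 ∨ α = 1 := by
    by_cases h : Sum.inl () ∈ I₄
    · exact Or.inr (hα1 h)
    · exact Or.inl (hα0 h)
  have hf := (continuous_fstBlock (ι := Fin d ⊕ Fin s) (κ := Fin m ⊕ Fin n)).tendsto (point x y u v)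
  have hs := (continuous_sndBlock (ι := Fin d ⊕ Fin s) (κ := Fin m ⊕ Fin n)).tendsto (point x y u v)
  obtain ⟨k, hk⟩ := (hrank {i | Sum.inr i ∈ I₄} I₅ I₆ (fun i hi => h₄ hi) h₅ h₆ α hα01 w hwm
    (fun k => fstBlock (fstBlock (zs (ρ (θ k))))) (fun k => sndBlock (fstBlock (zs (ρ (θ k)))))
    (fun k => fstBlock (sndBlock (zs (ρ (θ k))))) (fun k => sndBlock (sndBlock (zs (ρ (θ k)))))
    (fun k => ws (θ k))
    (hx.comp hτ) ((continuous_sndBlock.tendsto (pair x y)).comp (hf.comp hzτ))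
    ((continuous_fstBlock.tendsto (pair u v)).comp (hs.comp hzτ))
    ((continuous_sndBlock.tendsto (pair u v)).comp (hs.comp hzτ)) hwlim
    (fun k => hws (θ k))).exists
  refine hbad (θ k + N) ?_
  rw [finrank_gradientSet hB I₄ _ _ (zs (ρ (θ k))) _ α (ws (θ k))
      (fun i hi => by
        have := hvs (ρ (θ k)) _ hi
        rwa [limitingSubdiff_cp_inr hB] at this)
      (fun h => ⟨hα1 h, heq (θ k) h⟩) hα0,
    finrank_gradientSet hB I₄ _ _ (point x y u v) _ α w
      (fun i hi => by
        have := hv₀ _ hi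
        rwa [limitingSubdiff_cp_inr hB] at this)
      (fun h => ⟨hα1 h, hv₀w h⟩) hα0]
  exact hk

theorem rcrcq_and_mStationary (hB : B.Regular) {𝒲 : Vec (Fin d) → Set (Vec (Fin d))}
    {x : Vec (Fin d)} {y : Vec (Fin s)} {u : Vec (Fin m)} {v : Vec (Fin n)}
    (hsol : B.cp.IsLocalSolution B.cpObjective (point x y u v))
    (h𝒲 : ∀ᶠ x' in 𝓝 x, B.GradientMapAt 𝒲 x') (hrank : B.ConstantRank 𝒲 x y u v) :
    B.cp.RCRCQ (point x y u v) ∧ B.cp.MStationary B.cpObjective (point x y u v) := by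
  have hcq := strongRCRCQ_of_constantRank hB h𝒲 hrank
  have h𝒲z : ∀ᶠ x' in 𝓝 (fstBlock (fstBlock (point x y u v))), B.GradientMapAt 𝒲 x' := h𝒲
  obtain ⟨R, hR⟩ := eventually_bounded_regularSubdiff_value hB h𝒲z
  refine ⟨hcq.rcrcq, FeasSystem.mStationary_of_strongRCRCQ ?_
    (fun i => (hB.G_smooth i).comp contDiff_fstBlock) ?_
    (fun i => ((hB.g_smooth i).comp contDiff_fstBlock).neg) (fun i => ?_)
    ((eventually_fst_fst h𝒲z).mono fun z hz => continuousAt_value hB hz)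
    ((eventually_fst_fst h𝒲z).mono fun z hz => calm_value hB hz) hR hsol hcq⟩
  · exact hB.F_lip.comp
      (contDiff_fstBlock (ι := Fin d ⊕ Fin s) (κ := Fin m ⊕ Fin n) (n := 1)).locallyLipschitz
  · rintro (i | i | j)
    · exact (hB.H_smooth i).comp contDiff_fstBlock
    · exact (hB.h_smooth i).comp contDiff_fstBlock
    · exact contDiff_euclidean.mp hB.contDiff_gradYLagrangian j
  · exact contDiff_euclidean.mp (contDiff_fstBlock.comp contDiff_sndBlock) i

end BilevelProgram

/-! ### The two cases of the theorem -/

theorem theorem5p3 {d s p q m n : ℕ} (B : BilevelProgram d s p q m n) (hB : B.Regular)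
    (x : Vec (Fin d)) (y : Vec (Fin s)) (u : Vec (Fin m)) (v : Vec (Fin n))
    (hsol : B.cp.IsLocalSolution B.cpObjective (BilevelProgram.point x y u v))
    (hcase :
      ((∃ Y₀ : Set (Vec (Fin s)), IsCompact Y₀ ∧ ∀ x', B.Y x' = Y₀) ∧
        B.ConstantRank B.WFixed x y u v) ∨
      ((∃ U ∈ 𝓝 x, Bornology.IsBounded (⋃ x' ∈ U, B.Y x')) ∧
        (∀ y' ∈ B.S x, B.MFCQ x y') ∧
        B.ConstantRank B.W x y u v)) :
    B.cp.RCRCQ (BilevelProgram.point x y u v) ∧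
      B.cp.MStationary B.cpObjective (BilevelProgram.point x y u v) := by
  -- Neither case assumes that Y(x) is nonempty; feasibility of the local solution supplies it.
  have hy : y ∈ B.Y x :=
    ⟨fun i => neg_nonneg.mp (hsol.1.2.2 i).1, fun i => hsol.1.2.1 (Sum.inr (Sum.inl i))⟩
  rcases hcase with ⟨⟨Y₀, hY₀, hY⟩, hrank⟩ | ⟨hbdd, hcq, hrank⟩
  · exact BilevelProgram.rcrcq_and_mStationary hB hsol (Eventually.of_forall
      (BilevelProgram.gradientMapAt_WFixed hB hY₀ hY ⟨y, hY x ▸ hy⟩)) hrank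
  · exact BilevelProgram.rcrcq_and_mStationary hB hsol
      (BilevelProgram.eventually_gradientMapAt_W hB ⟨y, hy⟩ hbdd hcq) hrank
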